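/- Work in $\mathbb R^2$ with the lattice $\mathbb Z^2$ and the standard inner product. A rational (lattice) polygon is a two-dimensional convex hull of finitely many points of $\mathbb Q^2$ (of $\mathbb Z^2$); its denominator $\mathrm{denom}(P)$ is the least $d\ge 1$ such that $dP$ is a lattice polygon, and $P$ is called half-integral if $2P$ is a lattice polygon, i.e. $\mathrm{denom}(P)\mid 2$. Write $l(P)=|P\cap\mathbb Z^2|$ and $i(P)=|\mathrm{int}(P)\cap\mathbb Z^2|$. The Ehrhart quasi-polynomial $\mathrm{ehr}_P(t)=e_2(t)t^2+e_1(t)t+e_0(t)$ is the quasi-polynomial (periodic coefficient functions $e_j:\mathbb Z\to\mathbb Q$) with $\mathrm{ehr}_P(k)=l(kP)$ for all integers $k\ge 1$; $P$ is pseudo-integral if its quasi-period (the least common multiple of the periods of the $e_j$) is $1$. The dual of $P$ is $P^*=\{y\in\mathbb R^2 : \langle y,x\rangle\ge -1\ \forall x\in P\}$. The lattice distance of a point $x$ from an edge whose affine hull is $\{y:\langle n,y\rangle=b\}$, with $n\in\mathbb Z^2$ primitive, is $|\langle n,x\rangle-b|$. An LDP polygon is a lattice polygon with $0$ in its interior all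 of whose vertices are primitive lattice vectors; its Gorenstein index is $\mathrm{denom}(Q^*)$. **Theorem.** Let $P\subseteq\mathbb R^2$ be a half-integral polygon with $0\in\mathrm{int}(P)$. The following are equivalent: 1. $P^*$ is an LDP polygon; 2. every edge of $P$ has lattice distance $1$ from $0$; 3. $l(kP)=i((k+1)P)$ for all integers $k\ge 0$, and the affine hull of every edge of $P$ contains a lattice point; 4. $\mathrm{ehr}_P(t)=\mathrm{area}(P)\,t^2+\mathrm{area}(P)\,t+1$; 5. $\mathrm{int}(P)\cap\mathbb Z^2=\{0\}$ and $P$ is pseudo-integral. Moreover, the pseudo-integral polygons $P$ with $\mathrm{denom}(P)=2$ and $\mathrm{int}(P)\cap\mathbb Z^2=\{0\}$ are exactly the duals of the LDP polygons of Gorenstein index $2$, and the LDP polygons of Gorenstein index $2$ are exactly the duals of these polygons. There are exactly $30$ of each up to equivalence, and duality matches them: there are polygons $R_1,\dots,R_{30}$, pseudo-integral of denominator $2$ with $\mathrm{int}(R_j)\cap\mathbb Z^2=\{0\}$, whose duals $R_j^*$ are LDP polygons of Gorenstein index $2$, such that every pseudo-integral polygon with denominator $2$ and exactly one interior lattice point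 is equivalent to exactly one $R_j$ under the affine unimodular maps $x\mapsto Ax+b$ ($A\in GL_2(\mathbb Z)$, $b\in\mathbb Z^2$), and every LDP polygon of Gorenstein index $2$ is equivalent to exactly one $R_j^*$ under the linear unimodular maps $x\mapsto Ax$ ($A\in GL_2(\mathbb Z)$). -/

import Mathlib

open scoped Pointwise Matrix

noncomputable section

namespace LDPPolygon

/-- The plane with its standard coordinates; `⬝ᵥ` is the standard inner product and `volume` is
Lebesgue measure. -/
abbrev Plane : Type := Fin 2 → ℝ

/-- The inclusion of `ℤ²` into the plane. -/
def ofInt (z : Fin 2 → ℤ) : Plane := fun i => (z i : ℝ)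

/-- The lattice `ℤ²`. -/
def lattice : Set Plane := Set.range ofInt

/-- The points with rational coordinates. -/
def ratPoints : Set Plane := Set.range fun (q : Fin 2 → ℚ) (i : Fin 2) => (q i : ℝ)

/-- A (two-dimensional) rational polygon. -/
def IsRationalPolygon (P : Set Plane) : Prop :=
  (∃ S : Finset Plane, (S : Set Plane) ⊆ ratPoints ∧ P = convexHull ℝ (S : Set Plane)) ∧
    affineSpan ℝ P = ⊤

/-- A (two-dimensional) lattice polygon. -/
def IsLatticePolygon (P : Set Plane) : Prop :=
  (∃ S : Finset Plane, (S : Set Plane) ⊆ lattice ∧ P = convexHull ℝ (S : Set Plane)) ∧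
    affineSpan ℝ P = ⊤

/-- The denominator of a rational polygon: the least `d ≥ 1` such that `dP` is a lattice
polygon. -/
def denom (P : Set Plane) : ℕ :=
  sInf {d : ℕ | 1 ≤ d ∧ IsLatticePolygon ((d : ℝ) • P)}

/-- The number `l(P)` of lattice points. -/
def latticePoints (P : Set Plane) : ℕ := (P ∩ lattice).ncard

/-- The number `i(P)` of interior lattice points. -/
def interiorLatticePoints (P : Set Plane) : ℕ := (interior P ∩ lattice).ncard

/-- The area. -/
def area (P : Set Plane) : ℝ := (MeasureTheory.volume P).toReal

/-- The dual polygon `P^*`. -/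
def dual (P : Set Plane) : Set Plane := {y | ∀ x ∈ P, -1 ≤ y ⬝ᵥ x}

/-- `E` is an edge of `P`: a one-dimensional (exposed) face. -/
def IsEdge (P E : Set Plane) : Prop :=
  IsExposed ℝ P E ∧ Module.finrank ℝ (vectorSpan ℝ E) = 1

/-- The affine hull of `E` is a rational line, `{y | ⟨n, y⟩ = b}` with `n` a primitive integer
vector, and the lattice distance `|⟨n, x⟩ - b|` of `x` from it is `r`.  (The pair `(n, b)` is
determined by the line up to a common sign.) -/
def HasLatticeDist (E : Set Plane) (x : Plane) (r : ℝ) : Prop :=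
  ∃ (n : Fin 2 → ℤ) (b : ℝ), IsCoprime (n 0) (n 1) ∧
    (affineSpan ℝ E : Set Plane) = {y | ofInt n ⬝ᵥ y = b} ∧ |ofInt n ⬝ᵥ x - b| = r

/-- LDP polygons: lattice polygons with the origin in the interior, all of whose vertices are
primitive. -/
def IsLDP (Q : Set Plane) : Prop :=
  IsLatticePolygon Q ∧ 0 ∈ interior Q ∧
    ∀ v ∈ Q.extremePoints ℝ, ∃ n : Fin 2 → ℤ, IsCoprime (n 0) (n 1) ∧ v = ofInt n

/-- The Gorenstein index of an LDP polygon. -/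
def gorensteinIndex (Q : Set Plane) : ℕ := denom (dual Q)

/-- A quasi-polynomial of degree `n`: periodic rational coefficient functions on the integers,
the leading one not identically zero. -/
structure QuasiPolynomial (n : ℕ) where
  coeff : Fin (n + 1) → ℤ → ℚ
  periodic : ∀ j, ∃ p : ℕ, 0 < p ∧ Function.Periodic (coeff j) (p : ℤ)
  leading_ne_zero : coeff (Fin.last n) ≠ 0

/-- The value `∑ₖ qₖ(t) tᵏ`. -/
def QuasiPolynomial.eval {n : ℕ} (q : QuasiPolynomial n) (t : ℤ) : ℚ :=
  ∑ j : Fin (n + 1), q.coeff j t * (t : ℚ) ^ (j : ℕ)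

/-- The (least positive) period of a coefficient function. -/
def QuasiPolynomial.period {n : ℕ} (q : QuasiPolynomial n) (j : Fin (n + 1)) : ℕ :=
  sInf {p : ℕ | 0 < p ∧ Function.Periodic (q.coeff j) (p : ℤ)}

/-- The quasi-period: the least common multiple of the periods of the coefficients. -/
def QuasiPolynomial.quasiPeriod {n : ℕ} (q : QuasiPolynomial n) : ℕ :=
  Finset.univ.lcm q.period

/-- `q` is the Ehrhart quasi-polynomial of `P`: its value at every positive integer `k` is
`l(kP)`.  (A quasi-polynomial is determined by its values at the positive integers.) -/
def IsEhrhart (P : Set Plane) (q : QuasiPolynomial 2) : Prop :=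
  ∀ k : ℕ, 1 ≤ k → q.eval (k : ℤ) = (latticePoints ((k : ℝ) • P) : ℚ)

/-- `P` is pseudo-integral: its Ehrhart quasi-polynomial has quasi-period `1`. -/
def IsPseudoIntegral (P : Set Plane) : Prop :=
  ∃ q : QuasiPolynomial 2, IsEhrhart P q ∧ q.quasiPeriod = 1

/-- Affine unimodular equivalence. -/
def AffineUnimodularEquiv (P P' : Set Plane) : Prop :=
  ∃ (A : Matrix (Fin 2) (Fin 2) ℤ) (b : Fin 2 → ℤ), IsUnit A.det ∧
    (fun x : Plane => A.map (fun a : ℤ => (a : ℝ)) *ᵥ x + ofInt b) '' P = P'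

/-- Linear unimodular equivalence: the natural equivalence of LDP polygons, since it fixes the
origin. -/
def LinearUnimodularEquiv (P P' : Set Plane) : Prop :=
  ∃ A : Matrix (Fin 2) (Fin 2) ℤ, IsUnit A.det ∧
    (fun x : Plane => A.map (fun a : ℤ => (a : ℝ)) *ᵥ x) '' P = P'

end LDPPolygon

end

open LDPPolygon

/-!
The proof replaces a half-integral polygon `P` by the lattice polygon `M = 2 • P` and reads off
everything from the boundary lattice points of `M`. Two consecutive ones `u`, `v` form a *step*
(`IsStep`); its height `det2 u v` is the lattice distance of the line through `u` and `v` from the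
origin, because `v - u` is primitive. The cones over the steps decompose the plane
(`IsOriginPolygon.exists_inCell`, `IsStep.inCell_unique`), and a count of the lattice points in
each cone gives Pick's theorem for all dilates of `M`
(`IsOriginPolygon.two_mul_latticePoints_smul`). The normal vectors of the steps, divided by the
heights, are the vertices of the dual (`IsOriginPolygon.dual_smul_eq_convexHull`,
`IsOriginPolygon.dualVertices_subset_extremePoints`), and the lines of the steps are those of the
edges (`IsOriginPolygon.forall_isEdge_iff`).

Each of the five conditions says that all heights of `M` are `2` (`IsOriginPolygon.tfae_half`). For
the first two this is the description of the dual and of the edges. If all heights are `2`, the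
`k`-th dilate of `P` and the interior of the next one contain the same lattice points, and the
Ehrhart polynomial follows from Pick's theorem. Conversely, if `P` and the interior of `2 • P`
contain equally many lattice points, all heights are at most `2` (`IsOriginPolygon.height_le_two`);
the condition on the edges makes them even, the Ehrhart polynomial makes their average `2`. If `P`
is pseudo-integral with one interior lattice point, the value of the Ehrhart polynomial at `1`
determines the number of boundary points of `M` in `2ℤ²`, and a parity argument bounds this number
by the heights, with equality only if all of them are `2`
(`IsOriginPolygon.heightTwo_of_isPseudoIntegral`). The description of the duals of the LDP polygons
of Gorenstein index `2` follows from the first and the last condition and the bipolar theorem.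

For the classification, let `Q` be an LDP polygon of Gorenstein index `2` and `M = 2 • dual Q`.
Some vertex `w` of `M` is not in `2ℤ²`. Since the heights are `2`, the boundary points `u`, `v`
before and after `w` are in `2ℤ²`, and `u / 2 + v / 2 = c • w` for an integer `c ≤ 0`. In
coordinates adapted to `u / 2` and `w`, the polygon `Q` has the edge from `(2 * c - 1, 2)` to `(1,
2)` and is bounded by `x ≤ 1` and `x - c * y ≥ -1` (`IsLDP.exists_isTopForm`). It has a lattice
point with `y < 0`, so that `c ≥ -2`, and finitely many cases remain, because the vertices are
primitive and the heights of `Q` divide `2` (`IsTopForm.isListed`). They give the thirty vertex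
sets `vertexSets`, which a unimodular invariant shows to be pairwise inequivalent
(`pairInvariant_nodup`). Duality carries the list over to the pseudo-integral polygons; an affine
equivalence preserves the unique interior lattice point and is therefore linear after a translation
(`affineUnimodularEquiv_iff`).
-/

/-! ### Determinants and lattice points -/

namespace LDPPolygon

/-- The determinant of the `2 × 2` matrix with columns `u` and `v`. -/
def det2 {R : Type*} [CommRing R] (u v : Fin 2 → R) : R := u 0 * v 1 - u 1 * v 0

@[simp] lemma ofInt_apply (z : Fin 2 → ℤ) (i : Fin 2) : ofInt z i = (z i : ℝ) := rfl

lemma ofInt_injective : Function.Injective ofInt := fun u v h => by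
  funext i
  have := congrFun h i
  simpa using this

lemma ofInt_inj {u v : Fin 2 → ℤ} : ofInt u = ofInt v ↔ u = v := ofInt_injective.eq_iff

lemma ofInt_sub (u v : Fin 2 → ℤ) : ofInt (u - v) = ofInt u - ofInt v := by
  funext i; simp

lemma ofInt_add (u v : Fin 2 → ℤ) : ofInt (u + v) = ofInt u + ofInt v := by
  funext i; simp

@[simp] lemma ofInt_zero : ofInt 0 = 0 := by
  funext i; simp

lemma ofInt_smul (k : ℤ) (u : Fin 2 → ℤ) : ofInt (k • u) = (k : ℝ) • ofInt u := by
  funext i; simp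

lemma det2_ofInt (u v : Fin 2 → ℤ) : det2 (ofInt u) (ofInt v) = ((det2 u v : ℤ) : ℝ) := by
  simp [det2]

lemma ofInt_mem_lattice (z : Fin 2 → ℤ) : ofInt z ∈ lattice := ⟨z, rfl⟩

lemma plane_ext {x y : Plane} (h0 : x 0 = y 0) (h1 : x 1 = y 1) : x = y := by
  funext i; fin_cases i <;> assumption

lemma exists_dotProduct_of_functional (f : Plane →L[ℝ] ℝ) : ∃ n : Plane, ∀ x, f x = x ⬝ᵥ n := by
  refine ⟨fun i => f (Pi.single i 1), fun x => ?_⟩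
  have hx : x = x 0 • (Pi.single 0 1 : Plane) + x 1 • (Pi.single 1 1 : Plane) := by
    apply plane_ext <;> simp
  conv_lhs => rw [hx]
  simp [dotProduct, Fin.sum_univ_two]

/-! ### Lattice polygons around the origin and their boundary steps -/

/-- A lattice polygon with the origin in its interior. -/
structure IsOriginPolygon (M : Set Plane) : Prop where
  isLatticePolygon : IsLatticePolygon M
  zero_mem : (0 : Plane) ∈ interior M

namespace IsOriginPolygon

variable {M : Set Plane}

lemma convex (hM : IsOriginPolygon M) : Convex ℝ M := by
  obtain ⟨S, -, rfl⟩ := hM.1.1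
  exact convex_convexHull ℝ _

lemma isCompact (hM : IsOriginPolygon M) : IsCompact M := by
  obtain ⟨S, -, rfl⟩ := hM.1.1
  exact S.finite_toSet.isCompact_convexHull (𝕜 := ℝ)

lemma zero_mem' (hM : IsOriginPolygon M) : (0 : Plane) ∈ M := interior_subset hM.zero_mem

lemma smul_mem (hM : IsOriginPolygon M) {x : Plane} (hx : x ∈ M) {t : ℝ} (h0 : 0 ≤ t)
    (h1 : t ≤ 1) : t • x ∈ M :=
  hM.convex.smul_mem_of_zero_mem hM.zero_mem' hx ⟨h0, h1⟩

lemma smul_mem_interior (hM : IsOriginPolygon M) {x : Plane} (hx : x ∈ M) {t : ℝ} (h0 : 0 ≤ t)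
    (h1 : t < 1) : t • x ∈ interior M := by
  have := hM.convex.combo_interior_self_mem_interior hM.zero_mem hx (sub_pos.2 h1) h0
    (sub_add_cancel 1 t)
  simpa using this

end IsOriginPolygon

lemma finite_latticePoints_of_isBounded {M : Set Plane} (hM : Bornology.IsBounded M) :
    {z : Fin 2 → ℤ | ofInt z ∈ M}.Finite := by
  obtain ⟨R, hR⟩ := hM.exists_norm_le
  obtain ⟨N, hN⟩ := exists_int_gt R
  refine (Set.finite_Icc (fun _ : Fin 2 => -N) (fun _ => N)).subset fun z hz => ?_
  have h : ∀ i, |z i| ≤ N := fun i => by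
    have h1 := (norm_le_pi_norm (ofInt z) i).trans (hR _ hz)
    have h2 : (|z i| : ℝ) ≤ N := by
      rw [ofInt_apply, Real.norm_eq_abs] at h1
      exact h1.trans hN.le
    exact_mod_cast h2
  exact ⟨fun i => (abs_le.1 (h i)).1, fun i => (abs_le.1 (h i)).2⟩

/-- The lattice points on the boundary of `M`. -/
def bdry (M : Set Plane) : Set (Fin 2 → ℤ) := {z | ofInt z ∈ M ∧ ofInt z ∉ interior M}

/-- `v` follows `u` in the counterclockwise list of the boundary lattice points of `M`: the vector
`v - u` is primitive and `M` lies on the left of the directed line from `u` to `v`, as does the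
origin. -/
structure IsStep (M : Set Plane) (u v : Fin 2 → ℤ) : Prop where
  left_mem : ofInt u ∈ M
  right_mem : ofInt v ∈ M
  det_pos : 0 < det2 u v
  coprime : IsCoprime ((v - u) 0) ((v - u) 1)
  le : ∀ x ∈ M, det2 x (ofInt (v - u)) ≤ ((det2 u v : ℤ) : ℝ)

namespace IsStep

variable {M : Set Plane} {u v u' v' : Fin 2 → ℤ}

lemma det_left (_h : IsStep M u v) : det2 u (v - u) = det2 u v := by
  simp [det2]; ring

lemma det_right (_h : IsStep M u v) : det2 v (v - u) = det2 u v := by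
  simp [det2]; ring

lemma lt_of_mem_interior (h : IsStep M u v) {x : Plane} (hx : x ∈ interior M) :
    det2 x (ofInt (v - u)) < ((det2 u v : ℤ) : ℝ) := by
  refine lt_of_le_of_ne (h.le x (interior_subset hx)) fun heq => ?_
  -- moving `x` slightly along the outer normal keeps it in `M`
  have hc : Filter.Tendsto (fun t : ℝ => x + t • ofInt ![(v - u) 1, -(v - u) 0])
      (nhdsWithin 0 (Set.Ioi 0)) (nhds x) := by
    have : Continuous (fun t : ℝ => x + t • ofInt ![(v - u) 1, -(v - u) 0]) := by fun_prop
    have h2 := this.tendsto 0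
    simp only [zero_smul, add_zero] at h2
    exact h2.mono_left nhdsWithin_le_nhds
  have hev := hc.eventually (isOpen_interior.mem_nhds hx)
  obtain ⟨t, ht, ht0⟩ := (hev.and self_mem_nhdsWithin).exists
  have h1 := h.le _ (interior_subset ht)
  have ht0 : 0 < t := ht0
  have hne : (0 : ℝ) < ((v - u) 0 : ℝ) ^ 2 + ((v - u) 1 : ℝ) ^ 2 := by
    rcases eq_or_ne ((v - u) 0) 0 with h0 | h0
    · rcases eq_or_ne ((v - u) 1) 0 with h1 | h1
      · have := h.coprime
        rw [h0, h1] at this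
        exact absurd this not_isCoprime_zero_zero
      · have : ((v - u) 1 : ℝ) ≠ 0 := by exact_mod_cast h1
        positivity
    · have : ((v - u) 0 : ℝ) ≠ 0 := by exact_mod_cast h0
      positivity
  rw [← heq] at h1
  simp only [det2, ofInt_apply, Pi.add_apply, Pi.smul_apply, smul_eq_mul, Matrix.cons_val_zero,
    Matrix.cons_val_one, Int.cast_neg] at h1
  nlinarith [mul_pos ht0 hne]

lemma left_mem_bdry (h : IsStep M u v) : u ∈ bdry M :=
  ⟨h.left_mem, fun hu => by
    have := h.lt_of_mem_interior hu
    rw [det2_ofInt, h.det_left] at this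
    exact lt_irrefl _ this⟩

lemma right_mem_bdry (h : IsStep M u v) : v ∈ bdry M :=
  ⟨h.right_mem, fun hu => by
    have := h.lt_of_mem_interior hu
    rw [det2_ofInt, h.det_right] at this
    exact lt_irrefl _ this⟩

lemma le_int (h : IsStep M u v) {w : Fin 2 → ℤ} (hw : ofInt w ∈ M) :
    det2 w (v - u) ≤ det2 u v := by
  have := h.le _ hw
  rw [det2_ofInt] at this
  exact_mod_cast this

/-- Parallel primitive vectors are equal up to sign. -/
lemma _root_.LDPPolygon.eq_or_eq_neg_of_det2_eq_zero {d d' : Fin 2 → ℤ}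
    (hd : IsCoprime (d 0) (d 1)) (hd' : IsCoprime (d' 0) (d' 1)) (h : det2 d d' = 0) :
    d' = d ∨ d' = -d := by
  obtain ⟨a, b, hab⟩ := hd
  obtain ⟨a', b', hab'⟩ := hd'
  unfold det2 at h
  -- `d' = k d` and `d = k' d'` with integers `k`, `k'`
  have h0 : d' 0 = (a * d' 0 + b * d' 1) * d 0 := by linear_combination (-d' 0) * hab - b * h
  have h1 : d' 1 = (a * d' 0 + b * d' 1) * d 1 := by linear_combination (-d' 1) * hab + a * h
  generalize a * d' 0 + b * d' 1 = k at h0 h1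
  have hk : (a' * d 0 + b' * d 1) * k = 1 := by
    rw [h0, h1] at hab'; linear_combination hab'
  rcases Int.isUnit_iff.1 (IsUnit.of_mul_eq_one_right _ hk : IsUnit k) with rfl | rfl
  · left; funext i; fin_cases i <;> simp [h0, h1]
  · right; funext i; fin_cases i
    · simpa using h0
    · simpa using h1

lemma right_unique (h : IsStep M u v) (h' : IsStep M u v') : v = v' := by
  have h1 := h.le_int h'.right_mem
  have h2 := h'.le_int h.right_mem
  have hd : det2 (v - u) (v' - u) = 0 := by
    have e1 : det2 (v - u) (v' - u) = det2 v (v' - u) - det2 u v' := by simp [det2]; ring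
    have e2 : det2 (v - u) (v' - u) = det2 u v - det2 v' (v - u) := by simp [det2]; ring
    omega
  rcases eq_or_eq_neg_of_det2_eq_zero h.coprime h'.coprime hd with e | e
  · exact (sub_left_inj.1 e).symm
  · have p := h.det_pos
    have p' := h'.det_pos
    rw [← h.det_left] at p
    rw [← h'.det_left, e] at p'
    have : det2 u (-(v - u)) = - det2 u (v - u) := by simp [det2]; ring
    omega

lemma left_unique (h : IsStep M u v) (h' : IsStep M u' v) : u = u' := by
  have h1 := h.le_int h'.left_mem
  have h2 := h'.le_int h.left_mem
  have hd : det2 (v - u) (v - u') = 0 := by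
    have e1 : det2 (v - u) (v - u') = det2 u' v - det2 u (v - u') := by simp [det2]; ring
    have e2 : det2 (v - u) (v - u') = det2 u' (v - u) - det2 u v := by simp [det2]; ring
    omega
  rcases eq_or_eq_neg_of_det2_eq_zero h.coprime h'.coprime hd with e | e
  · exact (sub_right_inj.1 e).symm
  · have p := h.det_pos
    have p' := h'.det_pos
    rw [← h.det_right] at p
    rw [← h'.det_right, e] at p'
    have : det2 v (-(v - u)) = - det2 v (v - u) := by simp [det2]; ring
    omega

end IsStep

namespace IsOriginPolygon

variable {M : Set Plane}

lemma finite_lattice (hM : IsOriginPolygon M) : {z : Fin 2 → ℤ | ofInt z ∈ M}.Finite :=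
  finite_latticePoints_of_isBounded hM.isCompact.isBounded

lemma finite_bdry (hM : IsOriginPolygon M) : (bdry M).Finite :=
  hM.finite_lattice.subset fun _ h => h.1

/-- A linear functional that is nonpositive on the lattice points of `M` vanishes. -/
lemma eq_zero_of_forall_lattice_le (hM : IsOriginPolygon M) (n : Plane)
    (h : ∀ z : Fin 2 → ℤ, ofInt z ∈ M → ofInt z ⬝ᵥ n ≤ 0) : n = 0 := by
  obtain ⟨S, hS, hMS⟩ := hM.1.1
  have hle : ∀ x ∈ M, x ⬝ᵥ n ≤ 0 := by
    have hc : Convex ℝ {x : Plane | x ⬝ᵥ n ≤ 0} :=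
      convex_halfSpace_le ⟨fun x y => add_dotProduct x y n, fun c x => smul_dotProduct c x n⟩ 0
    have : M ⊆ {x : Plane | x ⬝ᵥ n ≤ 0} := by
      rw [hMS]
      refine convexHull_min (fun s hs => ?_) hc
      obtain ⟨z, rfl⟩ := hS hs
      exact h z (hMS ▸ subset_convexHull ℝ _ hs)
    exact this
  have hc : Filter.Tendsto (fun t : ℝ => t • n) (nhdsWithin 0 (Set.Ioi 0)) (nhds (0 : Plane)) := by
    have : Continuous (fun t : ℝ => t • n) := by fun_prop
    have h2 := this.tendsto 0
    simp only [zero_smul] at h2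
    exact h2.mono_left nhdsWithin_le_nhds
  have hev := hc.eventually (isOpen_interior.mem_nhds hM.zero_mem)
  obtain ⟨t, ht, ht0⟩ := (hev.and self_mem_nhdsWithin).exists
  have h1 := hle _ (interior_subset ht)
  have ht0 : 0 < t := ht0
  rw [smul_dotProduct, smul_eq_mul] at h1
  have h2 : n ⬝ᵥ n = 0 :=
    le_antisymm (nonpos_of_mul_nonpos_right h1 ht0)
      (Finset.sum_nonneg fun i _ => mul_self_nonneg (n i))
  exact dotProduct_self_eq_zero.1 h2

/-- Every direction has a lattice point of `M` strictly on its right. -/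
lemma exists_lattice_det_pos (hM : IsOriginPolygon M) {x : Plane} (hx : x ≠ 0) :
    ∃ z : Fin 2 → ℤ, ofInt z ∈ M ∧ 0 < det2 (ofInt z) x := by
  by_contra! hcon
  have : (![x 1, -x 0] : Plane) = 0 := by
    refine hM.eq_zero_of_forall_lattice_le _ fun z hz => ?_
    have := hcon z hz
    simp only [det2, dotProduct, Fin.sum_univ_two, Matrix.cons_val_zero, Matrix.cons_val_one]
      at this ⊢
    linarith
  apply hx
  have e0 := congrFun this 0
  have e1 := congrFun this 1
  simp at e0 e1
  exact plane_ext e1 e0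

/-- A boundary lattice point has a supporting functional. -/
lemma exists_support (hM : IsOriginPolygon M) {p : Plane} (hp : p ∉ interior M) :
    ∃ n : Plane, 0 < p ⬝ᵥ n ∧ ∀ x ∈ M, x ⬝ᵥ n ≤ p ⬝ᵥ n := by
  obtain ⟨f, hf0, hf⟩ := geometric_hahn_banach_of_nonempty_interior_point hM.convex hp
    ⟨0, hM.zero_mem⟩
  obtain ⟨n, hn⟩ := exists_dotProduct_of_functional f
  have hle : ∀ x ∈ M, x ⬝ᵥ n ≤ p ⬝ᵥ n := fun x hx => by rw [← hn, ← hn]; exact hf x hx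
  refine ⟨n, ?_, hle⟩
  by_contra! hcon
  have : n = 0 := hM.eq_zero_of_forall_lattice_le n fun z hz => (hle _ hz).trans hcon
  apply hf0
  ext x
  rw [hn, this]
  simp

end IsOriginPolygon

end LDPPolygon

namespace LDPPolygon

lemma exists_primitive {w : Fin 2 → ℤ} (hw : w ≠ 0) : ∃ (g : ℤ) (d : Fin 2 → ℤ), 0 < g ∧
    w = g • d ∧ IsCoprime (d 0) (d 1) := by
  have hg : 0 < Int.gcd (w 0) (w 1) := by
    rw [Nat.pos_iff_ne_zero, Ne, Int.gcd_eq_zero_iff]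
    rintro ⟨h0, h1⟩
    exact hw (by funext i; fin_cases i <;> assumption)
  obtain ⟨a, b, hab, h0, h1⟩ := Int.exists_gcd_one hg
  refine ⟨Int.gcd (w 0) (w 1), ![a, b], by exact_mod_cast hg, ?_, ?_⟩
  · funext i; fin_cases i
    · simpa [mul_comm] using h0
    · simpa [mul_comm] using h1
  · simpa [Int.isCoprime_iff_gcd_eq_one] using hab

lemma exists_eq_smul_of_det2_eq_zero {d w : Fin 2 → ℤ} (hd : IsCoprime (d 0) (d 1))
    (h : det2 d w = 0) : ∃ k : ℤ, w = k • d := by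
  obtain ⟨a, b, hab⟩ := hd
  unfold det2 at h
  refine ⟨a * w 0 + b * w 1, ?_⟩
  funext i; fin_cases i
  · simp only [Fin.zero_eta, Pi.smul_apply, smul_eq_mul]
    linear_combination (-w 0) * hab - b * h
  · simp only [Fin.mk_one, Pi.smul_apply, smul_eq_mul]
    linear_combination (-w 1) * hab + a * h

namespace IsOriginPolygon

variable {M : Set Plane}

/-- Every boundary lattice point has a successor: among the lattice points of `M` to the left of
the ray through `u`, take one that is seen from `u` furthest to the right. -/
lemma exists_step (hM : IsOriginPolygon M) {u : Fin 2 → ℤ} (hu : u ∈ bdry M) :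
    ∃ v, IsStep M u v := by
  obtain ⟨n, hn0, hn⟩ := hM.exists_support hu.2
  have hu0 : ofInt u ≠ 0 := fun h => by rw [h] at hn0; simp at hn0
  have huu : 0 < ofInt u ⬝ᵥ ofInt u :=
    lt_of_le_of_ne (Finset.sum_nonneg fun i _ => mul_self_nonneg _)
      (fun h => hu0 (dotProduct_self_eq_zero.1 h.symm))
  -- the candidates
  let C : Set (Fin 2 → ℤ) := {z | ofInt z ∈ M ∧ 0 < det2 u z}
  have hCfin : C.Finite := hM.finite_lattice.subset fun z hz => hz.1
  have hCne : C.Nonempty := by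
    obtain ⟨z, hz, hpos⟩ := hM.exists_lattice_det_pos (x := -ofInt u) (neg_ne_zero.2 hu0)
    refine ⟨z, hz, ?_⟩
    have : det2 (ofInt z) (-ofInt u) = ((det2 u z : ℤ) : ℝ) := by
      rw [← det2_ofInt]; simp [det2]; ring
    rw [this] at hpos
    exact_mod_cast hpos
  let φ : (Fin 2 → ℤ) → ℝ := fun z => ((ofInt z - ofInt u) ⬝ᵥ ofInt u) / det2 (ofInt u) (ofInt z)
  obtain ⟨z, ⟨hzM, hz⟩, hmax⟩ := Set.exists_max_image C φ hCfin hCne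
  have hzR : 0 < det2 (ofInt u) (ofInt z) := by rw [det2_ofInt]; exact_mod_cast hz
  -- all lattice points lie to the left of the line from `u` to `z`
  have key : ∀ w : Fin 2 → ℤ, ofInt w ∈ M →
      0 ≤ det2 (ofInt z - ofInt u) (ofInt w - ofInt u) := by
    intro w hw
    rcases lt_or_ge 0 (det2 (ofInt u) (ofInt w)) with hpos | hneg
    · have hwC : w ∈ C := ⟨hw, by rw [det2_ofInt] at hpos; exact_mod_cast hpos⟩
      have h1 := hmax w hwC
      simp only [φ] at h1
      rw [div_le_div_iff₀ hpos hzR] at h1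
      have h2 : det2 (ofInt z - ofInt u) (ofInt w - ofInt u) * (ofInt u ⬝ᵥ ofInt u) =
          ((ofInt z - ofInt u) ⬝ᵥ ofInt u) * det2 (ofInt u) (ofInt w) -
          ((ofInt w - ofInt u) ⬝ᵥ ofInt u) * det2 (ofInt u) (ofInt z) := by
        simp [det2, dotProduct, Fin.sum_univ_two]; ring
      by_contra! hlt
      nlinarith [mul_neg_of_neg_of_pos hlt huu]
    · by_contra! hlt
      have h1 := hn _ hw
      have h2 := hn _ hzM
      -- `u` would be a combination of `0`, `z` and `w` that contradicts the supporting line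
      have h3 : det2 (ofInt z - ofInt u) (ofInt w - ofInt u) * (ofInt u ⬝ᵥ n) =
          det2 (ofInt u) (ofInt w) * (ofInt z ⬝ᵥ n - ofInt u ⬝ᵥ n) -
          det2 (ofInt u) (ofInt z) * (ofInt w ⬝ᵥ n - ofInt u ⬝ᵥ n) := by
        simp [det2, dotProduct, Fin.sum_univ_two]; ring
      have h4 := mul_neg_of_neg_of_pos hlt hn0
      have h5 := mul_nonneg_of_nonpos_of_nonpos hneg (sub_nonpos.2 h2)
      have h6 := mul_nonpos_of_nonneg_of_nonpos hzR.le (sub_nonpos.2 h1)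
      linarith
  have hzu : z - u ≠ 0 := fun h => by
    rw [sub_eq_zero.1 h] at hz
    simp only [det2] at hz
    linarith [mul_comm (u 0) (u 1)]
  obtain ⟨g, d, hg, hgd, hd⟩ := exists_primitive hzu
  have hgR : (0 : ℝ) < g := by exact_mod_cast hg
  have hz' : z = u + g • d := by rw [← hgd]; abel
  refine ⟨u + d, hu.1, ?_, ?_, by simpa using hd, ?_⟩
  · have h1 : ofInt (u + d) = (1 - (g : ℝ)⁻¹) • ofInt u + (g : ℝ)⁻¹ • ofInt z := by
      rw [hz', ofInt_add, ofInt_add, ofInt_smul, smul_add, smul_smul, inv_mul_cancel₀ hgR.ne']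
      module
    rw [h1]
    have hg1 : (g : ℝ)⁻¹ ≤ 1 := inv_le_one_of_one_le₀ (by exact_mod_cast hg)
    exact hM.convex hu.1 hzM (sub_nonneg.2 hg1) (inv_nonneg.2 hgR.le) (sub_add_cancel _ _)
  · have : det2 u z = g * det2 u (u + d) := by rw [hz']; simp [det2]; ring
    rw [this] at hz
    exact (mul_pos_iff_of_pos_left hg).1 hz
  · obtain ⟨S, hS, hMS⟩ := hM.1.1
    have hc : Convex ℝ {x : Plane | det2 x (ofInt (u + d - u)) ≤ ((det2 u (u + d) : ℤ) : ℝ)} :=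
      convex_halfSpace_le ⟨fun x y => by simp [det2]; ring, fun c x => by simp [det2]; ring⟩ _
    have hsub : M ⊆ {x : Plane | det2 x (ofInt (u + d - u)) ≤ ((det2 u (u + d) : ℤ) : ℝ)} := by
      conv_lhs => rw [hMS]
      refine convexHull_min (fun s hs => ?_) hc
      obtain ⟨w, rfl⟩ := hS hs
      have h1 := key w (hMS ▸ subset_convexHull ℝ _ hs)
      have h2 : det2 (ofInt z - ofInt u) (ofInt w - ofInt u) =
          g * ((det2 u (u + d) : ℤ) - det2 (ofInt w) (ofInt (u + d - u))) := by
        rw [hz', ← det2_ofInt]; simp [det2]; ring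
      rw [h2] at h1
      have := nonneg_of_mul_nonneg_right h1 hgR
      exact sub_nonneg.1 this
    exact fun x hx => hsub hx

end IsOriginPolygon

/-- The half-open cone between `u` and `v`: it contains the ray through `v` but not that
through `u`. -/
def InCell (u v : Fin 2 → ℤ) (x : Plane) : Prop :=
  0 < det2 (ofInt u) x ∧ 0 ≤ det2 x (ofInt v)

namespace IsStep

variable {M : Set Plane} {u v u' v' : Fin 2 → ℤ}

/-- The coordinates of a point with respect to the basis `u`, `v`. -/
lemma eq_combo (h : IsStep M u v) (x : Plane) :
    x = (det2 x (ofInt v) / (det2 u v : ℤ)) • ofInt u +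
      (det2 (ofInt u) x / (det2 u v : ℤ)) • ofInt v := by
  have hp : ((det2 u v : ℤ) : ℝ) ≠ 0 := by exact_mod_cast h.det_pos.ne'
  apply plane_ext
  · simp only [Pi.add_apply, Pi.smul_apply, smul_eq_mul]
    field_simp
    rw [← det2_ofInt]; simp [det2]; ring
  · simp only [Pi.add_apply, Pi.smul_apply, smul_eq_mul]
    field_simp
    rw [← det2_ofInt]; simp [det2]; ring

lemma level_eq (x : Plane) : det2 x (ofInt (v - u)) = det2 x (ofInt v) + det2 (ofInt u) x := by
  simp [det2]; ring

lemma level_pos_of_inCell {x : Plane} (hx : InCell u v x) : 0 < det2 x (ofInt (v - u)) := by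
  rw [level_eq]; exact add_pos_of_nonneg_of_pos hx.2 hx.1

/-- Within its cell, the line through `u` and `v` bounds the dilates of `M`. -/
lemma mem_smul_of_inCell (h : IsStep M u v) (hM : IsOriginPolygon M) {x : Plane}
    (hx : 0 ≤ det2 (ofInt u) x) (hx' : 0 ≤ det2 x (ofInt v)) {t : ℝ} (ht : 0 ≤ t)
    (hle : det2 x (ofInt (v - u)) ≤ t * (det2 u v : ℤ)) : x ∈ t • M := by
  have hp : (0 : ℝ) < ((det2 u v : ℤ) : ℝ) := by exact_mod_cast h.det_pos
  have hx0 := h.eq_combo x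
  rw [level_eq] at hle
  set a := det2 x (ofInt v) / (det2 u v : ℤ)
  set b := det2 (ofInt u) x / (det2 u v : ℤ)
  have ha : 0 ≤ a := div_nonneg hx' hp.le
  have hb : 0 ≤ b := div_nonneg hx hp.le
  have hab : a + b ≤ t := by
    rw [← add_div, div_le_iff₀ hp]; exact hle
  rcases ht.eq_or_lt with rfl | ht
  · have ha0 : a = 0 := by linarith
    have hb0 : b = 0 := by linarith
    rw [hx0, ha0, hb0]
    exact ⟨0, hM.zero_mem', by simp⟩
  · rw [Set.mem_smul_set_iff_inv_smul_mem₀ ht.ne']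
    rcases (add_nonneg ha hb).eq_or_lt with h0 | hs
    · have ha0 : a = 0 := by linarith
      have hb0 : b = 0 := by linarith
      rw [hx0, ha0, hb0]
      simpa using hM.zero_mem'
    · have hmem : (a / (a + b)) • ofInt u + (b / (a + b)) • ofInt v ∈ M :=
        hM.convex h.left_mem h.right_mem (by positivity) (by positivity) (by field_simp)
      have := hM.smul_mem hmem (t := t⁻¹ * (a + b)) (by positivity)
        (by rw [inv_mul_le_iff₀ ht]; linarith)
      convert this using 1
      rw [hx0, mul_smul, smul_add (a + b), smul_smul (a + b), smul_smul (a + b),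
        mul_div_cancel₀ _ hs.ne', mul_div_cancel₀ _ hs.ne']

end IsStep

namespace IsOriginPolygon

variable {M : Set Plane}

/-- The cells cover the punctured plane: to find the cell of `x`, take the boundary lattice point
to the right of `x` that makes the smallest angle with it. -/
lemma exists_inCell (hM : IsOriginPolygon M) {x : Plane} (hx : x ≠ 0) :
    ∃ u v, IsStep M u v ∧ InCell u v x := by
  have hxx : 0 < x ⬝ᵥ x :=
    lt_of_le_of_ne (Finset.sum_nonneg fun i _ => mul_self_nonneg _)
      (fun h => hx (dotProduct_self_eq_zero.1 h.symm))
  let C : Set (Fin 2 → ℤ) := {z | z ∈ bdry M ∧ 0 < det2 (ofInt z) x}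
  have hCfin : C.Finite := hM.finite_bdry.subset fun z hz => hz.1
  have hCne : C.Nonempty := by
    -- a lattice point of `M` that is furthest to the right of `x` lies on the boundary
    let L : Set (Fin 2 → ℤ) := {z | ofInt z ∈ M}
    obtain ⟨z₀, hz₀, hpos⟩ := hM.exists_lattice_det_pos hx
    obtain ⟨z, hz, hmax⟩ := Set.exists_max_image L (fun z => det2 (ofInt z) x) hM.finite_lattice
      ⟨z₀, hz₀⟩
    have hzpos : 0 < det2 (ofInt z) x := hpos.trans_le (hmax z₀ hz₀)
    refine ⟨z, ⟨hz, fun hint => ?_⟩, hzpos⟩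
    obtain ⟨S, hS, hMS⟩ := hM.1.1
    have hc : Convex ℝ {y : Plane | det2 y x ≤ det2 (ofInt z) x} :=
      convex_halfSpace_le ⟨fun x y => by simp [det2]; ring, fun c x => by simp [det2]; ring⟩ _
    have hsub : M ⊆ {y : Plane | det2 y x ≤ det2 (ofInt z) x} := by
      conv_lhs => rw [hMS]
      refine convexHull_min (fun s hs => ?_) hc
      obtain ⟨w, rfl⟩ := hS hs
      refine hmax w ?_
      change ofInt w ∈ M
      exact hMS ▸ subset_convexHull ℝ _ hs
    have hcont : Filter.Tendsto (fun t : ℝ => (1 + t) • ofInt z)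
        (nhdsWithin 0 (Set.Ioi 0)) (nhds (ofInt z)) := by
      have : Continuous (fun t : ℝ => (1 + t) • ofInt z) := by fun_prop
      have h2 := this.tendsto 0
      simp only [add_zero, one_smul] at h2
      exact h2.mono_left nhdsWithin_le_nhds
    have hev := hcont.eventually (isOpen_interior.mem_nhds hint)
    obtain ⟨t, ht, ht0⟩ := (hev.and self_mem_nhdsWithin).exists
    have ht0 : 0 < t := ht0
    have h1 : det2 ((1 + t) • ofInt z) x ≤ det2 (ofInt z) x := hsub (interior_subset ht)
    have h2 : det2 ((1 + t) • ofInt z) x = (1 + t) * det2 (ofInt z) x := by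
      simp [det2]; ring
    nlinarith [mul_pos ht0 hzpos]
  let φ : (Fin 2 → ℤ) → ℝ := fun z => (ofInt z ⬝ᵥ x) / det2 (ofInt z) x
  obtain ⟨u, ⟨hu, hupos⟩, hmax⟩ := Set.exists_max_image C φ hCfin hCne
  obtain ⟨v, hv⟩ := hM.exists_step hu
  refine ⟨u, v, hv, hupos, ?_⟩
  by_contra! hneg
  have hvpos : 0 < det2 (ofInt v) x := by
    have : det2 (ofInt v) x = - det2 x (ofInt v) := by simp [det2]; ring
    linarith
  have h1 := hmax v ⟨hv.right_mem_bdry, hvpos⟩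
  simp only [φ] at h1
  rw [div_le_div_iff₀ hvpos hupos] at h1
  have h2 : det2 (ofInt u) (ofInt v) * (x ⬝ᵥ x) =
      (ofInt v ⬝ᵥ x) * det2 (ofInt u) x - (ofInt u ⬝ᵥ x) * det2 (ofInt v) x := by
    simp [det2, dotProduct, Fin.sum_univ_two]; ring
  have h3 : 0 < det2 (ofInt u) (ofInt v) := by rw [det2_ofInt]; exact_mod_cast hv.det_pos
  nlinarith [mul_pos h3 hxx]

/-- A dilate of `M` is cut out by the lines through the boundary steps. -/
lemma mem_smul_iff (hM : IsOriginPolygon M) {t : ℝ} (ht : 0 ≤ t) (x : Plane) :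
    x ∈ t • M ↔ ∀ u v, IsStep M u v → det2 x (ofInt (v - u)) ≤ t * (det2 u v : ℤ) := by
  constructor
  · rintro ⟨y, hy, rfl⟩ u v h
    have h1 : det2 (t • y) (ofInt (v - u)) = t * det2 y (ofInt (v - u)) := by
      simp [det2]; ring
    simp only [h1]
    exact mul_le_mul_of_nonneg_left (h.le y hy) ht
  · intro h
    rcases eq_or_ne x 0 with rfl | hx
    · exact ⟨0, hM.zero_mem', by simp⟩
    · obtain ⟨u, v, huv, hc⟩ := hM.exists_inCell hx
      exact huv.mem_smul_of_inCell hM hc.1.le hc.2 ht (h u v huv)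

lemma finite_steps (hM : IsOriginPolygon M) :
    {p : (Fin 2 → ℤ) × (Fin 2 → ℤ) | IsStep M p.1 p.2}.Finite :=
  (hM.finite_bdry.prod hM.finite_bdry).subset fun _ h => ⟨h.left_mem_bdry, h.right_mem_bdry⟩

lemma mem_interior_smul_iff (hM : IsOriginPolygon M) {t : ℝ} (ht : 0 < t) (x : Plane) :
    x ∈ interior (t • M) ↔ ∀ u v, IsStep M u v → det2 x (ofInt (v - u)) < t * (det2 u v : ℤ) := by
  rw [interior_smul₀ ht.ne']
  constructor
  · rintro ⟨y, hy, rfl⟩ u v h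
    have h1 : det2 (t • y) (ofInt (v - u)) = t * det2 y (ofInt (v - u)) := by
      simp [det2]; ring
    simp only [h1]
    exact mul_lt_mul_of_pos_left (h.lt_of_mem_interior hy) ht
  · intro h
    rw [← interior_smul₀ ht.ne']
    have hopen : IsOpen (⋂ p ∈ {p : (Fin 2 → ℤ) × (Fin 2 → ℤ) | IsStep M p.1 p.2},
        {y : Plane | det2 y (ofInt (p.2 - p.1)) < t * (det2 p.1 p.2 : ℤ)}) := by
      refine hM.finite_steps.isOpen_biInter fun p _ => isOpen_lt ?_ continuous_const
      unfold det2
      fun_prop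
    refine mem_interior.2 ⟨_, fun y hy => ?_, hopen, ?_⟩
    · rw [hM.mem_smul_iff ht.le]
      intro u v huv
      exact (Set.mem_iInter₂.1 hy (u, v) huv).le
    · exact Set.mem_iInter₂.2 fun p hp => h p.1 p.2 hp

end IsOriginPolygon

namespace IsStep

variable {M : Set Plane} {u v u' v' : Fin 2 → ℤ}

/-- If the cells of two steps meet, the line of one step passes through the end of the other. -/
lemma det_right_eq_of_inCell (h : IsStep M u v) (h' : IsStep M u' v') {x : Plane}
    (hx : InCell u v x) (hx' : InCell u' v' x) : det2 v (v' - u') = det2 u' v' := by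
  -- the levels of `x` with respect to the two lines agree, after division by the heights
  have hle : ∀ {u v u' v' : Fin 2 → ℤ}, IsStep M u v → IsStep M u' v' → InCell u v x →
      det2 x (ofInt v) * (((det2 u' v' : ℤ) : ℝ) - det2 (ofInt u) (ofInt (v' - u'))) +
      det2 (ofInt u) x * (((det2 u' v' : ℤ) : ℝ) - det2 (ofInt v) (ofInt (v' - u'))) =
      det2 x (ofInt (v - u)) * (det2 u' v' : ℤ) - det2 x (ofInt (v' - u')) * (det2 u v : ℤ) := by
    intro u v u' v' _ _ _
    rw [← det2_ofInt u v]; simp [det2]; ring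
  have hnn : ∀ {u v u' v' : Fin 2 → ℤ}, IsStep M u v → IsStep M u' v' → InCell u v x →
      0 ≤ det2 x (ofInt v) * (((det2 u' v' : ℤ) : ℝ) - det2 (ofInt u) (ofInt (v' - u'))) ∧
      0 ≤ det2 (ofInt u) x * (((det2 u' v' : ℤ) : ℝ) - det2 (ofInt v) (ofInt (v' - u'))) := by
    intro u v u' v' h h' hx
    exact ⟨mul_nonneg hx.2 (sub_nonneg.2 (h'.le _ h.left_mem)),
      mul_nonneg hx.1.le (sub_nonneg.2 (h'.le _ h.right_mem))⟩
  have e1 := hle h h' hx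
  have e2 := hle h' h hx'
  obtain ⟨p1, p2⟩ := hnn h h' hx
  obtain ⟨p3, p4⟩ := hnn h' h hx'
  have h0 : det2 (ofInt u) x * (((det2 u' v' : ℤ) : ℝ) - det2 (ofInt v) (ofInt (v' - u'))) = 0 := by
    linarith
  have h1 := (mul_eq_zero.1 h0).resolve_left hx.1.ne'
  rw [det2_ofInt] at h1
  have h2 : ((det2 u' v' : ℤ) : ℝ) = ((det2 v (v' - u') : ℤ) : ℝ) := sub_eq_zero.1 h1
  exact_mod_cast h2.symm

/-- The cells are disjoint. -/
lemma inCell_unique (h : IsStep M u v) (h' : IsStep M u' v') {x : Plane}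
    (hx : InCell u v x) (hx' : InCell u' v' x) : u = u' ∧ v = v' := by
  have e1 := h.det_right_eq_of_inCell h' hx hx'
  have e2 := h'.det_right_eq_of_inCell h hx' hx
  suffices hv : v = v' by
    subst hv
    exact ⟨h.left_unique h', rfl⟩
  have z1 : det2 (v' - u') (v - v') = 0 := by
    have : det2 (v' - u') (v - v') = det2 u' v' - det2 v (v' - u') := by simp [det2]; ring
    omega
  have z2 : det2 (v - u) (v - v') = 0 := by
    have : det2 (v - u) (v - v') = det2 v' (v - u) - det2 u v := by simp [det2]; ring
    omega
  obtain ⟨j, hj⟩ := exists_eq_smul_of_det2_eq_zero h.coprime z2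
  obtain ⟨k, hk⟩ := exists_eq_smul_of_det2_eq_zero h'.coprime z1
  by_contra hne
  have hk0 : k ≠ 0 := by
    rintro rfl
    exact hne (sub_eq_zero.1 (by simpa using hk))
  have hpar : det2 (v - u) (v' - u') = 0 := by
    have h1 : k * det2 (v - u) (v' - u') = det2 (v - u) (k • (v' - u')) := by
      simp [det2]; ring
    rw [← hk, z2] at h1
    exact (mul_eq_zero.1 h1).resolve_left hk0
  have hd : v' - u' = v - u := by
    rcases eq_or_eq_neg_of_det2_eq_zero h.coprime h'.coprime hpar with e | e
    · exact e
    · have p := h.det_pos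
      have p' := h'.det_pos
      rw [← h.det_right] at p
      rw [← e1, e] at p'
      have : det2 v (-(v - u)) = - det2 v (v - u) := by simp [det2]; ring
      omega
  -- both points `v`, `v'` are at distance less than one step from the ray of `x`
  have l1 := level_eq (u := u) (v := v) x
  have l2 := level_eq (u := u') (v := v') x
  rw [hd] at l2
  have l3 : det2 x (ofInt v) - det2 x (ofInt v') = j * det2 x (ofInt (v - u)) := by
    have h1 : det2 x (ofInt v) - det2 x (ofInt v') = det2 x (ofInt (v - v')) := by
      simp [det2]; ring
    rw [h1, hj, ofInt_smul]; simp [det2]; ring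
  have hpos := level_pos_of_inCell hx
  have a1 := hx.1
  have a2 := hx.2
  have a3 := hx'.1
  have a4 := hx'.2
  have b1 : (j : ℝ) < 1 := by
    by_contra! hc
    nlinarith
  have b2 : (-1 : ℝ) < j := by
    by_contra! hc
    nlinarith
  have b3 : j < 1 := by exact_mod_cast b1
  have b4 : -1 < j := by exact_mod_cast b2
  have : j = 0 := by omega
  rw [this, zero_smul] at hj
  exact hne (sub_eq_zero.1 hj)

end IsStep

/-- The boundary lattice point that follows `u`, or `u` itself if `u` is not on the boundary. -/
noncomputable def next (M : Set Plane) (u : Fin 2 → ℤ) : Fin 2 → ℤ :=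
  open Classical in if h : ∃ v, IsStep M u v then h.choose else u

lemma IsStep.next_eq {M : Set Plane} {u v : Fin 2 → ℤ} (h : IsStep M u v) : next M u = v := by
  have hex : ∃ v, IsStep M u v := ⟨v, h⟩
  rw [next, dif_pos hex]
  exact hex.choose_spec.right_unique h

namespace IsOriginPolygon

variable {M : Set Plane}

lemma isStep_next (hM : IsOriginPolygon M) {u : Fin 2 → ℤ} (hu : u ∈ bdry M) :
    IsStep M u (next M u) := by
  obtain ⟨v, hv⟩ := hM.exists_step hu
  rwa [hv.next_eq]

/-- The boundary lattice points as a finite set. -/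
noncomputable def boundary (hM : IsOriginPolygon M) : Finset (Fin 2 → ℤ) := hM.finite_bdry.toFinset

@[simp] lemma mem_boundary (hM : IsOriginPolygon M) {u : Fin 2 → ℤ} :
    u ∈ hM.boundary ↔ u ∈ bdry M := by simp [boundary]

lemma next_injOn (hM : IsOriginPolygon M) : Set.InjOn (next M) hM.boundary := by
  intro u hu u' hu' h
  have h1 := hM.isStep_next (hM.mem_boundary.1 hu)
  have h2 := hM.isStep_next (hM.mem_boundary.1 hu')
  rw [← h] at h2
  exact h1.left_unique h2

lemma image_next (hM : IsOriginPolygon M) : hM.boundary.image (next M) = hM.boundary := by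
  refine Finset.eq_of_subset_of_card_le (fun v hv => ?_) ?_
  · obtain ⟨u, hu, rfl⟩ := Finset.mem_image.1 hv
    exact hM.mem_boundary.2 (hM.isStep_next (hM.mem_boundary.1 hu)).right_mem_bdry
  · rw [Finset.card_image_of_injOn hM.next_injOn]

lemma sum_next (hM : IsOriginPolygon M) {α : Type*} [AddCommMonoid α] (f : (Fin 2 → ℤ) → α) :
    ∑ u ∈ hM.boundary, f (next M u) = ∑ u ∈ hM.boundary, f u := by
  conv_rhs => rw [← hM.image_next]
  rw [Finset.sum_image hM.next_injOn]

lemma exists_prev (hM : IsOriginPolygon M) {v : Fin 2 → ℤ} (hv : v ∈ bdry M) :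
    ∃ u, IsStep M u v := by
  rw [← hM.mem_boundary, ← hM.image_next] at hv
  obtain ⟨u, hu, rfl⟩ := Finset.mem_image.1 hv
  exact ⟨u, hM.isStep_next (hM.mem_boundary.1 hu)⟩

lemma boundary_nonempty (hM : IsOriginPolygon M) : hM.boundary.Nonempty := by
  obtain ⟨u, v, h, -⟩ := hM.exists_inCell (x := ![1, 0]) (fun h => by
    have := congrFun h 0
    simp at this)
  exact ⟨u, hM.mem_boundary.2 h.left_mem_bdry⟩

end IsOriginPolygon

end LDPPolygon

/-! ### Lattice points in a cell -/

namespace LDPPolygon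

lemma card_filter_dvd_mul (h m : ℕ) (hh : 0 < h) (a : ℤ) :
    ((Finset.range (m * h + 1)).filter fun N : ℕ => (h : ℤ) ∣ a * N).card =
      m * Int.gcd h a + 1 := by
  have hg : 0 < Int.gcd h a := Int.gcd_pos_of_ne_zero_left _ (by exact_mod_cast hh.ne')
  obtain ⟨r, b, hrb, hr, hb⟩ := Int.exists_gcd_one hg
  set g := Int.gcd h a
  have hgZ : (0 : ℤ) < g := by exact_mod_cast hg
  have hrpos : 0 < r := by
    have : (0 : ℤ) < r * g := by rw [← hr]; exact_mod_cast hh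
    exact (mul_pos_iff_of_pos_right hgZ).1 this
  lift r to ℕ using hrpos.le
  have hr' : h = r * g := by exact_mod_cast hr
  have hrpos' : 0 < r := by exact_mod_cast hrpos
  have himg : ((Finset.range (m * h + 1)).filter fun N : ℕ => (h : ℤ) ∣ a * N) =
      (Finset.range (m * g + 1)).image (fun k => r * k) := by
    ext N
    simp only [Finset.mem_filter, Finset.mem_range, Finset.mem_image]
    constructor
    · rintro ⟨hN, hdvd⟩
      have h1 : (r : ℤ) ∣ b * N := by
        rw [hr, hb, mul_assoc, mul_comm (g : ℤ), ← mul_assoc] at hdvd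
        exact Int.dvd_of_mul_dvd_mul_right hgZ.ne' hdvd
      have h2 : (r : ℤ) ∣ N := (Int.isCoprime_iff_gcd_eq_one.2 hrb).dvd_of_dvd_mul_left h1
      obtain ⟨k, rfl⟩ : r ∣ N := by exact_mod_cast h2
      refine ⟨k, ?_, rfl⟩
      rw [hr'] at hN
      have : r * k ≤ r * (m * g) := by nlinarith
      exact Nat.lt_succ_of_le (Nat.le_of_mul_le_mul_left this hrpos')
    · rintro ⟨k, hk, rfl⟩
      refine ⟨?_, ⟨b * k, ?_⟩⟩
      · rw [hr']
        have : r * k ≤ r * (m * g) := Nat.mul_le_mul_left _ (Nat.lt_succ_iff.1 hk)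
        nlinarith
      · rw [hb, hr]; push_cast; ring
  rw [himg, Finset.card_image_of_injective _ (fun x y hxy => Nat.eq_of_mul_eq_mul_left hrpos' hxy),
    Finset.card_range]

/-- Pairing `N` with `m h - N` evaluates the sum of the floors of `a N / h`. -/
lemma two_mul_sum_ediv (h m : ℕ) (hh : 0 < h) (a : ℤ) :
    2 * ∑ N ∈ Finset.range (m * h + 1), a * (N : ℤ) / h =
      (m * h + 1) * (m * a) - (m * h + 1) + (m * Int.gcd h a + 1) := by
  have hhZ : (0 : ℤ) < h := by exact_mod_cast hh
  have hpair : ∀ N ∈ Finset.range (m * h + 1),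
      a * (N : ℤ) / h + a * ((m * h + 1 - 1 - N : ℕ) : ℤ) / h =
        m * a - 1 + if (h : ℤ) ∣ a * N then 1 else 0 := by
    intro N hN
    have hle : N ≤ m * h := Nat.lt_succ_iff.1 (Finset.mem_range.1 hN)
    have e1 : a * ((m * h + 1 - 1 - N : ℕ) : ℤ) = -(a * N) + h * (m * a) := by
      rw [Nat.add_sub_cancel, Nat.cast_sub hle]; push_cast; ring
    rw [e1, Int.add_mul_ediv_left _ _ hhZ.ne']
    split_ifs with hd
    · obtain ⟨k, hk⟩ := hd
      have : -(a * (N : ℤ)) = h * (-k) := by rw [hk]; ring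
      rw [this, hk, Int.mul_ediv_cancel_left _ hhZ.ne', Int.mul_ediv_cancel_left _ hhZ.ne']
      ring
    · have hne : a * (N : ℤ) % h ≠ 0 := fun h0 => hd (Int.dvd_of_emod_eq_zero h0)
      have hlt := Int.emod_lt_of_pos (a * (N : ℤ)) hhZ
      have hge := Int.emod_nonneg (a * (N : ℤ)) hhZ.ne'
      have hdiv := Int.emod_add_mul_ediv (a * (N : ℤ)) h
      have : -(a * (N : ℤ)) / h = -(a * (N : ℤ) / h) - 1 := by
        rw [Int.ediv_eq_iff_of_pos hhZ]
        constructor <;> nlinarith [hge.lt_of_ne hne.symm]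
      rw [this]; ring
  have h1 : ∑ N ∈ Finset.range (m * h + 1), a * (N : ℤ) / h +
      ∑ N ∈ Finset.range (m * h + 1), a * ((m * h + 1 - 1 - N : ℕ) : ℤ) / h =
      ∑ N ∈ Finset.range (m * h + 1), (m * a - 1 + if (h : ℤ) ∣ a * N then 1 else 0) := by
    rw [← Finset.sum_add_distrib]
    exact Finset.sum_congr rfl hpair
  rw [Finset.sum_range_reflect (fun N : ℕ => a * (N : ℤ) / h)] at h1
  rw [two_mul, h1, Finset.sum_add_distrib, Finset.sum_const, Finset.card_range, Finset.sum_boole,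
    card_filter_dvd_mul h m hh]
  push_cast
  simp only [nsmul_eq_mul]
  push_cast
  ring

/-- The lattice points of the cell of `u` and `v` up to `m` times the height of the line through
`u` and `v`. -/
def cellPoints (m : ℕ) (u v : Fin 2 → ℤ) : Set (Fin 2 → ℤ) :=
  {p | 0 < det2 u p ∧ 0 ≤ det2 p v ∧ det2 p (v - u) ≤ m * det2 u v}

/-- The number of lattice points in a cell.  The two gcd terms count lattice points on the two
boundary rays. -/
lemma card_cellPoints {u v : Fin 2 → ℤ} (hpos : 0 < det2 u v)
    (hd : IsCoprime ((v - u) 0) ((v - u) 1)) (m : ℕ) :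
    (cellPoints m u v).Finite ∧ 2 * ((cellPoints m u v).ncard : ℤ) =
      m ^ 2 * det2 u v + m + m * Int.gcd (v 0) (v 1) - m * Int.gcd (u 0) (u 1) := by
  obtain ⟨a, b, hab⟩ := hd
  -- `e` completes the primitive vector `d = v - u` to a basis of the lattice
  obtain ⟨h, hh⟩ := Int.eq_ofNat_of_zero_le hpos.le
  set d := v - u with hd
  set e : Fin 2 → ℤ := ![b, -a] with he
  have hed : e 0 * d 1 - e 1 * d 0 = 1 := by
    simp only [he, Matrix.cons_val_zero, Matrix.cons_val_one]; linear_combination hab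
  have hv : v = u + d := by rw [hd]; abel
  have hh' : u 0 * d 1 - u 1 * d 0 = h := by
    rw [← hh]; simp [det2, hd]; ring
  have hhpos : 0 < h := by omega
  have hhZ : (0 : ℤ) < h := by exact_mod_cast hhpos
  set α := det2 e u with hα
  have hα' : e 0 * u 1 - e 1 * u 0 = α := rfl
  have hgu : Int.gcd h α = Int.gcd (u 0) (u 1) := by
    apply Nat.dvd_antisymm
    · have h1 : ((Int.gcd h α : ℕ) : ℤ) ∣ h := Int.gcd_dvd_left _ _
      have h2 : ((Int.gcd h α : ℕ) : ℤ) ∣ α := Int.gcd_dvd_right _ _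
      refine Int.dvd_gcd ?_ ?_
      · have : u 0 = e 0 * h + d 0 * α := by
          rw [← hh', ← hα']; linear_combination (-u 0) * hed
        rw [this]; exact dvd_add (h1.mul_left _) (h2.mul_left _)
      · have : u 1 = e 1 * h + d 1 * α := by
          rw [← hh', ← hα']; linear_combination (-u 1) * hed
        rw [this]; exact dvd_add (h1.mul_left _) (h2.mul_left _)
    · have h1 : ((Int.gcd (u 0) (u 1) : ℕ) : ℤ) ∣ u 0 := Int.gcd_dvd_left _ _
      have h2 : ((Int.gcd (u 0) (u 1) : ℕ) : ℤ) ∣ u 1 := Int.gcd_dvd_right _ _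
      refine Int.dvd_gcd ?_ ?_
      · rw [← hh']; exact dvd_sub (h1.mul_right _) (h2.mul_right _)
      · rw [← hα']; exact dvd_sub (h2.mul_left _) (h1.mul_left _)
  have hgv : Int.gcd h (α + 1) = Int.gcd (v 0) (v 1) := by
    have hv0 : v 0 = u 0 + d 0 := by rw [hv]; rfl
    have hv1 : v 1 = u 1 + d 1 := by rw [hv]; rfl
    apply Nat.dvd_antisymm
    · have h1 : ((Int.gcd h (α + 1) : ℕ) : ℤ) ∣ h := Int.gcd_dvd_left _ _
      have h2 : ((Int.gcd h (α + 1) : ℕ) : ℤ) ∣ α + 1 := Int.gcd_dvd_right _ _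
      refine Int.dvd_gcd ?_ ?_
      · have : v 0 = e 0 * h + d 0 * (α + 1) := by
          rw [← hh', ← hα', hv0]; linear_combination (-u 0) * hed
        rw [this]; exact dvd_add (h1.mul_left _) (h2.mul_left _)
      · have : v 1 = e 1 * h + d 1 * (α + 1) := by
          rw [← hh', ← hα', hv1]; linear_combination (-u 1) * hed
        rw [this]; exact dvd_add (h1.mul_left _) (h2.mul_left _)
    · have h1 : ((Int.gcd (v 0) (v 1) : ℕ) : ℤ) ∣ v 0 := Int.gcd_dvd_left _ _
      have h2 : ((Int.gcd (v 0) (v 1) : ℕ) : ℤ) ∣ v 1 := Int.gcd_dvd_right _ _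
      refine Int.dvd_gcd ?_ ?_
      · have : (h : ℤ) = v 0 * d 1 - v 1 * d 0 := by rw [← hh', hv0, hv1]; ring
        rw [this]; exact dvd_sub (h1.mul_right _) (h2.mul_right _)
      · have : α + 1 = e 0 * v 1 - e 1 * v 0 := by
          rw [← hα', hv0, hv1]; linear_combination (-1 : ℤ) * hed
        rw [this]; exact dvd_sub (h2.mul_left _) (h1.mul_left _)
  -- in the basis `e`, `d` the cell is a family of intervals
  let T : Finset (Σ _ : ℕ, ℤ) := (Finset.range (m * h + 1)).sigma fun N =>
    Finset.Ioc (α * N / h) ((α + 1) * N / h)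
  let F : (Σ _ : ℕ, ℤ) → (Fin 2 → ℤ) := fun x => (x.1 : ℤ) • e + x.2 • d
  have hF1 : ∀ x, det2 (F x) d = x.1 := fun x => by
    simp only [F, det2, Pi.add_apply, Pi.smul_apply, smul_eq_mul]
    linear_combination (x.1 : ℤ) * hed
  have hF2 : ∀ x, det2 e (F x) = x.2 := fun x => by
    simp only [F, det2, Pi.add_apply, Pi.smul_apply, smul_eq_mul]
    linear_combination x.2 * hed
  have hFinj : Function.Injective F := by
    rintro ⟨N, s⟩ ⟨N', s'⟩ hxy
    have h1 := hF1 ⟨N, s⟩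
    have h2 := hF2 ⟨N, s⟩
    rw [hxy, hF1] at h1
    rw [hxy, hF2] at h2
    have h1' : N' = N := by exact_mod_cast h1
    have h2' : s' = s := h2
    rw [h1', h2']
  have hFu : ∀ x, det2 u (F x) = h * x.2 - α * x.1 := fun x => by
    simp only [F, det2, Pi.add_apply, Pi.smul_apply, smul_eq_mul]
    rw [← hh', ← hα']
    linear_combination (0 : ℤ) * hed
  have hFv : ∀ x, det2 (F x) v = (α + 1) * x.1 - x.2 * h := fun x => by
    simp only [F, det2, hv, Pi.add_apply, Pi.smul_apply, smul_eq_mul]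
    rw [← hh', ← hα']
    linear_combination (x.1 : ℤ) * hed
  have hset : cellPoints m u v = F '' (T : Set (Σ _ : ℕ, ℤ)) := by
    ext p
    simp only [cellPoints, Set.mem_ofPred_eq, Set.mem_image, Finset.mem_coe]
    constructor
    · rintro ⟨h1, h2, h3⟩
      have hN : 0 ≤ det2 p d := by
        have : det2 p d = det2 p v + det2 u p := by simp [det2, hd]; ring
        omega
      obtain ⟨N, hN'⟩ := Int.eq_ofNat_of_zero_le hN
      have hp : F ⟨N, det2 e p⟩ = p := by
        simp only [F, ← hN']
        funext i; fin_cases i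
        · simp only [det2, Fin.zero_eta, Pi.add_apply, Pi.smul_apply, smul_eq_mul]
          linear_combination p 0 * hed
        · simp only [det2, Fin.mk_one, Pi.add_apply, Pi.smul_apply, smul_eq_mul]
          linear_combination p 1 * hed
      refine ⟨⟨N, det2 e p⟩, ?_, hp⟩
      rw [← hp, hFu] at h1
      rw [← hp, hFv] at h2
      simp only [T, Finset.mem_sigma, Finset.mem_range, Finset.mem_Ioc]
      refine ⟨?_, ?_, ?_⟩
      · rw [hN', hh] at h3
        have : N ≤ m * h := by exact_mod_cast h3
        omega
      · rw [Int.ediv_lt_iff_lt_mul hhZ]; linarith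
      · rw [Int.le_ediv_iff_mul_le hhZ]; linarith
    · rintro ⟨⟨N, s⟩, hx, rfl⟩
      simp only [T, Finset.mem_sigma, Finset.mem_range, Finset.mem_Ioc] at hx
      obtain ⟨h1, h2, h3⟩ := hx
      rw [Int.ediv_lt_iff_lt_mul hhZ] at h2
      rw [Int.le_ediv_iff_mul_le hhZ] at h3
      refine ⟨?_, ?_, ?_⟩
      · rw [hFu]; simp only; linarith
      · rw [hFv]; simp only; linarith
      · rw [hF1, hh]; simp only
        exact_mod_cast Nat.lt_succ_iff.1 h1
  refine ⟨by rw [hset]; exact T.finite_toSet.image F, ?_⟩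
  rw [hset, Set.ncard_image_of_injective _ hFinj, Set.ncard_coe_finset, Finset.card_sigma]
  push_cast
  have hcard : ∀ N ∈ Finset.range (m * h + 1),
      ((Finset.Ioc (α * (N : ℤ) / h) ((α + 1) * N / h)).card : ℤ) =
        (α + 1) * N / h - α * N / h := by
    intro N _
    rw [Int.card_Ioc, Int.toNat_of_nonneg]
    exact sub_nonneg.2 (Int.ediv_le_ediv hhZ (by nlinarith))
  rw [Finset.sum_congr rfl hcard, Finset.sum_sub_distrib, mul_sub, two_mul_sum_ediv h m hhpos,
    two_mul_sum_ediv h m hhpos, hgu, hgv, hh]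
  ring

end LDPPolygon

/-! ### Pick's theorem and the area -/

namespace LDPPolygon

lemma inter_lattice_eq_image (P : Set Plane) :
    P ∩ lattice = ofInt '' {z : Fin 2 → ℤ | ofInt z ∈ P} := by
  ext x
  constructor
  · rintro ⟨hx, z, rfl⟩
    exact ⟨z, hx, rfl⟩
  · rintro ⟨z, hz, rfl⟩
    exact ⟨hz, z, rfl⟩

lemma latticePoints_eq_ncard (P : Set Plane) :
    latticePoints P = {z : Fin 2 → ℤ | ofInt z ∈ P}.ncard := by
  rw [latticePoints, inter_lattice_eq_image, Set.ncard_image_of_injective _ ofInt_injective]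

lemma interiorLatticePoints_eq (P : Set Plane) :
    interiorLatticePoints P = latticePoints (interior P) := rfl

lemma isLatticePolygon_of_interior_nonempty {P : Set Plane} {S : Set Plane} (hfin : S.Finite)
    (hS : S ⊆ lattice) (hP : P = convexHull ℝ S) (hint : (interior P).Nonempty) :
    IsLatticePolygon P := by
  lift S to Finset Plane using hfin
  exact ⟨⟨S, hS, hP⟩, affineSpan_eq_top_of_nonempty_interior
    (hint.mono (interior_mono (subset_convexHull ℝ P)))⟩

namespace IsOriginPolygon

variable {M : Set Plane}

lemma smul (hM : IsOriginPolygon M) {m : ℕ} (hm : 0 < m) : IsOriginPolygon ((m : ℝ) • M) := by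
  have hm' : (m : ℝ) ≠ 0 := by exact_mod_cast hm.ne'
  have h0 : (0 : Plane) ∈ interior ((m : ℝ) • M) := by
    rw [interior_smul₀ hm']
    exact ⟨0, hM.zero_mem, by simp⟩
  refine ⟨?_, h0⟩
  obtain ⟨S, hS, hMS⟩ := hM.1.1
  refine isLatticePolygon_of_interior_nonempty (S := (m : ℝ) • (S : Set Plane))
    (S.finite_toSet.smul_set) ?_ ?_ ⟨0, h0⟩
  · rintro _ ⟨s, hs, rfl⟩
    obtain ⟨z, rfl⟩ := hS hs
    exact ⟨(m : ℤ) • z, by rw [ofInt_smul]; simp⟩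
  · conv_lhs => rw [hMS]
    rw [convexHull_smul]

/-- The sum of the heights `det2 u v` over all boundary steps, which is twice the area. -/
noncomputable def heightSum (hM : IsOriginPolygon M) : ℤ :=
  ∑ u ∈ hM.boundary, det2 u (next M u)

/-- **Pick's theorem** for all dilates of a lattice polygon around the origin, summed over the
cells: the contributions of the rays through the boundary lattice points cancel cyclically. -/
theorem two_mul_latticePoints_smul (hM : IsOriginPolygon M) (m : ℕ) :
    2 * (latticePoints ((m : ℝ) • M) : ℤ) =
      m ^ 2 * hM.heightSum + m * hM.boundary.card + 2 := by
  classical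
  have hfin : {z : Fin 2 → ℤ | ofInt z ∈ (m : ℝ) • M}.Finite :=
    finite_latticePoints_of_isBounded (hM.isCompact.smul _).isBounded
  have hcell : ∀ u ∈ hM.boundary, ∀ p : Fin 2 → ℤ,
      p ∈ cellPoints m u (next M u) ↔ InCell u (next M u) (ofInt p) ∧ ofInt p ∈ (m : ℝ) • M := by
    intro u hu p
    have hst := hM.isStep_next (hM.mem_boundary.1 hu)
    have hin : InCell u (next M u) (ofInt p) ↔ 0 < det2 u p ∧ 0 ≤ det2 p (next M u) := by
      rw [InCell, det2_ofInt, det2_ofInt]; norm_cast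
    constructor
    · rintro ⟨h1, h2, h3⟩
      have hc := hin.2 ⟨h1, h2⟩
      refine ⟨hc, hst.mem_smul_of_inCell hM hc.1.le hc.2 (Nat.cast_nonneg m) ?_⟩
      rw [det2_ofInt]; exact_mod_cast h3
    · rintro ⟨h1, h2⟩
      obtain ⟨h3, h4⟩ := hin.1 h1
      refine ⟨h3, h4, ?_⟩
      have := (hM.mem_smul_iff (Nat.cast_nonneg m) _).1 h2 _ _ hst
      rw [det2_ofInt] at this
      exact_mod_cast this
  have hdecomp : hfin.toFinset.erase 0 = hM.boundary.biUnion fun u =>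
      hfin.toFinset.filter fun p => InCell u (next M u) (ofInt p) := by
    ext p
    simp only [Finset.mem_erase, Finset.mem_biUnion, Finset.mem_filter]
    constructor
    · rintro ⟨hp0, hp⟩
      have hp0' : ofInt p ≠ 0 := fun h => hp0 (ofInt_injective (by simpa using h))
      obtain ⟨u, v, huv, hc⟩ := hM.exists_inCell hp0'
      exact ⟨u, hM.mem_boundary.2 huv.left_mem_bdry, hp, by rwa [huv.next_eq]⟩
    · rintro ⟨u, -, hp, hc⟩
      refine ⟨?_, hp⟩
      rintro rfl
      have := hc.1
      simp [det2] at this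
  have hdisj : (hM.boundary : Set (Fin 2 → ℤ)).PairwiseDisjoint fun u =>
      hfin.toFinset.filter fun p => InCell u (next M u) (ofInt p) := by
    intro u hu u' hu' hne
    refine Finset.disjoint_left.2 fun p hp hp' => hne ?_
    exact ((hM.isStep_next (hM.mem_boundary.1 hu)).inCell_unique
      (hM.isStep_next (hM.mem_boundary.1 hu')) (Finset.mem_filter.1 hp).2
      (Finset.mem_filter.1 hp').2).1
  have hcard : ∀ u ∈ hM.boundary,
      2 * ((hfin.toFinset.filter fun p => InCell u (next M u) (ofInt p)).card : ℤ) =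
        m ^ 2 * det2 u (next M u) + m + (m * Int.gcd (next M u 0) (next M u 1) -
          m * Int.gcd (u 0) (u 1)) := by
    intro u hu
    have hst := hM.isStep_next (hM.mem_boundary.1 hu)
    have h1 := (card_cellPoints hst.det_pos hst.coprime m).2
    have h2 : cellPoints m u (next M u) =
        ↑(hfin.toFinset.filter fun p => InCell u (next M u) (ofInt p)) := by
      ext p
      rw [hcell u hu]
      simp [and_comm]
    rw [h2, Set.ncard_coe_finset] at h1
    rw [h1]; ring
  have h0mem : (0 : Fin 2 → ℤ) ∈ hfin.toFinset := by
    rw [Set.Finite.mem_toFinset]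
    exact ⟨0, hM.zero_mem', by simp⟩
  have htel : ∑ u ∈ hM.boundary, ((m : ℤ) * Int.gcd (next M u 0) (next M u 1) -
      m * Int.gcd (u 0) (u 1)) = 0 := by
    rw [Finset.sum_sub_distrib, hM.sum_next fun u => (m : ℤ) * Int.gcd (u 0) (u 1), sub_self]
  rw [latticePoints_eq_ncard, Set.ncard_eq_toFinset_card _ hfin,
    ← Finset.card_erase_add_one h0mem, hdecomp, Finset.card_biUnion hdisj]
  push_cast
  rw [mul_add, Finset.mul_sum, Finset.sum_congr rfl hcard, Finset.sum_add_distrib, htel,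
    Finset.sum_add_distrib, ← Finset.mul_sum, Finset.sum_const, heightSum]
  simp only [nsmul_eq_mul]
  ring

lemma latticePoints_eq_interior_add (hM : IsOriginPolygon M) :
    latticePoints M = interiorLatticePoints M + hM.boundary.card := by
  have hsplit : {z : Fin 2 → ℤ | ofInt z ∈ M} = {z | ofInt z ∈ interior M} ∪ bdry M := by
    ext z
    simp only [Set.mem_union, bdry, Set.mem_ofPred_eq]
    by_cases h : ofInt z ∈ interior M
    · simp [h, interior_subset h]
    · simp [h]
  have hdisj : Disjoint {z : Fin 2 → ℤ | ofInt z ∈ interior M} (bdry M) :=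
    Set.disjoint_left.2 fun z hz hz' => hz'.2 hz
  have hfin : {z : Fin 2 → ℤ | ofInt z ∈ interior M}.Finite :=
    hM.finite_lattice.subset fun z (hz : ofInt z ∈ interior M) =>
      (interior_subset hz : ofInt z ∈ M)
  rw [interiorLatticePoints_eq, latticePoints_eq_ncard, latticePoints_eq_ncard, hsplit,
    Set.ncard_union_eq hdisj hfin hM.finite_bdry, Set.ncard_eq_toFinset_card _ hM.finite_bdry]
  rfl

/-- The number of boundary lattice points of a dilate, read off from Pick's theorem for `M` and for
its dilate. -/
lemma card_boundary_smul (hM : IsOriginPolygon M) {m : ℕ} (hm : 0 < m) :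
    (hM.smul hm).boundary.card = m * hM.boundary.card := by
  have h1 := (hM.smul hm).two_mul_latticePoints_smul 1
  have h2 := (hM.smul hm).two_mul_latticePoints_smul 2
  rw [smul_smul, ← Nat.cast_mul, hM.two_mul_latticePoints_smul] at h1 h2
  push_cast at h1 h2
  have : ((hM.smul hm).boundary.card : ℤ) = m * hM.boundary.card := by linarith
  exact_mod_cast this

lemma two_mul_interiorLatticePoints_smul (hM : IsOriginPolygon M) {m : ℕ} (hm : 0 < m) :
    2 * (interiorLatticePoints ((m : ℝ) • M) : ℤ) =
      m ^ 2 * hM.heightSum - m * hM.boundary.card + 2 := by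
  have h1 := hM.two_mul_latticePoints_smul m
  rw [(hM.smul hm).latticePoints_eq_interior_add, hM.card_boundary_smul hm] at h1
  push_cast at h1
  linarith

/-- The area is the leading coefficient of the lattice point count. -/
lemma two_mul_area (hM : IsOriginPolygon M) : 2 * area M = hM.heightSum := by
  have hlim := tendsto_card_div_pow_atTop_volume M hM.isCompact.isBounded
    hM.isCompact.isClosed.measurableSet (hM.convex.addHaar_frontier _)
  have hcount : ∀ n : ℕ, 0 < n → (Nat.card ↑(M ∩ (n : ℝ)⁻¹ •
      (Submodule.span ℤ (Set.range (Pi.basisFun ℝ (Fin 2))) : Set Plane)) : ℝ) =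
      latticePoints ((n : ℝ) • M) := by
    intro n hn
    have hn' : (n : ℝ) ≠ 0 := by exact_mod_cast hn.ne'
    have hL : (Submodule.span ℤ (Set.range (Pi.basisFun ℝ (Fin 2))) : Set Plane) = lattice := by
      ext x
      rw [SetLike.mem_coe, Module.Basis.mem_span_iff_repr_mem]
      constructor
      · intro h
        choose z hz using h
        refine ⟨z, ?_⟩
        funext i
        simpa using hz i
      · rintro ⟨z, rfl⟩ i
        exact ⟨z i, by simp⟩
    rw [hL, latticePoints, Nat.card_coe_set_eq]
    have : (n : ℝ) • M ∩ lattice = (n : ℝ) • (M ∩ (n : ℝ)⁻¹ • lattice) := by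
      rw [Set.smul_set_inter₀ hn', smul_smul, mul_inv_cancel₀ hn', one_smul]
    rw [this]
    exact congrArg _ (Set.ncard_image_of_injective _ (smul_right_injective Plane hn')).symm
  have hlim2 : Filter.Tendsto (fun n : ℕ => (hM.heightSum / 2 : ℝ) +
      (hM.boundary.card / 2 : ℝ) * (n : ℝ)⁻¹ + ((n : ℝ)⁻¹) ^ 2) Filter.atTop
      (nhds ((hM.heightSum / 2 : ℝ) + (hM.boundary.card / 2 : ℝ) * 0 + 0 ^ 2)) :=
    (tendsto_const_nhds.add (tendsto_const_nhds.mul tendsto_inv_atTop_nhds_zero_nat)).add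
      (tendsto_inv_atTop_nhds_zero_nat.pow 2)
  have heq := tendsto_nhds_unique (hlim.congr' ?_) hlim2
  · have : area M = MeasureTheory.volume.real M := rfl
    rw [this, heq]; ring
  · filter_upwards [Filter.eventually_gt_atTop 0] with n hn
    have hn' : (n : ℝ) ≠ 0 := by exact_mod_cast hn.ne'
    have h1 := hM.two_mul_latticePoints_smul n
    have h2 : 2 * (latticePoints ((n : ℝ) • M) : ℝ) =
      n ^ 2 * hM.heightSum + n * hM.boundary.card + 2 := by exact_mod_cast h1
    rw [hcount n hn, Fintype.card_fin]
    field_simp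
    linarith

end IsOriginPolygon

end LDPPolygon

/-! ### The dual polygon -/

namespace LDPPolygon

lemma mem_dual {P : Set Plane} {y : Plane} : y ∈ dual P ↔ ∀ x ∈ P, -1 ≤ y ⬝ᵥ x := Iff.rfl

lemma convex_dual (P : Set Plane) : Convex ℝ (dual P) := by
  intro y hy z hz a b ha hb hab x hx
  rw [add_dotProduct, smul_dotProduct, smul_dotProduct, smul_eq_mul, smul_eq_mul]
  nlinarith [mul_le_mul_of_nonneg_left (hy x hx) ha, mul_le_mul_of_nonneg_left (hz x hx) hb]

lemma subset_dual_dual (P : Set Plane) : P ⊆ dual (dual P) := fun x hx y hy => by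
  rw [dotProduct_comm]; exact hy x hx

lemma dual_smul {t : ℝ} (ht : t ≠ 0) (P : Set Plane) : dual (t • P) = t⁻¹ • dual P := by
  ext y
  rw [Set.mem_smul_set_iff_inv_smul_mem₀ (inv_ne_zero ht), inv_inv]
  constructor
  · intro h x hx
    have := h _ (Set.smul_mem_smul_set hx)
    rwa [dotProduct_smul, ← smul_dotProduct] at this
  · rintro h _ ⟨x, hx, rfl⟩
    simp only
    rw [dotProduct_smul, ← smul_dotProduct]
    exact h x hx

lemma zero_mem_interior_dual {P : Set Plane} (hP : Bornology.IsBounded P) :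
    (0 : Plane) ∈ interior (dual P) := by
  obtain ⟨R, hR0, hR⟩ := hP.exists_pos_norm_le
  rw [mem_interior_iff_mem_nhds]
  refine Filter.mem_of_superset (Metric.ball_mem_nhds 0 (ε := (2 * R)⁻¹) (by positivity))
    fun y hy x hx => ?_
  rw [mem_ball_zero_iff] at hy
  have hb : ∀ i, |y i * x i| ≤ (2 * R)⁻¹ * R := fun i => by
    rw [abs_mul]
    exact mul_le_mul ((norm_le_pi_norm y i).trans hy.le) ((norm_le_pi_norm x i).trans (hR x hx))
      (abs_nonneg _) (by positivity)
  have hR2 : (2 * R)⁻¹ * R = 1 / 2 := by field_simp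
  have h0 := (abs_le.1 (hb 0)).1
  have h1 := (abs_le.1 (hb 1)).1
  rw [dotProduct, Fin.sum_univ_two]
  linarith

/-- The inner normal vector of the line through `u` and `v`. -/
def stepNormal (u v : Fin 2 → ℤ) : Fin 2 → ℤ := ![-(v - u) 1, (v - u) 0]

lemma stepNormal_dotProduct (u v : Fin 2 → ℤ) (x : Plane) :
    ofInt (stepNormal u v) ⬝ᵥ x = -det2 x (ofInt (v - u)) := by
  simp [stepNormal, det2, dotProduct, Fin.sum_univ_two]; ring

/-- The vertices of the dual of `t • M`. -/
def dualVertices (M : Set Plane) (t : ℝ) : Set Plane :=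
  {y | ∃ u v, IsStep M u v ∧ y = (t * (det2 u v : ℤ))⁻¹ • ofInt (stepNormal u v)}

namespace IsOriginPolygon

variable {M : Set Plane}

lemma finite_dualVertices (hM : IsOriginPolygon M) (t : ℝ) : (dualVertices M t).Finite := by
  refine (hM.finite_steps.image fun p => (t * (det2 p.1 p.2 : ℤ))⁻¹ •
    ofInt (stepNormal p.1 p.2)).subset ?_
  rintro _ ⟨u, v, h, rfl⟩
  exact ⟨(u, v), h, rfl⟩

lemma dualVertices_subset (hM : IsOriginPolygon M) {t : ℝ} (ht : 0 < t) :
    dualVertices M t ⊆ dual (t • M) := by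
  rintro _ ⟨u, v, h, rfl⟩ x hx
  have hp : (0 : ℝ) < (det2 u v : ℤ) := by exact_mod_cast h.det_pos
  have := (hM.mem_smul_iff ht.le x).1 hx u v h
  rw [smul_dotProduct, stepNormal_dotProduct, smul_eq_mul, mul_neg, neg_le_neg_iff,
    inv_mul_le_iff₀ (by positivity)]
  linarith

/-- The origin is a convex combination of the vertices of the dual: the steps add up to `0`. -/
lemma zero_mem_convexHull_dualVertices (hM : IsOriginPolygon M) {t : ℝ} (ht : 0 < t) :
    (0 : Plane) ∈ convexHull ℝ (dualVertices M t) := by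
  have hpos : ∀ u ∈ hM.boundary, (0 : ℝ) < (det2 u (next M u) : ℤ) := fun u hu => by
    exact_mod_cast (hM.isStep_next (hM.mem_boundary.1 hu)).det_pos
  set D : ℝ := ∑ u ∈ hM.boundary, ((det2 u (next M u) : ℤ) : ℝ) with hD
  have hDpos : 0 < D := Finset.sum_pos hpos hM.boundary_nonempty
  have hmem := (convex_convexHull ℝ (dualVertices M t)).sum_mem (t := hM.boundary)
    (w := fun u => ((det2 u (next M u) : ℤ) : ℝ) / D)
    (z := fun u => (t * (det2 u (next M u) : ℤ))⁻¹ • ofInt (stepNormal u (next M u)))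
    (fun u hu => (div_pos (hpos u hu) hDpos).le)
    (by rw [← Finset.sum_div, ← hD, div_self hDpos.ne'])
    (fun u hu => subset_convexHull ℝ _ ⟨u, next M u, hM.isStep_next (hM.mem_boundary.1 hu), rfl⟩)
  have hzero : ∑ u ∈ hM.boundary, stepNormal u (next M u) = 0 := by
    funext i
    rw [Finset.sum_apply]
    fin_cases i
    · have := hM.sum_next (fun u => u 1)
      simp only [stepNormal, Fin.zero_eta, Matrix.cons_val_zero, Pi.sub_apply, Pi.zero_apply,
        Finset.sum_neg_distrib, Finset.sum_sub_distrib]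
      omega
    · have := hM.sum_next (fun u => u 0)
      simp only [stepNormal, Fin.mk_one, Matrix.cons_val_one, Pi.sub_apply, Pi.zero_apply]
      simpa [sub_eq_zero] using this
  have hsum : ∑ u ∈ hM.boundary, (((det2 u (next M u) : ℤ) : ℝ) / D) •
      ((t * (det2 u (next M u) : ℤ))⁻¹ • ofInt (stepNormal u (next M u))) = 0 := by
    have h1 : ∀ u ∈ hM.boundary, (((det2 u (next M u) : ℤ) : ℝ) / D) •
        ((t * (det2 u (next M u) : ℤ))⁻¹ • ofInt (stepNormal u (next M u))) =
        (D * t)⁻¹ • ofInt (stepNormal u (next M u)) := by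
      intro u hu
      have := (hpos u hu).ne'
      rw [smul_smul]
      congr 1
      field_simp
    rw [Finset.sum_congr rfl h1, ← Finset.smul_sum]
    have h2 : ∑ u ∈ hM.boundary, ofInt (stepNormal u (next M u)) =
        ofInt (∑ u ∈ hM.boundary, stepNormal u (next M u)) := by
      funext i
      simp
    rw [h2, hzero, ofInt_zero, smul_zero]
  rwa [hsum] at hmem

theorem dual_smul_eq_convexHull (hM : IsOriginPolygon M) {t : ℝ} (ht : 0 < t) :
    dual (t • M) = convexHull ℝ (dualVertices M t) := by
  refine Set.Subset.antisymm (fun y hy => ?_)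
    (convexHull_min (hM.dualVertices_subset ht) (convex_dual _))
  by_contra hcon
  obtain ⟨f, c, hf, hc⟩ := geometric_hahn_banach_closed_point (convex_convexHull ℝ _)
    ((hM.finite_dualVertices t).isCompact_convexHull ℝ).isClosed hcon
  obtain ⟨n, hn⟩ := exists_dotProduct_of_functional f
  have hc0 : 0 < c := by
    have := hf 0 (hM.zero_mem_convexHull_dualVertices ht)
    rwa [map_zero] at this
  -- the separating functional is a point of `t • M` that violates the inequality for `y`
  have hx : (-c⁻¹) • n ∈ t • M := by
    rw [hM.mem_smul_iff ht.le]
    intro u v h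
    have hp : (0 : ℝ) < (det2 u v : ℤ) := by exact_mod_cast h.det_pos
    have h1 := hf _ (subset_convexHull ℝ _ ⟨u, v, h, rfl⟩)
    rw [hn, smul_dotProduct, stepNormal_dotProduct, smul_eq_mul,
      inv_mul_lt_iff₀ (by positivity)] at h1
    have h2 : det2 ((-c⁻¹) • n) (ofInt (v - u)) = c⁻¹ * (-det2 n (ofInt (v - u))) := by
      simp [det2]; ring
    rw [h2, inv_mul_le_iff₀ hc0]
    linarith
  have h1 := hy _ hx
  rw [hn] at hc
  rw [dotProduct_smul, smul_eq_mul] at h1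
  have h2 : c⁻¹ * c < c⁻¹ * (y ⬝ᵥ n) := mul_lt_mul_of_pos_left hc (inv_pos.2 hc0)
  rw [inv_mul_cancel₀ hc0.ne'] at h2
  linarith

theorem dual_dual_smul (hM : IsOriginPolygon M) {t : ℝ} (ht : 0 < t) :
    dual (dual (t • M)) = t • M := by
  refine Set.Subset.antisymm (fun x hx => ?_) (subset_dual_dual _)
  rw [hM.mem_smul_iff ht.le]
  intro u v h
  have hp : (0 : ℝ) < (det2 u v : ℤ) := by exact_mod_cast h.det_pos
  have h1 := hx _ (hM.dualVertices_subset ht ⟨u, v, h, rfl⟩)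
  rw [dotProduct_comm, smul_dotProduct, stepNormal_dotProduct, smul_eq_mul, mul_neg,
    neg_le_neg_iff, inv_mul_le_iff₀ (by positivity)] at h1
  linarith

theorem dual_dual (hM : IsOriginPolygon M) : dual (dual M) = M := by
  simpa using hM.dual_dual_smul zero_lt_one

/-- The normal vectors of the steps give extreme points of the dual: two independent constraints
are active there. -/
lemma dualVertices_subset_extremePoints (hM : IsOriginPolygon M) {t : ℝ} (ht : 0 < t) :
    dualVertices M t ⊆ (dual (t • M)).extremePoints ℝ := by
  intro y hy
  refine ⟨hM.dualVertices_subset ht hy, ?_⟩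
  obtain ⟨u, v, h, rfl⟩ := hy
  have hp : (0 : ℝ) < (det2 u v : ℤ) := by exact_mod_cast h.det_pos
  rintro a ha b hb ⟨s, r, hs, hr, hsr, hab⟩
  have hw : ∀ w, ofInt w ∈ M → det2 w (v - u) = det2 u v → a ⬝ᵥ (t • ofInt w) = -1 := by
    intro w hwM hw
    have h1 := ha _ (Set.smul_mem_smul_set hwM)
    have h2 := hb _ (Set.smul_mem_smul_set hwM)
    have h3 := congrArg (fun y => y ⬝ᵥ (t • ofInt w)) hab
    simp only [add_dotProduct, smul_dotProduct, smul_eq_mul] at h3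
    rw [dotProduct_smul t (ofInt (stepNormal u v)), stepNormal_dotProduct, det2_ofInt, hw,
      smul_eq_mul, mul_neg, mul_neg, inv_mul_cancel₀ (by positivity)] at h3
    nlinarith
  have h1 := hw u h.left_mem h.det_left
  have h2 := hw v h.right_mem h.det_right
  have hne := hp.ne'
  simp only [Pi.smul_apply, smul_eq_mul, dotProduct, Fin.sum_univ_two, ofInt_apply] at h1 h2
  rw [← det2_ofInt] at hne hp ⊢
  simp only [det2, ofInt_apply] at hne hp
  apply plane_ext
  · simp only [stepNormal, det2, Pi.smul_apply, smul_eq_mul, ofInt_apply, Matrix.cons_val_zero,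
      Pi.sub_apply]
    rw [eq_inv_mul_iff_mul_eq₀ (by positivity)]
    push_cast
    linear_combination (v 1 : ℝ) * h1 - (u 1 : ℝ) * h2
  · simp only [stepNormal, det2, Pi.smul_apply, smul_eq_mul, ofInt_apply, Matrix.cons_val_one,
      Pi.sub_apply]
    rw [eq_inv_mul_iff_mul_eq₀ (by positivity)]
    push_cast
    linear_combination (-v 0 : ℝ) * h1 + (u 0 : ℝ) * h2

end IsOriginPolygon

/-! ### Edges and boundary steps -/

lemma exists_eq_smul_of_det2_eq_zero_real {d w : Plane} (hd : d ≠ 0) (h : det2 w d = 0) :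
    ∃ c : ℝ, w = c • d := by
  unfold det2 at h
  have hdd : d ⬝ᵥ d ≠ 0 := fun h => hd (dotProduct_self_eq_zero.1 h)
  refine ⟨(w ⬝ᵥ d) / (d ⬝ᵥ d), ?_⟩
  simp only [dotProduct, Fin.sum_univ_two] at hdd ⊢
  apply plane_ext
  · simp only [Pi.smul_apply, smul_eq_mul]
    rw [div_mul_eq_mul_div, eq_div_iff hdd]
    linear_combination d 1 * h
  · simp only [Pi.smul_apply, smul_eq_mul]
    rw [div_mul_eq_mul_div, eq_div_iff hdd]
    linear_combination (-d 0) * h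

/-- The affine hull of a set whose difference vectors are multiples of `x₂ - x₁` is the line through
`x₁` and `x₂`. -/
lemma affineSpan_eq_line {E : Set Plane} {x₁ x₂ d : Plane} {b : ℝ} (h₁ : x₁ ∈ E)
    (hne : x₁ ≠ x₂) (hspan : vectorSpan ℝ E = Submodule.span ℝ {x₂ - x₁})
    (hb₁ : det2 x₁ d = b) (hb₂ : det2 x₂ d = b) (hd : d ≠ 0) :
    (affineSpan ℝ E : Set Plane) = {x | det2 x d = b} := by
  have hsub : ∀ x y : Plane, det2 (x - y) d = det2 x d - det2 y d := fun x y => by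
    simp [det2]; ring
  obtain ⟨k, hk⟩ := exists_eq_smul_of_det2_eq_zero_real hd
    (show det2 (x₂ - x₁) d = 0 by rw [hsub, hb₁, hb₂, sub_self])
  have hk0 : k ≠ 0 := by
    rintro rfl
    rw [zero_smul] at hk
    exact hne (sub_eq_zero.1 hk).symm
  ext x
  rw [SetLike.mem_coe, ← AffineSubspace.vsub_right_mem_direction_iff_mem
    (mem_affineSpan ℝ h₁), direction_affineSpan, hspan, Submodule.mem_span_singleton, vsub_eq_sub]
  constructor
  · rintro ⟨c, hc⟩
    have h1 : det2 (x - x₁) d = 0 := by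
      rw [← hc, hk]; simp [det2]; ring
    rw [hsub] at h1
    exact (sub_eq_zero.1 h1).trans hb₁
  · intro hx
    obtain ⟨c, hc⟩ := exists_eq_smul_of_det2_eq_zero_real hd
      (show det2 (x - x₁) d = 0 by rw [hsub, hb₁, hx, sub_self])
    refine ⟨c / k, ?_⟩
    rw [hc, hk, smul_smul, div_mul_cancel₀ _ hk0]

lemma IsStep.ofInt_sub_ne_zero {M : Set Plane} {u v : Fin 2 → ℤ} (h : IsStep M u v) :
    ofInt (v - u) ≠ 0 := fun h0 => by
  have h1 : v - u = 0 := ofInt_injective (by simpa using h0)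
  have h2 := h.coprime
  rw [h1] at h2
  exact not_isCoprime_zero_zero h2

namespace IsOriginPolygon

variable {M : Set Plane}

/-- The face of `t • M` on the line of a step is an edge. -/
lemma exists_isEdge_of_isStep (hM : IsOriginPolygon M) {t : ℝ} (ht : 0 < t) {u v : Fin 2 → ℤ}
    (h : IsStep M u v) : ∃ E, IsEdge (t • M) E ∧
      (affineSpan ℝ E : Set Plane) = {x | det2 x (ofInt (v - u)) = t * (det2 u v : ℤ)} := by
  set d := ofInt (v - u) with hd
  have hsmul : ∀ (x : Plane), det2 (t • x) d = t * det2 x d := fun x => by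
    simp [det2]; ring
  have hsub : ∀ x y : Plane, det2 (x - y) d = det2 x d - det2 y d := fun x y => by
    simp [det2]; ring
  have hu : det2 (t • ofInt u) d = t * (det2 u v : ℤ) := by
    rw [hsmul, hd, det2_ofInt, h.det_left]
  have hv : det2 (t • ofInt v) d = t * (det2 u v : ℤ) := by
    rw [hsmul, hd, det2_ofInt, h.det_right]
  have hne : t • ofInt u ≠ t • ofInt v := fun he => h.ofInt_sub_ne_zero (by
    rw [ofInt_sub, smul_right_injective Plane ht.ne' he, sub_self])
  let l : Plane →L[ℝ] ℝ := (d 1) • ContinuousLinearMap.proj 0 - (d 0) • ContinuousLinearMap.proj 1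
  have hl : ∀ x, l x = det2 x d := fun x => by
    simp [l, det2]; ring
  set E : Set Plane := {x ∈ t • M | ∀ y ∈ t • M, l y ≤ l x} with hE
  have hmem : ∀ x, x ∈ E ↔ x ∈ t • M ∧ det2 x d = t * (det2 u v : ℤ) := by
    intro x
    constructor
    · rintro ⟨hx, hx'⟩
      refine ⟨hx, le_antisymm ((hM.mem_smul_iff ht.le x).1 hx u v h) ?_⟩
      have := hx' _ (Set.smul_mem_smul_set h.left_mem)
      rwa [hl, hl, hu] at this
    · rintro ⟨hx, hx'⟩
      refine ⟨hx, fun y hy => ?_⟩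
      rw [hl, hl, hx']
      exact (hM.mem_smul_iff ht.le y).1 hy u v h
  have huE : t • ofInt u ∈ E := (hmem _).2 ⟨Set.smul_mem_smul_set h.left_mem, hu⟩
  have hvE : t • ofInt v ∈ E := (hmem _).2 ⟨Set.smul_mem_smul_set h.right_mem, hv⟩
  have hspan : vectorSpan ℝ E = Submodule.span ℝ {t • ofInt v - t • ofInt u} := by
    apply le_antisymm
    · rw [vectorSpan, Submodule.span_le]
      rintro _ ⟨x, hx, y, hy, rfl⟩
      obtain ⟨c, hc⟩ := exists_eq_smul_of_det2_eq_zero_real h.ofInt_sub_ne_zero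
        (show det2 (x - y) d = 0 by rw [hsub, ((hmem x).1 hx).2, ((hmem y).1 hy).2, sub_self])
      rw [SetLike.mem_coe, Submodule.mem_span_singleton]
      refine ⟨c / t, ?_⟩
      simp only [vsub_eq_sub]
      rw [hc, ← smul_sub, ← ofInt_sub, smul_smul, div_mul_cancel₀ _ ht.ne']
    · rw [Submodule.span_le, Set.singleton_subset_iff]
      exact vsub_mem_vectorSpan ℝ hvE huE
  refine ⟨E, ⟨fun _ => ⟨l, rfl⟩, ?_⟩, affineSpan_eq_line huE hne hspan hu hv h.ofInt_sub_ne_zero⟩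
  rw [hspan, finrank_span_singleton (sub_ne_zero.2 hne.symm)]

/-- Every edge of `t • M` lies on the line of a step: the one whose cell contains a point between
two points of the edge. -/
lemma exists_isStep_of_isEdge (hM : IsOriginPolygon M) {t : ℝ} (ht : 0 < t) {E : Set Plane}
    (hE : IsEdge (t • M) E) : ∃ u v, IsStep M u v ∧
      (affineSpan ℝ E : Set Plane) = {x | det2 x (ofInt (v - u)) = t * (det2 u v : ℤ)} := by
  obtain ⟨hexp, hrank⟩ := hE
  have hnt : E.Nontrivial := by
    rw [← Set.not_subsingleton_iff]
    intro hs
    rw [vectorSpan_of_subsingleton ℝ hs, finrank_bot] at hrank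
    exact zero_ne_one hrank
  obtain ⟨x₁, h₁, x₂, h₂, hne⟩ := hnt
  obtain ⟨l, hl⟩ := hexp ⟨x₁, h₁⟩
  have h₁' : x₁ ∈ t • M ∧ ∀ y ∈ t • M, l y ≤ l x₁ := by rw [hl] at h₁; exact h₁
  have h₂' : x₂ ∈ t • M ∧ ∀ y ∈ t • M, l y ≤ l x₂ := by rw [hl] at h₂; exact h₂
  have hll : l x₁ = l x₂ := le_antisymm (h₂'.2 _ h₁'.1) (h₁'.2 _ h₂'.1)
  have hpos : 0 < l x₁ := by
    by_contra! hcon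
    obtain ⟨n, hn⟩ := exists_dotProduct_of_functional l
    have hn0 : n = 0 := hM.eq_zero_of_forall_lattice_le n fun z hz => by
      have h3 := (h₁'.2 _ (Set.smul_mem_smul_set hz)).trans hcon
      rw [hn, smul_dotProduct, smul_eq_mul] at h3
      exact nonpos_of_mul_nonpos_right h3 ht
    -- otherwise the whole polygon would be the edge
    have hEP : E = t • M := by
      rw [hl]
      ext x
      simp [hn, hn0]
    have hint : (interior (t • M)).Nonempty := by
      rw [interior_smul₀ ht.ne']
      exact ⟨_, Set.smul_mem_smul_set hM.zero_mem⟩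
    have htop : affineSpan ℝ E = ⊤ := by
      rw [hEP]
      exact affineSpan_eq_top_of_nonempty_interior
        (hint.mono (interior_mono (subset_convexHull ℝ _)))
    rw [← direction_affineSpan, htop, AffineSubspace.direction_top, finrank_top] at hrank
    simp at hrank
  set x : Plane := (2 : ℝ)⁻¹ • x₁ + (2 : ℝ)⁻¹ • x₂ with hx
  have hlx : l x = l x₁ := by
    rw [hx, map_add, map_smul, map_smul, ← hll, smul_eq_mul]; ring
  have hx0 : x ≠ 0 := fun h0 => by rw [h0, map_zero] at hlx; exact hpos.ne hlx
  obtain ⟨u, v, h, hc⟩ := hM.exists_inCell hx0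
  have hp : (0 : ℝ) < (det2 u v : ℤ) := by exact_mod_cast h.det_pos
  have b₁ := (hM.mem_smul_iff ht.le _).1 h₁'.1 u v h
  have b₂ := (hM.mem_smul_iff ht.le _).1 h₂'.1 u v h
  have havg : det2 x (ofInt (v - u)) =
      2⁻¹ * det2 x₁ (ofInt (v - u)) + 2⁻¹ * det2 x₂ (ofInt (v - u)) := by
    rw [hx]; simp [det2]; ring
  have hlev : t * (det2 u v : ℤ) ≤ det2 x (ofInt (v - u)) := by
    by_contra! hlt
    -- otherwise a larger multiple of `x` would lie in `t • M`
    have hlp := IsStep.level_pos_of_inCell hc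
    set s := det2 x (ofInt (v - u)) / (det2 u v : ℤ) with hs
    have hs0 : 0 < s := div_pos hlp hp
    have hst : s < t := by rw [hs, div_lt_iff₀ hp]; exact hlt
    have hmem : x ∈ s • M := h.mem_smul_of_inCell hM hc.1.le hc.2 hs0.le
      (by rw [hs, div_mul_cancel₀ _ hp.ne'])
    obtain ⟨y, hy, hyx⟩ := hmem
    have hyx : s • y = x := hyx
    have h3 := h₁'.2 _ (Set.smul_mem_smul_set hy)
    rw [← hlx, ← hyx, map_smul, map_smul, smul_eq_mul, smul_eq_mul] at h3
    rw [← hlx, ← hyx, map_smul, smul_eq_mul] at hpos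
    have h4 : 0 < l y := (mul_pos_iff_of_pos_left hs0).1 hpos
    nlinarith
  have e₁ : det2 x₁ (ofInt (v - u)) = t * (det2 u v : ℤ) := by linarith
  have e₂ : det2 x₂ (ofInt (v - u)) = t * (det2 u v : ℤ) := by linarith
  have hspan : vectorSpan ℝ E = Submodule.span ℝ {x₂ - x₁} := by
    symm
    apply Submodule.eq_of_le_of_finrank_eq
    · rw [Submodule.span_le, Set.singleton_subset_iff]
      exact vsub_mem_vectorSpan ℝ h₂ h₁
    · rw [hrank, finrank_span_singleton (sub_ne_zero.2 hne.symm)]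
  exact ⟨u, v, h, affineSpan_eq_line h₁ hne hspan e₁ e₂ h.ofInt_sub_ne_zero⟩

/-- The lines spanned by the edges of `t • M` are the lines of the steps. -/
theorem forall_isEdge_iff (hM : IsOriginPolygon M) {t : ℝ} (ht : 0 < t) (p : Set Plane → Prop) :
    (∀ E, IsEdge (t • M) E → p (affineSpan ℝ E : Set Plane)) ↔
      ∀ u v, IsStep M u v → p {x | det2 x (ofInt (v - u)) = t * (det2 u v : ℤ)} := by
  constructor
  · intro h u v huv
    obtain ⟨E, hE, hspan⟩ := hM.exists_isEdge_of_isStep ht huv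
    rw [← hspan]
    exact h E hE
  · intro h E hE
    obtain ⟨u, v, huv, hspan⟩ := hM.exists_isStep_of_isEdge ht hE
    rw [hspan]
    exact h u v huv

end IsOriginPolygon

end LDPPolygon

/-! ### The five conditions -/

namespace LDPPolygon

/-- All boundary steps of `M` have lattice distance `2` from the origin.  For `M = 2 • P` this is
the combinatorial form of each of the five conditions on `P`. -/
def HeightTwo (M : Set Plane) : Prop := ∀ u v, IsStep M u v → det2 u v = 2

lemma IsStep.coprime_stepNormal {M : Set Plane} {u v : Fin 2 → ℤ} (h : IsStep M u v) :
    IsCoprime (stepNormal u v 0) (stepNormal u v 1) := by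
  simp only [stepNormal, Matrix.cons_val_zero, Matrix.cons_val_one]
  exact h.coprime.symm.neg_left

lemma IsStep.pos_real {M : Set Plane} {u v : Fin 2 → ℤ} (h : IsStep M u v) :
    (0 : ℝ) < (det2 u v : ℤ) := by exact_mod_cast h.det_pos

/-- If `c / H` times a primitive vector is integral, then `H` divides `c`. -/
lemma dvd_of_coprime_of_smul_eq {H c : ℤ} {N n : Fin 2 → ℤ} (hN : IsCoprime (N 0) (N 1))
    (h : H • n = c • N) : H ∣ c := by
  obtain ⟨a, b, hab⟩ := hN
  have h0 := congrFun h 0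
  have h1 := congrFun h 1
  simp only [Pi.smul_apply, smul_eq_mul] at h0 h1
  exact ⟨a * n 0 + b * n 1, by linear_combination (-c) * hab - a * h0 - b * h1⟩

namespace IsOriginPolygon

variable {M : Set Plane}

lemma isBounded_smul (hM : IsOriginPolygon M) (t : ℝ) : Bornology.IsBounded (t • M) :=
  (hM.isCompact.smul t).isBounded

lemma zero_mem_interior_smul (hM : IsOriginPolygon M) {t : ℝ} (ht : 0 < t) :
    (0 : Plane) ∈ interior (t • M) := by
  rw [interior_smul₀ ht.ne']
  exact ⟨0, hM.zero_mem, by simp⟩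

lemma isLDP_dual_iff (hM : IsOriginPolygon M) :
    IsLDP (dual ((2⁻¹ : ℝ) • M)) ↔ HeightTwo M := by
  have h2 : (0 : ℝ) < 2⁻¹ := by norm_num
  constructor
  · rintro ⟨-, -, hext⟩ u v h
    obtain ⟨n, hn, hy⟩ := hext _ (hM.dualVertices_subset_extremePoints h2 ⟨u, v, h, rfl⟩)
    have he : (det2 u v) • n = (2 : ℤ) • stepNormal u v := by
      apply ofInt_injective
      rw [ofInt_smul, ofInt_smul, ← hy, smul_smul]
      congr 1
      have := h.pos_real.ne'
      field_simp
      norm_num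
    have d1 := dvd_of_coprime_of_smul_eq h.coprime_stepNormal he
    have d2 := dvd_of_coprime_of_smul_eq hn he.symm
    exact Int.dvd_antisymm h.det_pos.le (by norm_num) d1 d2
  · intro hH
    have hv : ∀ y ∈ dualVertices M 2⁻¹, ∃ n : Fin 2 → ℤ, IsCoprime (n 0) (n 1) ∧ y = ofInt n := by
      rintro _ ⟨u, v, h, rfl⟩
      refine ⟨stepNormal u v, h.coprime_stepNormal, ?_⟩
      rw [hH u v h]
      norm_num
    have h0 := zero_mem_interior_dual (hM.isBounded_smul 2⁻¹)
    refine ⟨isLatticePolygon_of_interior_nonempty (hM.finite_dualVertices 2⁻¹) ?_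
      (hM.dual_smul_eq_convexHull h2) ⟨0, h0⟩, h0, ?_⟩
    · intro y hy
      obtain ⟨n, -, rfl⟩ := hv y hy
      exact ofInt_mem_lattice n
    · intro y hy
      rw [hM.dual_smul_eq_convexHull h2] at hy
      exact hv y (extremePoints_convexHull_subset hy)

lemma forall_edge_dist_iff (hM : IsOriginPolygon M) :
    (∀ E, IsEdge ((2⁻¹ : ℝ) • M) E → HasLatticeDist E 0 1) ↔ HeightTwo M := by
  have h2 : (0 : ℝ) < 2⁻¹ := by norm_num
  refine (hM.forall_isEdge_iff h2 fun L => ∃ (n : Fin 2 → ℤ) (b : ℝ), IsCoprime (n 0) (n 1) ∧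
    L = {y | ofInt n ⬝ᵥ y = b} ∧ |ofInt n ⬝ᵥ (0 : Plane) - b| = 1).trans ?_
  constructor
  · intro hE u v h
    obtain ⟨n, b, hn, hL, hb⟩ := hE u v h
    have hsmul : ∀ x : Plane, det2 ((2⁻¹ : ℝ) • x) (ofInt (v - u)) =
        2⁻¹ * det2 x (ofInt (v - u)) := fun x => by simp [det2]; ring
    have hu : (2⁻¹ : ℝ) • ofInt u ∈ {y | ofInt n ⬝ᵥ y = b} := by
      rw [← hL, Set.mem_ofPred_eq, hsmul, det2_ofInt, h.det_left]
    have hv : (2⁻¹ : ℝ) • ofInt v ∈ {y | ofInt n ⬝ᵥ y = b} := by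
      rw [← hL, Set.mem_ofPred_eq, hsmul, det2_ofInt, h.det_right]
    rw [Set.mem_ofPred_eq, dotProduct_smul, smul_eq_mul] at hu hv
    -- both primitive normal vectors agree up to sign
    have hpar : det2 n (stepNormal u v) = 0 := by
      have h3 : ofInt n ⬝ᵥ ofInt v - ofInt n ⬝ᵥ ofInt u = ((det2 n (stepNormal u v) : ℤ) : ℝ) := by
        simp [det2, stepNormal, dotProduct, Fin.sum_univ_two]; ring
      have h4 : ((det2 n (stepNormal u v) : ℤ) : ℝ) = 0 := by rw [← h3]; linarith
      exact_mod_cast h4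
    have hN : ofInt (stepNormal u v) ⬝ᵥ ofInt u = -((det2 u v : ℤ) : ℝ) := by
      rw [stepNormal_dotProduct, det2_ofInt, h.det_left]
    have hp := h.pos_real
    rw [dotProduct_zero, zero_sub, abs_neg, ← hu] at hb
    have hb2 : ((det2 u v : ℤ) : ℝ) = 2 := by
      rcases eq_or_eq_neg_of_det2_eq_zero hn h.coprime_stepNormal hpar with e | e
      · rw [← e, hN, mul_neg, abs_neg, abs_of_pos (by positivity)] at hb
        linarith
      · have e' : ofInt n = -ofInt (stepNormal u v) := by
          rw [e]; funext i; simp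
        rw [e', neg_dotProduct, hN, neg_neg, abs_of_pos (by positivity)] at hb
        linarith
    exact_mod_cast hb2
  · intro hH u v h
    refine ⟨stepNormal u v, -1, h.coprime_stepNormal, ?_, by simp⟩
    ext x
    rw [Set.mem_ofPred_eq, Set.mem_ofPred_eq, stepNormal_dotProduct, hH u v h, neg_inj]
    norm_num

lemma forall_edge_lattice_iff (hM : IsOriginPolygon M) :
    (∀ E, IsEdge ((2⁻¹ : ℝ) • M) E → ((affineSpan ℝ E : Set Plane) ∩ lattice).Nonempty) ↔
      ∀ u v, IsStep M u v → 2 ∣ det2 u v := by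
  have h2 : (0 : ℝ) < 2⁻¹ := by norm_num
  refine (hM.forall_isEdge_iff h2 fun L => (L ∩ lattice).Nonempty).trans
    (forall₃_congr fun u v h => ?_)
  constructor
  · rintro ⟨_, hz, z, rfl⟩
    rw [Set.mem_ofPred_eq, det2_ofInt] at hz
    refine ⟨det2 z (v - u), ?_⟩
    have : ((det2 u v : ℤ) : ℝ) = 2 * ((det2 z (v - u) : ℤ) : ℝ) := by rw [hz]; ring
    exact_mod_cast this
  · rintro ⟨k, hk⟩
    obtain ⟨a, b, hab⟩ := h.coprime
    refine ⟨_, ?_, ofInt_mem_lattice ![k * b, -(k * a)]⟩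
    rw [Set.mem_ofPred_eq, det2_ofInt, hk]
    have : det2 ![k * b, -(k * a)] (v - u) = k := by
      simp only [det2, Matrix.cons_val_zero, Matrix.cons_val_one]; linear_combination k * hab
    rw [this]
    push_cast
    ring

/-- When all heights are `2`, the lattice points of the `k`-th dilate of `P = 2⁻¹ • M` are the
interior lattice points of the next dilate, because levels of lattice points are integers. -/
lemma mem_smul_iff_mem_interior (hM : IsOriginPolygon M) (hH : HeightTwo M) (k : ℕ)
    (z : Fin 2 → ℤ) : ofInt z ∈ (k : ℝ) • (2⁻¹ : ℝ) • M ↔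
      ofInt z ∈ interior (((k : ℝ) + 1) • (2⁻¹ : ℝ) • M) := by
  rw [smul_smul, smul_smul, hM.mem_smul_iff (by positivity),
    hM.mem_interior_smul_iff (by positivity)]
  refine forall₃_congr fun u v h => ?_
  rw [hH u v h, det2_ofInt]
  have e1 : (k : ℝ) * 2⁻¹ * ((2 : ℤ) : ℝ) = ((k : ℤ) : ℝ) := by push_cast; ring
  have e2 : ((k : ℝ) + 1) * 2⁻¹ * ((2 : ℤ) : ℝ) = ((k + 1 : ℤ) : ℝ) := by push_cast; ring
  rw [e1, e2, Int.cast_le, Int.cast_lt, Int.lt_add_one_iff]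

lemma latticePoints_eq_interiorLatticePoints (hM : IsOriginPolygon M) (hH : HeightTwo M) (k : ℕ) :
    latticePoints ((k : ℝ) • (2⁻¹ : ℝ) • M) =
      interiorLatticePoints (((k : ℝ) + 1) • (2⁻¹ : ℝ) • M) := by
  rw [interiorLatticePoints_eq, latticePoints_eq_ncard, latticePoints_eq_ncard]
  congr 1
  ext z
  exact hM.mem_smul_iff_mem_interior hH k z

/-- If `P = 2⁻¹ • M` and the interior of `2 • P` have equally many lattice points, all heights are
at most `2`: below a step of height `H` there is a lattice point at level `H - 1` in its cell. -/
lemma height_le_two (hM : IsOriginPolygon M)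
    (hcard : latticePoints ((2⁻¹ : ℝ) • M) = interiorLatticePoints M) {u v : Fin 2 → ℤ}
    (h : IsStep M u v) : det2 u v ≤ 2 := by
  by_contra! hgt
  have hfin : {z : Fin 2 → ℤ | ofInt z ∈ interior M}.Finite :=
    hM.finite_lattice.subset fun z (hz : ofInt z ∈ interior M) =>
      (interior_subset hz : ofInt z ∈ M)
  have hsub : {z : Fin 2 → ℤ | ofInt z ∈ (2⁻¹ : ℝ) • M} ⊆ {z | ofInt z ∈ interior M} := by
    rintro z ⟨x, hx, hxz⟩
    rw [Set.mem_ofPred_eq, ← hxz]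
    exact hM.smul_mem_interior hx (by norm_num) (by norm_num)
  rw [interiorLatticePoints_eq, latticePoints_eq_ncard, latticePoints_eq_ncard] at hcard
  have heq := Set.eq_of_subset_of_ncard_le hsub hcard.ge hfin
  obtain ⟨a, b, hab⟩ := h.coprime
  set H := det2 u v with hH
  set e : Fin 2 → ℤ := ![b, -a] with he
  -- `u - e` has level `H - 1`; moving along the line brings it into the cell
  set z : Fin 2 → ℤ := u - e + (-((-det2 u e) / H)) • (v - u) with hz
  have hed : det2 e (v - u) = 1 := by
    simp only [det2, he, Matrix.cons_val_zero, Matrix.cons_val_one]; linear_combination hab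
  have hlev : det2 z (v - u) = H - 1 := by
    have : det2 z (v - u) = det2 u (v - u) - det2 e (v - u) := by simp [det2, hz]; ring
    rw [this, hed, h.det_left]
  have huz : det2 u z = (-det2 u e) % H := by
    have h1 : det2 u z = -det2 u e + (-((-det2 u e) / H)) * det2 u (v - u) := by
      simp [det2, hz]; ring
    rw [h1, h.det_left]
    have := Int.emod_add_mul_ediv (-det2 u e) H
    linarith
  have h0 : 0 ≤ det2 u z := by rw [huz]; exact Int.emod_nonneg _ (by omega)
  have h1 : det2 u z < H := by rw [huz]; exact Int.emod_lt_of_pos _ (by omega)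
  have hzv : det2 z v = H - 1 - det2 u z := by
    have : det2 z (v - u) = det2 z v + det2 u z := by simp [det2]; ring
    omega
  have hp := h.pos_real
  have hmem : ofInt z ∈ (((H - 1 : ℤ) : ℝ) / (H : ℝ)) • M := by
    refine h.mem_smul_of_inCell hM ?_ ?_ (div_nonneg ?_ hp.le) ?_
    · rw [det2_ofInt]; exact_mod_cast h0
    · rw [det2_ofInt, hzv]; exact_mod_cast (by omega : 0 ≤ H - 1 - det2 u z)
    · exact_mod_cast (by omega : 0 ≤ H - 1)
    · rw [det2_ofInt, hlev, div_mul_cancel₀ _ hp.ne']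
  have hint : z ∈ {z : Fin 2 → ℤ | ofInt z ∈ interior M} := by
    obtain ⟨x, hx, hxz⟩ := hmem
    rw [Set.mem_ofPred_eq, ← hxz]
    refine hM.smul_mem_interior hx (div_nonneg ?_ hp.le) ?_
    · exact_mod_cast (by omega : 0 ≤ H - 1)
    · rw [div_lt_one hp]; exact_mod_cast (by omega : H - 1 < H)
  rw [← heq, Set.mem_ofPred_eq, hM.mem_smul_iff (by norm_num)] at hint
  have hlast := hint u v h
  rw [det2_ofInt, hlev] at hlast
  have : (2 : ℝ) * ((H - 1 : ℤ) : ℝ) ≤ H := by linarith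
  have : 2 * (H - 1) ≤ H := by exact_mod_cast this
  omega

lemma area_half (hM : IsOriginPolygon M) : 8 * area ((2⁻¹ : ℝ) • M) = hM.heightSum := by
  rw [← hM.two_mul_area, area, area, MeasureTheory.Measure.addHaar_smul, ENNReal.toReal_mul]
  simp
  ring

lemma heightTwo_of_le (hM : IsOriginPolygon M) (hle : ∀ u v, IsStep M u v → det2 u v ≤ 2)
    (hsum : hM.heightSum = 2 * hM.boundary.card) : HeightTwo M := by
  intro u v h
  have h1 : ∀ u ∈ hM.boundary, det2 u (next M u) ≤ 2 := fun u hu =>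
    hle _ _ (hM.isStep_next (hM.mem_boundary.1 hu))
  have h2 : ∑ u ∈ hM.boundary, det2 u (next M u) = ∑ u ∈ hM.boundary, (2 : ℤ) := by
    rw [Finset.sum_const, nsmul_eq_mul, mul_comm]; exact hsum
  have := (Finset.sum_eq_sum_iff_of_le h1).1 h2 u (hM.mem_boundary.2 h.left_mem_bdry)
  rwa [h.next_eq] at this

lemma heightSum_of_heightTwo (hM : IsOriginPolygon M) (hH : HeightTwo M) :
    hM.heightSum = 2 * hM.boundary.card := by
  rw [heightSum, Finset.sum_congr rfl fun u hu => hH _ _ (hM.isStep_next (hM.mem_boundary.1 hu)),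
    Finset.sum_const, nsmul_eq_mul, mul_comm]

lemma natCast_mul_two_smul (m : ℕ) : ((2 * m : ℕ) : ℝ) • (2⁻¹ : ℝ) • M = (m : ℝ) • M := by
  rw [smul_smul]
  congr 1
  push_cast
  ring

/-- The Ehrhart polynomial when all heights are `2`.  For odd `k` the count is that of the interior
of the even dilate `k + 1`. -/
lemma four_mul_latticePoints (hM : IsOriginPolygon M) (hH : HeightTwo M) (k : ℕ) :
    4 * (latticePoints ((k : ℝ) • (2⁻¹ : ℝ) • M) : ℤ) =
      hM.boundary.card * k ^ 2 + hM.boundary.card * k + 4 := by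
  have hD := hM.heightSum_of_heightTwo hH
  rcases Nat.even_or_odd' k with ⟨m, rfl | rfl⟩
  · have := hM.two_mul_latticePoints_smul m
    rw [natCast_mul_two_smul]
    rw [hD] at this
    push_cast
    linarith
  · have h1 := hM.two_mul_interiorLatticePoints_smul (Nat.succ_pos m)
    rw [hD] at h1
    have h2 : (((2 * m + 1 : ℕ) : ℝ) + 1) = ((2 * (m + 1) : ℕ) : ℝ) := by push_cast; ring
    rw [hM.latticePoints_eq_interiorLatticePoints hH, h2, natCast_mul_two_smul]
    push_cast at h1 ⊢
    linarith

/-- A lattice point lies on the boundary of `P = 2⁻¹ • M` when its double is a boundary lattice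
point of `M`. -/
lemma latticePoints_half (hM : IsOriginPolygon M) : latticePoints ((2⁻¹ : ℝ) • M) =
    interiorLatticePoints ((2⁻¹ : ℝ) • M) +
      (hM.boundary.filter fun u => 2 ∣ u 0 ∧ 2 ∣ u 1).card := by
  have hsplit : {z : Fin 2 → ℤ | ofInt z ∈ (2⁻¹ : ℝ) • M} =
      {z | ofInt z ∈ interior ((2⁻¹ : ℝ) • M)} ∪ {z | (2 : ℤ) • z ∈ bdry M} := by
    ext z
    have h1 : ofInt z ∈ (2⁻¹ : ℝ) • M ↔ ofInt ((2 : ℤ) • z) ∈ M := by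
      rw [Set.mem_smul_set_iff_inv_smul_mem₀ (by norm_num), ofInt_smul, inv_inv]; norm_num
    have h2 : ofInt z ∈ interior ((2⁻¹ : ℝ) • M) ↔ ofInt ((2 : ℤ) • z) ∈ interior M := by
      rw [interior_smul₀ (by norm_num), Set.mem_smul_set_iff_inv_smul_mem₀ (by norm_num),
        ofInt_smul, inv_inv]; norm_num
    simp only [Set.mem_union, Set.mem_ofPred_eq, bdry, h1, h2]
    have hs : ofInt ((2 : ℤ) • z) ∈ interior M → ofInt ((2 : ℤ) • z) ∈ M :=
      fun h => interior_subset h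
    tauto
  have hfin : {z : Fin 2 → ℤ | ofInt z ∈ (2⁻¹ : ℝ) • M}.Finite :=
    finite_latticePoints_of_isBounded (hM.isBounded_smul _)
  have hinj : Function.Injective fun z : Fin 2 → ℤ => (2 : ℤ) • z :=
    smul_right_injective _ two_ne_zero
  have himg : (fun z : Fin 2 → ℤ => (2 : ℤ) • z) '' {z | (2 : ℤ) • z ∈ bdry M} =
      ↑(hM.boundary.filter fun u => 2 ∣ u 0 ∧ 2 ∣ u 1) := by
    ext u
    simp only [Set.mem_image, Set.mem_ofPred_eq, Finset.coe_filter, mem_boundary]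
    constructor
    · rintro ⟨z, hz, rfl⟩
      exact ⟨hz, by simp⟩
    · rintro ⟨hu, ⟨a, ha⟩, ⟨b, hb⟩⟩
      have : (2 : ℤ) • ![a, b] = u := by
        funext i; fin_cases i
        · simp [ha]
        · simp [hb]
      exact ⟨![a, b], by rwa [this], this⟩
  have hdisj : Disjoint {z : Fin 2 → ℤ | ofInt z ∈ interior ((2⁻¹ : ℝ) • M)}
      {z | (2 : ℤ) • z ∈ bdry M} := by
    refine Set.disjoint_left.2 fun z hz hz' => hz'.2 ?_
    have hz : ofInt z ∈ interior ((2⁻¹ : ℝ) • M) := hz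
    rw [interior_smul₀ (by norm_num), Set.mem_smul_set_iff_inv_smul_mem₀ (by norm_num),
      inv_inv] at hz
    rw [ofInt_smul]
    exact_mod_cast hz
  rw [interiorLatticePoints_eq, latticePoints_eq_ncard, latticePoints_eq_ncard, hsplit,
    Set.ncard_union_eq hdisj (hfin.subset (hsplit ▸ Set.subset_union_left))
      (hfin.subset (hsplit ▸ Set.subset_union_right)),
    ← Set.ncard_image_of_injective {z | (2 : ℤ) • z ∈ bdry M} hinj, himg, Set.ncard_coe_finset]

/-- Consecutive boundary lattice points are not both even, and an even one forces the height of the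
step to be even. -/
lemma two_mul_card_even_le (hM : IsOriginPolygon M) :
    2 * ((hM.boundary.filter fun u => 2 ∣ u 0 ∧ 2 ∣ u 1).card : ℤ) ≤
      ∑ u ∈ hM.boundary, if 2 ∣ det2 u (next M u) then 1 else 0 := by
  set f : (Fin 2 → ℤ) → ℤ := fun u => if 2 ∣ u 0 ∧ 2 ∣ u 1 then 1 else 0 with hf
  have h1 : ((hM.boundary.filter fun u => 2 ∣ u 0 ∧ 2 ∣ u 1).card : ℤ) =
      ∑ u ∈ hM.boundary, f u := by simp [hf]
  rw [two_mul, h1]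
  nth_rewrite 2 [← hM.sum_next f]
  rw [← Finset.sum_add_distrib]
  refine Finset.sum_le_sum fun u hu => ?_
  have h := hM.isStep_next (hM.mem_boundary.1 hu)
  simp only [hf]
  by_cases he : 2 ∣ u 0 ∧ 2 ∣ u 1
  · have hv : ¬(2 ∣ next M u 0 ∧ 2 ∣ next M u 1) := by
      rintro ⟨a, b⟩
      have := h.coprime.isUnit_of_dvd' (dvd_sub a he.1) (dvd_sub b he.2)
      exact absurd this (by decide)
    have hd : 2 ∣ det2 u (next M u) := dvd_sub (he.1.mul_right _) (he.2.mul_right _)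
    rw [if_pos he, if_neg hv, if_pos hd]
    norm_num
  · rw [if_neg he]
    by_cases hv : 2 ∣ next M u 0 ∧ 2 ∣ next M u 1
    · have hd : 2 ∣ det2 u (next M u) := dvd_sub (hv.2.mul_left _) (hv.1.mul_left _)
      rw [if_pos hv, if_pos hd]
      norm_num
    · rw [if_neg hv]
      split_ifs <;> norm_num

end IsOriginPolygon

/-- The quasi-polynomial with constant coefficients `c₀`, `c₁`, `c₂`. -/
def constQuasiPolynomial (c : Fin 3 → ℚ) (hc : c 2 ≠ 0) : QuasiPolynomial 2 where
  coeff j _ := c j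
  periodic _ := ⟨1, one_pos, fun _ => rfl⟩
  leading_ne_zero h := hc (congrFun h 0)

lemma quasiPeriod_constQuasiPolynomial (c : Fin 3 → ℚ) (hc : c 2 ≠ 0) :
    (constQuasiPolynomial c hc).quasiPeriod = 1 := by
  have hp : ∀ j, (constQuasiPolynomial c hc).period j = 1 := fun j => by
    have hmem : 1 ∈ {p : ℕ | 0 < p ∧
        Function.Periodic ((constQuasiPolynomial c hc).coeff j) (p : ℤ)} :=
      ⟨one_pos, fun _ => rfl⟩
    have h1 := Nat.sInf_le hmem
    have h2 := (Nat.sInf_mem ⟨1, hmem⟩).1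
    exact le_antisymm h1 h2
  refine Nat.dvd_one.1 (Finset.lcm_dvd fun j _ => ?_)
  rw [hp j]

lemma QuasiPolynomial.coeff_eq_of_quasiPeriod_eq_one {n : ℕ} {q : QuasiPolynomial n}
    (hq : q.quasiPeriod = 1) (j : Fin (n + 1)) (t : ℤ) : q.coeff j t = q.coeff j 0 := by
  have h1 : q.period j = 1 := Nat.dvd_one.1 (hq ▸ Finset.dvd_lcm (Finset.mem_univ j))
  have hne : {p : ℕ | 0 < p ∧ Function.Periodic (q.coeff j) (p : ℤ)}.Nonempty := q.periodic j
  have h2 := (Nat.sInf_mem hne).2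
  have h3 : sInf {p : ℕ | 0 < p ∧ Function.Periodic (q.coeff j) (p : ℤ)} = 1 := h1
  rw [h3] at h2
  have := h2.int_mul_eq t
  simpa using this

lemma QuasiPolynomial.eval_two (q : QuasiPolynomial 2) (t : ℤ) :
    q.eval t = q.coeff 0 t + q.coeff 1 t * t + q.coeff 2 t * t ^ 2 := by
  simp [QuasiPolynomial.eval, Fin.sum_univ_three]

namespace IsOriginPolygon

variable {M : Set Plane}

lemma exists_ehrhart (hM : IsOriginPolygon M) (hH : HeightTwo M) :
    ∃ q : QuasiPolynomial 2, IsEhrhart ((2⁻¹ : ℝ) • M) q ∧ q.quasiPeriod = 1 ∧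
      ∀ t : ℤ, (q.eval t : ℝ) = area ((2⁻¹ : ℝ) • M) * (t : ℝ) ^ 2 +
        area ((2⁻¹ : ℝ) • M) * (t : ℝ) + 1 := by
  have hB : (hM.boundary.card : ℚ) ≠ 0 := by
    exact_mod_cast (Finset.card_pos.2 hM.boundary_nonempty).ne'
  have hc : (![1, (hM.boundary.card : ℚ) / 4, (hM.boundary.card : ℚ) / 4] : Fin 3 → ℚ) 2 ≠ 0 := by
    simpa using hB
  have heval : ∀ t : ℤ, (constQuasiPolynomial _ hc).eval t =
      1 + (hM.boundary.card : ℚ) / 4 * t + (hM.boundary.card : ℚ) / 4 * t ^ 2 := fun t => by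
    rw [QuasiPolynomial.eval_two]; rfl
  refine ⟨constQuasiPolynomial _ hc, fun k _ => ?_, quasiPeriod_constQuasiPolynomial _ hc,
    fun t => ?_⟩
  · have h1 : (4 : ℚ) * (latticePoints ((k : ℝ) • (2⁻¹ : ℝ) • M) : ℚ) =
        hM.boundary.card * k ^ 2 + hM.boundary.card * k + 4 := by
      exact_mod_cast hM.four_mul_latticePoints hH k
    rw [heval]
    push_cast
    linarith
  · have h1 := hM.area_half
    rw [hM.heightSum_of_heightTwo hH] at h1
    push_cast at h1
    have h2 : area ((2⁻¹ : ℝ) • M) = (hM.boundary.card : ℝ) / 4 := by linarith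
    rw [heval, h2]
    push_cast
    ring

lemma interior_inter_lattice (hM : IsOriginPolygon M) (hH : HeightTwo M) :
    interior ((2⁻¹ : ℝ) • M) ∩ lattice = {0} := by
  ext x
  constructor
  · rintro ⟨hx, z, rfl⟩
    have h1 := (hM.mem_smul_iff_mem_interior hH 0 z).2 (by simpa using hx)
    obtain ⟨y, -, hy⟩ := h1
    rw [Set.mem_singleton_iff, ← hy]
    simp
  · rintro rfl
    exact ⟨hM.zero_mem_interior_smul (by norm_num), 0, ofInt_zero⟩

/-- The values of the Ehrhart polynomial at `1` and `2` say that the heights are at most `2` and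
that their average is `2`. -/
lemma heightTwo_of_ehrhart (hM : IsOriginPolygon M) {q : QuasiPolynomial 2}
    (hq : IsEhrhart ((2⁻¹ : ℝ) • M) q)
    (heval : ∀ t : ℤ, (q.eval t : ℝ) = area ((2⁻¹ : ℝ) • M) * (t : ℝ) ^ 2 +
        area ((2⁻¹ : ℝ) • M) * (t : ℝ) + 1) : HeightTwo M := by
  have hA := hM.area_half
  have e1 := heval 1
  have e2 := heval 2
  have q1 := hq 1 le_rfl
  have q2 := hq (2 * 1) one_le_two
  have hs2 := natCast_mul_two_smul (M := M) 1
  rw [Nat.cast_one, one_smul] at hs2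
  rw [show ((1 : ℕ) : ℝ) = 1 from Nat.cast_one, one_smul] at q1
  rw [hs2] at q2
  rw [show ((1 : ℕ) : ℤ) = 1 from rfl] at q1
  rw [show ((2 * 1 : ℕ) : ℤ) = 2 from rfl] at q2
  rw [q1] at e1
  rw [q2] at e2
  have hl := hM.two_mul_latticePoints_smul 1
  have hi := hM.two_mul_interiorLatticePoints_smul one_pos
  rw [Nat.cast_one, one_smul] at hl hi
  have hl' : 2 * (latticePoints M : ℝ) = hM.heightSum + hM.boundary.card + 2 := by
    have : 2 * (latticePoints M : ℤ) = hM.heightSum + hM.boundary.card + 2 := by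
      rw [hl]; push_cast; ring
    exact_mod_cast this
  have hi' : 2 * (interiorLatticePoints M : ℝ) = hM.heightSum - hM.boundary.card + 2 := by
    have : 2 * (interiorLatticePoints M : ℤ) = hM.heightSum - hM.boundary.card + 2 := by
      rw [hi]; push_cast; ring
    exact_mod_cast this
  push_cast at e1 e2
  have hD : (hM.heightSum : ℝ) = 2 * hM.boundary.card := by linarith
  have hcard : (latticePoints ((2⁻¹ : ℝ) • M) : ℝ) = interiorLatticePoints M := by linarith
  exact hM.heightTwo_of_le (fun u v h => hM.height_le_two (by exact_mod_cast hcard) h)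
    (by exact_mod_cast hD)

/-- The Ehrhart polynomial is known from the lattice polygons `m • M`, so that its value at `1`,
which is one more than the number of even boundary points of `M`, gives `8 * b = ∑ (h + 2)`, where
`b` is the number of even boundary points and the sum is over the heights `h` of the steps. An even
point makes the heights of two steps even, so that the left-hand side is at most `4` times the
number of even `h`; but `h + 2 ≥ 4` for even `h`, with equality only for `h = 2`, and `h + 2 > 0`
for odd `h`. -/
lemma heightTwo_of_isPseudoIntegral (hM : IsOriginPolygon M)
    (hint : interior ((2⁻¹ : ℝ) • M) ∩ lattice = {0})
    (hP : IsPseudoIntegral ((2⁻¹ : ℝ) • M)) : HeightTwo M := by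
  obtain ⟨q, hq, hper⟩ := hP
  have heval : ∀ t, q.eval t = q.coeff 0 0 + q.coeff 1 0 * t + q.coeff 2 0 * t ^ 2 := fun t => by
    rw [QuasiPolynomial.eval_two, QuasiPolynomial.coeff_eq_of_quasiPeriod_eq_one hper 0 t,
      QuasiPolynomial.coeff_eq_of_quasiPeriod_eq_one hper 1 t,
      QuasiPolynomial.coeff_eq_of_quasiPeriod_eq_one hper 2 t]
  -- the values at `2`, `4`, `6` determine the polynomial
  have heven : ∀ m : ℕ, 0 < m → 2 * (q.coeff 0 0 + q.coeff 1 0 * (2 * m) +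
      q.coeff 2 0 * (2 * m) ^ 2) = m ^ 2 * hM.heightSum + m * hM.boundary.card + 2 := by
    intro m hm
    have h1 := hq (2 * m) (by omega)
    rw [natCast_mul_two_smul, heval] at h1
    have h2 : 2 * (latticePoints ((m : ℝ) • M) : ℚ) =
        m ^ 2 * hM.heightSum + m * hM.boundary.card + 2 := by
      exact_mod_cast hM.two_mul_latticePoints_smul m
    rw [← h2, ← h1]
    push_cast
    ring
  have h2 := heven 1 one_pos
  have h4 := heven 2 two_pos
  have h6 := heven 3 three_pos
  have h1 := hq 1 le_rfl
  rw [show ((1 : ℕ) : ℝ) = 1 from Nat.cast_one, one_smul, heval] at h1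
  have hone : interiorLatticePoints ((2⁻¹ : ℝ) • M) = 1 := by
    rw [interiorLatticePoints, hint, Set.ncard_singleton]
  have hl := hM.latticePoints_half
  rw [hone] at hl
  set b := (hM.boundary.filter fun u => 2 ∣ u 0 ∧ 2 ∣ u 1).card with hb
  rw [hl] at h1
  push_cast at h1 h2 h4 h6
  have hb8 : (8 : ℚ) * b = hM.heightSum + 2 * hM.boundary.card := by linarith
  have hb8' : (8 : ℤ) * b = hM.heightSum + 2 * hM.boundary.card := by exact_mod_cast hb8
  have hle := hM.two_mul_card_even_le
  have hterm : ∀ u ∈ hM.boundary,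
      (4 * if 2 ∣ det2 u (next M u) then 1 else 0 : ℤ) ≤ det2 u (next M u) + 2 := by
    intro u hu
    have := (hM.isStep_next (hM.mem_boundary.1 hu)).det_pos
    split_ifs <;> omega
  have hsum : ∑ u ∈ hM.boundary, (det2 u (next M u) + 2) =
      hM.heightSum + 2 * hM.boundary.card := by
    rw [Finset.sum_add_distrib, Finset.sum_const, nsmul_eq_mul, mul_comm (_ : ℤ) 2, heightSum]
  have heq : ∑ u ∈ hM.boundary, (4 * if 2 ∣ det2 u (next M u) then 1 else 0 : ℤ) =
      ∑ u ∈ hM.boundary, (det2 u (next M u) + 2) := by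
    apply le_antisymm (Finset.sum_le_sum hterm)
    rw [hsum, ← Finset.mul_sum]
    linarith
  intro u v h
  have := (Finset.sum_eq_sum_iff_of_le hterm).1 heq u (hM.mem_boundary.2 h.left_mem_bdry)
  rw [h.next_eq] at this
  have hp := h.det_pos
  split_ifs at this <;> omega

/-- The five conditions are equivalent for `P = 2⁻¹ • M`: each says that all heights are `2`. -/
theorem tfae_half (hM : IsOriginPolygon M) : List.TFAE [
    IsLDP (dual ((2⁻¹ : ℝ) • M)),
    ∀ E, IsEdge ((2⁻¹ : ℝ) • M) E → HasLatticeDist E 0 1,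
    (∀ k : ℕ, latticePoints ((k : ℝ) • (2⁻¹ : ℝ) • M) =
        interiorLatticePoints (((k : ℝ) + 1) • (2⁻¹ : ℝ) • M)) ∧
      ∀ E, IsEdge ((2⁻¹ : ℝ) • M) E → ((affineSpan ℝ E : Set Plane) ∩ lattice).Nonempty,
    ∃ q : QuasiPolynomial 2, IsEhrhart ((2⁻¹ : ℝ) • M) q ∧
      ∀ t : ℤ, (q.eval t : ℝ) = area ((2⁻¹ : ℝ) • M) * (t : ℝ) ^ 2 +
        area ((2⁻¹ : ℝ) • M) * (t : ℝ) + 1,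
    interior ((2⁻¹ : ℝ) • M) ∩ lattice = {0} ∧ IsPseudoIntegral ((2⁻¹ : ℝ) • M)] := by
  refine List.tfae_of_forall (HeightTwo M) _ ?_
  simp only [List.mem_cons, List.not_mem_nil, or_false, forall_eq_or_imp, forall_eq]
  refine ⟨hM.isLDP_dual_iff, hM.forall_edge_dist_iff, ⟨fun ⟨h1, h2⟩ u v h => ?_, fun hH =>
    ⟨hM.latticePoints_eq_interiorLatticePoints hH, hM.forall_edge_lattice_iff.2 fun u v h =>
      (hH u v h).symm ▸ dvd_rfl⟩⟩, ⟨fun ⟨q, hq, he⟩ => hM.heightTwo_of_ehrhart hq he, fun hH =>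
    (hM.exists_ehrhart hH).imp fun q hq => ⟨hq.1, hq.2.2⟩⟩,
    ⟨fun ⟨h1, h2⟩ => hM.heightTwo_of_isPseudoIntegral h1 h2, fun hH =>
      ⟨hM.interior_inter_lattice hH, (hM.exists_ehrhart hH).imp fun q hq => ⟨hq.1, hq.2.1⟩⟩⟩⟩
  have hdvd := hM.forall_edge_lattice_iff.1 h2 u v h
  have hcard := h1 1
  rw [Nat.cast_one, one_smul, smul_smul, show ((1 : ℝ) + 1) * 2⁻¹ = 1 by norm_num,
    one_smul] at hcard
  have hle := hM.height_le_two hcard h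
  have hp := h.det_pos
  omega

end IsOriginPolygon

end LDPPolygon

/-! ### Unimodular maps and translations -/

namespace LDPPolygon

lemma map_mul_intCast (A B : Matrix (Fin 2) (Fin 2) ℤ) :
    (A * B).map (fun a : ℤ => (a : ℝ)) =
      A.map (fun a : ℤ => (a : ℝ)) * B.map (fun a : ℤ => (a : ℝ)) :=
  Matrix.map_mul (f := Int.castRingHom ℝ)

lemma map_one_intCast :
    (1 : Matrix (Fin 2) (Fin 2) ℤ).map (fun a : ℤ => (a : ℝ)) = 1 :=
  Matrix.map_one _ Int.cast_zero Int.cast_one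

/-- The linear automorphism of the plane given by a unimodular integer matrix. -/
noncomputable def unimodular (A : Matrix (Fin 2) (Fin 2) ℤ) (hA : IsUnit A.det) :
    Plane ≃ₗ[ℝ] Plane :=
  Matrix.toLin'OfInv (M := A⁻¹.map (fun a : ℤ => (a : ℝ))) (M' := A.map (fun a : ℤ => (a : ℝ)))
    (by rw [← map_mul_intCast, Matrix.nonsing_inv_mul A hA, map_one_intCast])
    (by rw [← map_mul_intCast, Matrix.mul_nonsing_inv A hA, map_one_intCast])

variable {A : Matrix (Fin 2) (Fin 2) ℤ}

lemma unimodular_apply (hA : IsUnit A.det) (x : Plane) :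
    unimodular A hA x = A.map (fun a : ℤ => (a : ℝ)) *ᵥ x := Matrix.toLin'_apply _ x

lemma unimodular_symm_apply (hA : IsUnit A.det) (x : Plane) :
    (unimodular A hA).symm x = A⁻¹.map (fun a : ℤ => (a : ℝ)) *ᵥ x := Matrix.toLin'_apply _ x

lemma map_mulVec_ofInt (A : Matrix (Fin 2) (Fin 2) ℤ) (z : Fin 2 → ℤ) :
    A.map (fun a : ℤ => (a : ℝ)) *ᵥ ofInt z = ofInt (A *ᵥ z) := by
  funext i
  simp only [Matrix.mulVec, dotProduct, Fin.sum_univ_two, ofInt_apply, Matrix.map_apply]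
  push_cast
  rfl

lemma unimodular_ofInt (hA : IsUnit A.det) (z : Fin 2 → ℤ) :
    unimodular A hA (ofInt z) = ofInt (A *ᵥ z) := by
  rw [unimodular_apply, map_mulVec_ofInt]

lemma linearUnimodularEquiv_iff {P P' : Set Plane} : LinearUnimodularEquiv P P' ↔
    ∃ (A : Matrix (Fin 2) (Fin 2) ℤ) (hA : IsUnit A.det), unimodular A hA '' P = P' := by
  constructor
  · rintro ⟨A, hA, h⟩
    exact ⟨A, hA, by rw [← h]; exact Set.image_congr fun x _ => unimodular_apply hA x⟩
  · rintro ⟨A, hA, h⟩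
    exact ⟨A, hA, by rw [← h]; exact Set.image_congr fun x _ => (unimodular_apply hA x).symm⟩

lemma LinearUnimodularEquiv.symm {P P' : Set Plane} (h : LinearUnimodularEquiv P P') :
    LinearUnimodularEquiv P' P := by
  obtain ⟨A, hA, rfl⟩ := linearUnimodularEquiv_iff.1 h
  refine ⟨A⁻¹, (Matrix.isUnit_nonsing_inv_det_iff).2 hA, ?_⟩
  rw [Set.image_image]
  refine (Set.image_congr fun x _ => ?_).trans (Set.image_id P)
  rw [← unimodular_symm_apply hA, LinearEquiv.symm_apply_apply]
  rfl

lemma LinearUnimodularEquiv.trans {P P' P'' : Set Plane} (h : LinearUnimodularEquiv P P')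
    (h' : LinearUnimodularEquiv P' P'') : LinearUnimodularEquiv P P'' := by
  obtain ⟨A, hA, rfl⟩ := h
  obtain ⟨B, hB, rfl⟩ := h'
  refine ⟨B * A, by rw [Matrix.det_mul]; exact hB.mul hA, ?_⟩
  rw [Set.image_image]
  refine Set.image_congr fun x _ => ?_
  rw [map_mul_intCast, Matrix.mulVec_mulVec]

/-- The dual transforms by the inverse transpose. -/
lemma LinearUnimodularEquiv.dual {P P' : Set Plane} (h : LinearUnimodularEquiv P P') :
    LinearUnimodularEquiv (dual P) (dual P') := by
  obtain ⟨A, hA, rfl⟩ := linearUnimodularEquiv_iff.1 h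
  have hAT : IsUnit Aᵀ.det := by rwa [Matrix.det_transpose]
  refine LinearUnimodularEquiv.symm (linearUnimodularEquiv_iff.2 ⟨Aᵀ, hAT, ?_⟩)
  have hpair : ∀ y x : Plane, y ⬝ᵥ unimodular A hA x = unimodular Aᵀ hAT y ⬝ᵥ x := by
    intro y x
    simp [unimodular_apply, Matrix.mulVec, dotProduct, Fin.sum_univ_two]
    ring
  ext y
  rw [LinearEquiv.image_eq_preimage_symm, Set.mem_preimage, mem_dual, mem_dual,
    Set.forall_mem_image]
  refine forall₂_congr fun x _ => ?_
  rw [hpair, LinearEquiv.apply_symm_apply]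

lemma interior_image_unimodular (hA : IsUnit A.det) (P : Set Plane) :
    interior (unimodular A hA '' P) = unimodular A hA '' interior P :=
  ((unimodular A hA).toContinuousLinearEquiv.toHomeomorph.image_interior P).symm

lemma IsLatticePolygon.interior_nonempty {P : Set Plane} (hP : IsLatticePolygon P) :
    (interior P).Nonempty := by
  obtain ⟨⟨S, -, rfl⟩, htop⟩ := hP
  exact (convex_convexHull ℝ _).interior_nonempty_iff_affineSpan_eq_top.2 htop

lemma IsLatticePolygon.image_unimodular (hA : IsUnit A.det) {P : Set Plane}
    (hP : IsLatticePolygon P) : IsLatticePolygon (unimodular A hA '' P) := by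
  have hint := hP.interior_nonempty
  obtain ⟨⟨S, hS, rfl⟩, -⟩ := hP
  refine isLatticePolygon_of_interior_nonempty (S := unimodular A hA '' S)
    (S.finite_toSet.image _) ?_ ?_ ?_
  · rintro _ ⟨x, hx, rfl⟩
    obtain ⟨z, rfl⟩ := hS hx
    rw [unimodular_ofInt]
    exact ofInt_mem_lattice _
  · exact (unimodular A hA).toLinearMap.image_convexHull _
  · rw [interior_image_unimodular]
    exact hint.image _

lemma IsOriginPolygon.image_unimodular (hA : IsUnit A.det) {M : Set Plane}
    (hM : IsOriginPolygon M) : IsOriginPolygon (unimodular A hA '' M) :=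
  ⟨hM.1.image_unimodular hA, by
    rw [interior_image_unimodular]
    exact ⟨0, hM.zero_mem, map_zero _⟩⟩

lemma IsLatticePolygon.vadd {P : Set Plane} (hP : IsLatticePolygon P) (w : Fin 2 → ℤ) :
    IsLatticePolygon (ofInt w +ᵥ P) := by
  have hint := hP.interior_nonempty
  obtain ⟨⟨S, hS, rfl⟩, -⟩ := hP
  refine isLatticePolygon_of_interior_nonempty (S := ofInt w +ᵥ (S : Set Plane))
    S.finite_toSet.vadd_set ?_ (convexHull_vadd _ _).symm ?_
  · rintro _ ⟨x, hx, rfl⟩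
    obtain ⟨z, rfl⟩ := hS hx
    exact ⟨w + z, by rw [ofInt_add]; rfl⟩
  · rw [interior_vadd]
    exact hint.image _

lemma natCast_smul_vadd (d : ℕ) (w : Fin 2 → ℤ) (P : Set Plane) :
    (d : ℝ) • (ofInt w +ᵥ P) = ofInt ((d : ℤ) • w) +ᵥ (d : ℝ) • P := by
  ext x
  simp only [Set.mem_smul_set, Set.mem_vadd_set, vadd_eq_add, exists_exists_and_eq_and, smul_add]
  simp only [ofInt_smul, Int.cast_natCast]

lemma isLatticePolygon_vadd_iff (w : Fin 2 → ℤ) (P : Set Plane) :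
    IsLatticePolygon (ofInt w +ᵥ P) ↔ IsLatticePolygon P := by
  refine ⟨fun h => ?_, fun h => h.vadd w⟩
  have := h.vadd (-w)
  rw [vadd_vadd, ← ofInt_add, neg_add_cancel, ofInt_zero, zero_vadd] at this
  exact this

lemma denom_vadd (w : Fin 2 → ℤ) (P : Set Plane) : denom (ofInt w +ᵥ P) = denom P := by
  unfold denom
  congr 1
  ext d
  rw [Set.mem_ofPred_eq, Set.mem_ofPred_eq, natCast_smul_vadd, isLatticePolygon_vadd_iff]

lemma vadd_inter_lattice (w : Fin 2 → ℤ) (P : Set Plane) :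
    (ofInt w +ᵥ P) ∩ lattice = ofInt w +ᵥ (P ∩ lattice) := by
  ext x
  simp only [Set.mem_inter_iff, Set.mem_vadd_set, vadd_eq_add]
  constructor
  · rintro ⟨⟨y, hy, rfl⟩, z, hz⟩
    exact ⟨y, ⟨hy, z - w, by rw [ofInt_sub, hz]; abel⟩, rfl⟩
  · rintro ⟨y, ⟨hy, z, rfl⟩, rfl⟩
    exact ⟨⟨_, hy, rfl⟩, w + z, ofInt_add w z⟩

lemma latticePoints_vadd (w : Fin 2 → ℤ) (P : Set Plane) :
    latticePoints (ofInt w +ᵥ P) = latticePoints P := by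
  rw [latticePoints, vadd_inter_lattice, latticePoints]
  exact Set.ncard_image_of_injective _ (add_right_injective _)

lemma IsPseudoIntegral.vadd {P : Set Plane} (hP : IsPseudoIntegral P) (w : Fin 2 → ℤ) :
    IsPseudoIntegral (ofInt w +ᵥ P) := by
  obtain ⟨q, hq, hper⟩ := hP
  refine ⟨q, fun k hk => ?_, hper⟩
  rw [natCast_smul_vadd, latticePoints_vadd]
  exact hq k hk

/-! ### Half-integral polygons and LDP polygons -/

lemma isLatticePolygon_smul_of_denom {P : Set Plane} {d : ℕ} (hd : 0 < d) (h : denom P = d) :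
    IsLatticePolygon ((d : ℝ) • P) := by
  have hne : {d : ℕ | 1 ≤ d ∧ IsLatticePolygon ((d : ℝ) • P)}.Nonempty := by
    rw [Set.nonempty_iff_ne_empty]
    intro he
    rw [denom, he, Nat.sInf_empty] at h
    omega
  have := (Nat.sInf_mem hne).2
  rw [show sInf {d : ℕ | 1 ≤ d ∧ IsLatticePolygon ((d : ℝ) • P)} = d from h] at this
  exact this

lemma denom_eq_two_iff {P : Set Plane} :
    denom P = 2 ↔ IsLatticePolygon ((2 : ℝ) • P) ∧ ¬IsLatticePolygon P := by
  constructor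
  · intro h
    refine ⟨by exact_mod_cast isLatticePolygon_smul_of_denom two_pos h, fun h1 => ?_⟩
    have : denom P ≤ 1 := Nat.sInf_le ⟨le_rfl, by simpa using h1⟩
    omega
  · rintro ⟨h2, h1⟩
    have hmem : 2 ∈ {d : ℕ | 1 ≤ d ∧ IsLatticePolygon ((d : ℝ) • P)} :=
      ⟨one_le_two, by exact_mod_cast h2⟩
    have hle : denom P ≤ 2 := Nat.sInf_le hmem
    obtain ⟨hge, hlat⟩ := Nat.sInf_mem ⟨2, hmem⟩
    have hne : denom P ≠ 1 := fun h => h1 (by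
      rw [show sInf {d : ℕ | 1 ≤ d ∧ IsLatticePolygon ((d : ℝ) • P)} = 1 from h] at hlat
      simpa using hlat)
    have hge' : 1 ≤ denom P := hge
    omega

lemma exists_eq_half_smul {P : Set Plane} (hP : denom P ∣ 2) (h0 : (0 : Plane) ∈ interior P) :
    ∃ M, IsOriginPolygon M ∧ P = (2⁻¹ : ℝ) • M := by
  have hdouble : IsOriginPolygon ((2 : ℝ) • P) := by
    rcases (Nat.dvd_prime Nat.prime_two).1 hP with h | h
    · have h1 := isLatticePolygon_smul_of_denom one_pos h
      rw [Nat.cast_one, one_smul] at h1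
      exact_mod_cast (IsOriginPolygon.mk h1 h0).smul two_pos
    · refine ⟨(denom_eq_two_iff.1 h).1, ?_⟩
      rw [interior_smul₀ two_ne_zero]
      exact ⟨0, h0, smul_zero _⟩
  exact ⟨_, hdouble, by rw [smul_smul]; norm_num⟩

/-- The multiple `c • dual Q` is a lattice polygon if and only if the heights of the steps of `Q`
divide `c`. -/
lemma IsOriginPolygon.isLatticePolygon_smul_dual_iff {Q : Set Plane} (hQ : IsOriginPolygon Q)
    {c : ℕ} (hc : 0 < c) :
    IsLatticePolygon ((c : ℝ) • LDPPolygon.dual Q) ↔ ∀ u v, IsStep Q u v → det2 u v ∣ c := by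
  have hcR : (0 : ℝ) < c := by exact_mod_cast hc
  have hdual : (c : ℝ) • LDPPolygon.dual Q = LDPPolygon.dual ((c : ℝ)⁻¹ • Q) := by
    rw [dual_smul (inv_ne_zero hcR.ne'), inv_inv]
  rw [hdual]
  constructor
  · rintro ⟨⟨S, hS, hSQ⟩, -⟩ u v h
    have hext := hQ.dualVertices_subset_extremePoints (inv_pos.2 hcR) ⟨u, v, h, rfl⟩
    rw [hSQ] at hext
    obtain ⟨n, hn⟩ := hS (extremePoints_convexHull_subset hext)
    refine dvd_of_coprime_of_smul_eq h.coprime_stepNormal (n := n) (ofInt_injective ?_)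
    rw [ofInt_smul, ofInt_smul, hn, smul_smul]
    congr 1
    have := h.pos_real.ne'
    field_simp
    simp
  · intro h
    refine isLatticePolygon_of_interior_nonempty (hQ.finite_dualVertices (c : ℝ)⁻¹) ?_
      (hQ.dual_smul_eq_convexHull (inv_pos.2 hcR))
      ⟨0, zero_mem_interior_dual (hQ.isBounded_smul _)⟩
    rintro _ ⟨u, v, huv, rfl⟩
    obtain ⟨k, hk⟩ := h u v huv
    refine ⟨k • stepNormal u v, ?_⟩
    rw [ofInt_smul]
    congr 1
    have h1 : (c : ℝ) = ((det2 u v : ℤ) : ℝ) * k := by exact_mod_cast hk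
    have := huv.pos_real.ne'
    rw [h1]
    field_simp

lemma IsLDP.isOriginPolygon {Q : Set Plane} (hQ : IsLDP Q) : IsOriginPolygon Q := ⟨hQ.1, hQ.2.1⟩

/-- The pseudo-integral polygons of denominator `2` whose only interior lattice point is the
origin. -/
structure IsHalfIntegralReflexive (P : Set Plane) : Prop where
  rational : IsRationalPolygon P
  denom_eq : denom P = 2
  pseudoIntegral : IsPseudoIntegral P
  interior_eq : interior P ∩ lattice = {0}

namespace IsHalfIntegralReflexive

variable {P : Set Plane}

lemma zero_mem (hP : IsHalfIntegralReflexive P) : (0 : Plane) ∈ interior P :=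
  (hP.interior_eq.symm ▸ Set.mem_singleton (0 : Plane) : (0 : Plane) ∈ interior P ∩ lattice).1

lemma dual_dual (hP : IsHalfIntegralReflexive P) : LDPPolygon.dual (LDPPolygon.dual P) = P := by
  obtain ⟨M, hM, rfl⟩ := exists_eq_half_smul hP.denom_eq.dvd hP.zero_mem
  exact hM.dual_dual_smul (by norm_num)

lemma isLDP_dual (hP : IsHalfIntegralReflexive P) : IsLDP (LDPPolygon.dual P) := by
  obtain ⟨M, hM, rfl⟩ := exists_eq_half_smul hP.denom_eq.dvd hP.zero_mem
  exact (hM.tfae_half.out 4 0).1 (And.intro hP.interior_eq hP.pseudoIntegral)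

lemma gorensteinIndex_dual (hP : IsHalfIntegralReflexive P) :
    gorensteinIndex (LDPPolygon.dual P) = 2 := by
  rw [gorensteinIndex, hP.dual_dual, hP.denom_eq]

end IsHalfIntegralReflexive

lemma IsLDP.isHalfIntegralReflexive_dual {Q : Set Plane} (hQ : IsLDP Q)
    (hg : gorensteinIndex Q = 2) : IsHalfIntegralReflexive (dual Q) := by
  have hbdd := hQ.isOriginPolygon.isCompact.isBounded
  have h0 := zero_mem_interior_dual hbdd
  have hdd := hQ.isOriginPolygon.dual_dual
  have hden : denom (dual Q) = 2 := hg
  obtain ⟨M, hM, hMP⟩ := exists_eq_half_smul hden.dvd h0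
  have htfae := (hM.tfae_half.out 0 4).1 (by rw [← hMP, hdd]; exact hQ)
  rw [← hMP] at htfae
  refine ⟨⟨?_, ?_⟩, hden, htfae.2, htfae.1⟩
  · classical
    obtain ⟨S, hS, hSM⟩ := hM.1.1
    refine ⟨S.image fun x => (2⁻¹ : ℝ) • x, ?_, ?_⟩
    · intro x hx
      obtain ⟨s, hs, rfl⟩ := Finset.mem_image.1 (Finset.mem_coe.1 hx)
      obtain ⟨z, rfl⟩ := hS hs
      refine ⟨fun i => (z i : ℚ) / 2, ?_⟩
      funext i
      simp
      ring
    · rw [Finset.coe_image, Set.image_smul, convexHull_smul, ← hSM, hMP]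
  · have hne : (interior (dual Q)).Nonempty := ⟨0, h0⟩
    exact affineSpan_eq_top_of_nonempty_interior
      (hne.mono (interior_mono (subset_convexHull ℝ _)))

lemma isHalfIntegralReflexive_iff {P : Set Plane} : IsHalfIntegralReflexive P ↔
    IsRationalPolygon P ∧ denom P = 2 ∧ IsPseudoIntegral P ∧ interior P ∩ lattice = {0} :=
  ⟨fun h => ⟨h.1, h.2, h.3, h.4⟩, fun h => ⟨h.1, h.2.1, h.2.2.1, h.2.2.2⟩⟩

/-- A polygon with a single interior lattice point can be translated so that it is the origin. -/
lemma exists_vadd_isHalfIntegralReflexive {P : Set Plane} (hP : IsRationalPolygon P)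
    (hd : denom P = 2) (hps : IsPseudoIntegral P) (hi : interiorLatticePoints P = 1) :
    ∃ w : Fin 2 → ℤ, IsHalfIntegralReflexive (ofInt w +ᵥ P) := by
  obtain ⟨x, hx⟩ := Set.ncard_eq_one.1 hi
  have hxmem : x ∈ interior P ∩ lattice := hx.symm ▸ Set.mem_singleton x
  obtain ⟨z, rfl⟩ := hxmem.2
  refine ⟨-z, ⟨?_, ?_⟩, by rw [denom_vadd, hd], hps.vadd _, ?_⟩
  · classical
    obtain ⟨S, hS, hSP⟩ := hP.1
    refine ⟨S.image fun x => ofInt (-z) + x, ?_, ?_⟩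
    · intro y hy
      obtain ⟨s, hs, rfl⟩ := Finset.mem_image.1 (Finset.mem_coe.1 hy)
      obtain ⟨q, rfl⟩ := hS hs
      exact show _ from ⟨fun i => -(z i : ℚ) + q i, by funext i; simp⟩
    · conv_lhs => rw [hSP]
      rw [Finset.coe_image, ← convexHull_vadd]
      rfl
  · have : (interior (ofInt (-z) +ᵥ P)).Nonempty := by
      rw [interior_vadd]
      exact Set.Nonempty.image _ ⟨_, hxmem.1⟩
    exact affineSpan_eq_top_of_nonempty_interior
      (this.mono (interior_mono (subset_convexHull ℝ _)))
  · rw [interior_vadd, vadd_inter_lattice, hx, Set.vadd_set_singleton, vadd_eq_add, ← ofInt_add,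
      neg_add_cancel, ofInt_zero]

/-- An affine equivalence between polygons whose only interior lattice points are known is the
composition of a translation and a linear equivalence. -/
lemma affineUnimodularEquiv_iff {P R : Set Plane} {w : Fin 2 → ℤ}
    (hP : interior (ofInt w +ᵥ P) ∩ lattice = {0}) (hR : interior R ∩ lattice = {0}) :
    AffineUnimodularEquiv P R ↔ LinearUnimodularEquiv (ofInt w +ᵥ P) R := by
  rw [linearUnimodularEquiv_iff]
  have himage : ∀ (A : Matrix (Fin 2) (Fin 2) ℤ) (hA : IsUnit A.det) (b : Fin 2 → ℤ),
      (fun x : Plane => A.map (fun a : ℤ => (a : ℝ)) *ᵥ x + ofInt b) '' P =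
        ofInt (b - A *ᵥ w) +ᵥ unimodular A hA '' (ofInt w +ᵥ P) := by
    intro A hA b
    rw [← Set.image_vadd, ← Set.image_vadd, Set.image_image, Set.image_image]
    refine Set.image_congr fun x _ => ?_
    simp only [vadd_eq_add]
    rw [map_add, unimodular_ofInt, ofInt_sub, unimodular_apply]
    abel
  constructor
  · rintro ⟨A, b, hA, h⟩
    refine ⟨A, hA, ?_⟩
    rw [himage A hA] at h
    -- the interior lattice point `0` is mapped to `b - A w`
    have h0 : (0 : Plane) ∈ interior (ofInt w +ᵥ P) :=
      (hP.symm ▸ Set.mem_singleton (0 : Plane) :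
        (0 : Plane) ∈ interior (ofInt w +ᵥ P) ∩ lattice).1
    have h1 : ofInt (b - A *ᵥ w) ∈ interior R ∩ lattice := by
      refine ⟨?_, ofInt_mem_lattice _⟩
      rw [← h, interior_vadd, interior_image_unimodular]
      exact ⟨0, ⟨0, h0, map_zero _⟩, by simp⟩
    rw [hR, Set.mem_singleton_iff] at h1
    rw [h1, zero_vadd] at h
    exact h
  · rintro ⟨A, hA, h⟩
    refine ⟨A, A *ᵥ w, hA, ?_⟩
    rw [himage A hA, sub_self, ofInt_zero, zero_vadd, h]

end LDPPolygon

/-! ### Convex hulls of finite sets of lattice points -/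

namespace LDPPolygon

/-- The integer vector with the given coordinates. -/
def vec (p : ℤ × ℤ) : Fin 2 → ℤ := ![p.1, p.2]

@[simp] lemma vec_zero (p : ℤ × ℤ) : vec p 0 = p.1 := rfl
@[simp] lemma vec_one (p : ℤ × ℤ) : vec p 1 = p.2 := rfl

lemma vec_injective : Function.Injective vec := fun p q h => by
  have h0 := congrFun h 0
  have h1 := congrFun h 1
  exact Prod.ext h0 h1

lemma vec_mk (z : Fin 2 → ℤ) : vec (z 0, z 1) = z := by
  funext i; fin_cases i <;> rfl

/-- The convex hull of a finite set of lattice points. -/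
def hull (V : Finset (ℤ × ℤ)) : Set Plane := convexHull ℝ ((fun p => ofInt (vec p)) '' V)

lemma convex_hull (V : Finset (ℤ × ℤ)) : Convex ℝ (hull V) := convex_convexHull ℝ _

lemma mem_hull {V : Finset (ℤ × ℤ)} {p : ℤ × ℤ} (hp : p ∈ V) : ofInt (vec p) ∈ hull V :=
  subset_convexHull ℝ _ ⟨p, hp, rfl⟩

lemma hull_subset {V : Finset (ℤ × ℤ)} {K : Set Plane} (hK : Convex ℝ K)
    (h : ∀ p ∈ V, ofInt (vec p) ∈ K) : hull V ⊆ K := by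
  refine convexHull_min ?_ hK
  rintro _ ⟨p, hp, rfl⟩
  exact h p hp

/-- A linear inequality on the generating points holds on the hull. -/
lemma det2_le_of_mem_hull {V : Finset (ℤ × ℤ)} {d : Fin 2 → ℤ} {c : ℤ}
    (h : ∀ p ∈ V, det2 (vec p) d ≤ c) {x : Plane} (hx : x ∈ hull V) :
    det2 x (ofInt d) ≤ c := by
  have hc : Convex ℝ {x : Plane | det2 x (ofInt d) ≤ c} :=
    convex_halfSpace_le ⟨fun x y => by simp [det2]; ring, fun c x => by simp [det2]; ring⟩ _
  refine hull_subset hc (fun p hp => ?_) hx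
  rw [Set.mem_ofPred_eq, det2_ofInt]
  exact_mod_cast h p hp

/-- The barycentric coordinates of a point with respect to a triangle. -/
lemma mem_of_triangle {K : Set Plane} (hK : Convex ℝ K) {a b c x : Plane} (ha : a ∈ K) (hb : b ∈ K)
    (hc : c ∈ K) (h1 : 0 ≤ det2 (b - x) (c - x)) (h2 : 0 ≤ det2 (c - x) (a - x))
    (h3 : 0 ≤ det2 (a - x) (b - x))
    (hpos : 0 < det2 (b - x) (c - x) + det2 (c - x) (a - x) + det2 (a - x) (b - x)) : x ∈ K := by
  set s := det2 (b - x) (c - x) + det2 (c - x) (a - x) + det2 (a - x) (b - x) with hs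
  have hmem : (det2 (b - x) (c - x) / s) • a + ((det2 (c - x) (a - x) / s) • b +
      (det2 (a - x) (b - x) / s) • c) ∈ K := by
    have := hK.sum_mem (t := Finset.univ)
      (w := ![det2 (b - x) (c - x) / s, det2 (c - x) (a - x) / s, det2 (a - x) (b - x) / s])
      (z := ![a, b, c]) ?_ ?_ ?_
    · simpa [Fin.sum_univ_three, add_assoc] using this
    · intro i _
      fin_cases i
      · exact div_nonneg h1 hpos.le
      · exact div_nonneg h2 hpos.le
      · exact div_nonneg h3 hpos.le
    · simp only [Fin.sum_univ_three, Matrix.cons_val_zero, Matrix.cons_val_one, Matrix.cons_val]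
      rw [← add_div, ← add_div, ← hs, div_self hpos.ne']
    · intro i _
      fin_cases i
      · exact ha
      · exact hb
      · exact hc
  convert hmem using 1
  have hs' := hpos.ne'
  apply plane_ext
  · simp only [Pi.add_apply, Pi.smul_apply, smul_eq_mul]
    rw [div_mul_eq_mul_div, div_mul_eq_mul_div, div_mul_eq_mul_div, ← add_div, ← add_div,
      eq_div_iff hs', hs]
    simp [det2]; ring
  · simp only [Pi.add_apply, Pi.smul_apply, smul_eq_mul]
    rw [div_mul_eq_mul_div, div_mul_eq_mul_div, div_mul_eq_mul_div, ← add_div, ← add_div,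
      eq_div_iff hs', hs]
    simp [det2]; ring

/-- The origin is an interior point of a triangle that winds around it. -/
lemma zero_mem_interior_of_triangle {K : Set Plane} (hK : Convex ℝ K) {a b c : Plane} (ha : a ∈ K)
    (hb : b ∈ K) (hc : c ∈ K) (h1 : 0 < det2 b c) (h2 : 0 < det2 c a) (h3 : 0 < det2 a b) :
    (0 : Plane) ∈ interior K := by
  have hopen : IsOpen {x : Plane | 0 < det2 (b - x) (c - x) ∧ 0 < det2 (c - x) (a - x) ∧
      0 < det2 (a - x) (b - x)} := by
    have hcont : ∀ p q : Plane, Continuous fun x : Plane => det2 (p - x) (q - x) := fun p q => by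
      unfold det2; fun_prop
    exact (isOpen_lt continuous_const (hcont b c)).inter
      ((isOpen_lt continuous_const (hcont c a)).inter (isOpen_lt continuous_const (hcont a b)))
  refine mem_interior.2 ⟨_, fun x hx => ?_, hopen, by simpa using ⟨h1, h2, h3⟩⟩
  exact mem_of_triangle hK ha hb hc hx.1.le hx.2.1.le hx.2.2.le
    (add_pos (add_pos hx.1 hx.2.1) hx.2.2)

/-- Membership of a lattice point in a lattice triangle. -/
lemma mem_hull_of_triangle {V : Finset (ℤ × ℤ)} {a b c : ℤ × ℤ} (ha : a ∈ V) (hb : b ∈ V)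
    (hc : c ∈ V) {z : Fin 2 → ℤ} (h1 : 0 ≤ det2 (vec b - z) (vec c - z))
    (h2 : 0 ≤ det2 (vec c - z) (vec a - z)) (h3 : 0 ≤ det2 (vec a - z) (vec b - z))
    (hpos : 0 < det2 (vec b - vec a) (vec c - vec a)) : ofInt z ∈ hull V := by
  have hR : ∀ p q : ℤ × ℤ, det2 (ofInt (vec p) - ofInt z) (ofInt (vec q) - ofInt z) =
      ((det2 (vec p - z) (vec q - z) : ℤ) : ℝ) := fun p q => by
    rw [← det2_ofInt, ofInt_sub, ofInt_sub]
  have hsum : det2 (vec b - z) (vec c - z) + det2 (vec c - z) (vec a - z) +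
      det2 (vec a - z) (vec b - z) = det2 (vec b - vec a) (vec c - vec a) := by
    simp [det2]; ring
  refine mem_of_triangle (convex_hull V) (mem_hull ha) (mem_hull hb) (mem_hull hc) ?_ ?_ ?_ ?_
  · rw [hR]; exact_mod_cast h1
  · rw [hR]; exact_mod_cast h2
  · rw [hR]; exact_mod_cast h3
  · rw [hR, hR, hR]; exact_mod_cast hsum ▸ hpos

/-- A point of a convex set on which a linear functional attains its maximum is a convex combination
of generators with the same value. -/
lemma mem_convexHull_filter {S : Set Plane} (d : Plane) {c : ℝ} (hle : ∀ s ∈ S, det2 s d ≤ c)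
    {x : Plane} (hx : x ∈ convexHull ℝ S) (hxc : det2 x d = c) :
    x ∈ convexHull ℝ {s ∈ S | det2 s d = c} := by
  rw [convexHull_eq] at hx
  obtain ⟨ι, t, w, z, hw, hw1, hz, hxz⟩ := hx
  rw [Finset.centerMass_eq_of_sum_1 _ _ hw1] at hxz
  have hval : ∑ i ∈ t, w i * (c - det2 (z i) d) = 0 := by
    have h1 : det2 x d = ∑ i ∈ t, w i * det2 (z i) d := by
      rw [← hxz]
      simp only [det2, Finset.sum_apply, Pi.smul_apply, smul_eq_mul, Finset.sum_mul]
      rw [← Finset.sum_sub_distrib]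
      exact Finset.sum_congr rfl fun i _ => by ring
    simp only [mul_sub, Finset.sum_sub_distrib, ← Finset.sum_mul, hw1]
    rw [← h1, hxc]
    ring
  have hzero := (Finset.sum_eq_zero_iff_of_nonneg fun i hi =>
    mul_nonneg (hw i hi) (sub_nonneg.2 (hle _ (hz i hi)))).1 hval
  have hsupp : ∀ i ∈ t, w i ≠ 0 → z i ∈ {s ∈ S | det2 s d = c} := fun i hi hwi =>
    ⟨hz i hi, (sub_eq_zero.1 ((mul_eq_zero.1 (hzero i hi)).resolve_left hwi)).symm⟩
  classical
  rw [← hxz, ← Finset.sum_filter_ne_zero]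
  have hne : ∀ i ∈ t, w i • z i ≠ 0 → w i ≠ 0 := fun i _ h hw0 => h (by rw [hw0, zero_smul])
  have hsum : ∑ i ∈ t with w i • z i ≠ 0, w i • z i = ∑ i ∈ t with w i ≠ 0, w i • z i := by
    rw [Finset.sum_filter_ne_zero, Finset.sum_filter_of_ne hne]
  rw [hsum]
  refine (convex_convexHull ℝ _).sum_mem (fun i hi => hw i (Finset.mem_filter.1 hi).1) ?_
    fun i hi => subset_convexHull ℝ _
      (hsupp i (Finset.mem_filter.1 hi).1 (Finset.mem_filter.1 hi).2)
  rw [Finset.sum_filter_ne_zero, hw1]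

/-- A step of a hull lies on a line through two of the generating points, so that a divisibility of
its height can be tested on pairs of generating points. -/
lemma IsStep.dvd_of_hull {V : Finset (ℤ × ℤ)} {c : ℤ}
    (hV : ∀ p ∈ V, ∀ q ∈ V, 0 < det2 (vec p) (vec q) →
      (∀ w ∈ V, 0 ≤ det2 (vec q - vec p) (vec w - vec p)) →
      det2 (vec p) (vec q) ∣ c * (q.1 - p.1) ∧ det2 (vec p) (vec q) ∣ c * (q.2 - p.2))
    {u v : Fin 2 → ℤ} (h : IsStep (hull V) u v) : det2 u v ∣ c := by
  set W : Set Plane := {s ∈ (fun p => ofInt (vec p)) '' (V : Set (ℤ × ℤ)) |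
    det2 s (ofInt (v - u)) = ((det2 u v : ℤ) : ℝ)} with hW
  have hle : ∀ s ∈ (fun p => ofInt (vec p)) '' (V : Set (ℤ × ℤ)),
      det2 s (ofInt (v - u)) ≤ ((det2 u v : ℤ) : ℝ) := fun s hs =>
    h.le s (subset_convexHull ℝ _ hs)
  have hu : ofInt u ∈ convexHull ℝ W := mem_convexHull_filter _ hle h.left_mem
    (by rw [det2_ofInt, h.det_left])
  have hv : ofInt v ∈ convexHull ℝ W := mem_convexHull_filter _ hle h.right_mem
    (by rw [det2_ofInt, h.det_right])
  have hnt : W.Nontrivial := by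
    rw [← Set.not_subsingleton_iff]
    intro hs
    rw [hs.convex.convexHull_eq] at hu hv
    have := h.ofInt_sub_ne_zero
    rw [ofInt_sub, hs hu hv, sub_self] at this
    exact this rfl
  obtain ⟨_, ⟨⟨p, hp, rfl⟩, hpl⟩, _, ⟨⟨q, hq, rfl⟩, hql⟩, hpq⟩ := hnt
  simp only [det2_ofInt, Int.cast_inj] at hpl hql
  have hpos := h.det_pos
  have hpar : det2 (v - u) (vec q - vec p) = 0 := by
    have : det2 (v - u) (vec q - vec p) = det2 (vec p) (v - u) - det2 (vec q) (v - u) := by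
      simp [det2]; ring
    rw [this, hpl, hql, sub_self]
  obtain ⟨k, hk⟩ := exists_eq_smul_of_det2_eq_zero h.coprime hpar
  have hk0 : k ≠ 0 := by
    rintro rfl
    rw [zero_smul] at hk
    exact hpq (congrArg ofInt (sub_eq_zero.1 hk).symm)
  -- the pair in the order of the step
  have main : ∀ p ∈ V, ∀ q ∈ V, ∀ k : ℤ, 0 < k → det2 (vec p) (v - u) = det2 u v →
      vec q - vec p = k • (v - u) → det2 u v ∣ c := by
    intro p hp q hq k hk hpl hk'
    have hdet : det2 (vec p) (vec q) = k * det2 u v := by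
      have : det2 (vec p) (vec q) = det2 (vec p) (vec q - vec p) := by simp [det2]; ring
      rw [this, hk', ← hpl]; simp [det2]; ring
    have h0 : q.1 - p.1 = k * (v - u) 0 := by
      have := congrFun hk' 0; simpa using this
    have h1 : q.2 - p.2 = k * (v - u) 1 := by
      have := congrFun hk' 1; simpa using this
    obtain ⟨d0, d1⟩ := hV p hp q hq (by rw [hdet]; positivity) fun w hw => by
      have h2 := h.le_int (mem_hull hw)
      have h3 : det2 (vec q - vec p) (vec w - vec p) =
          k * (det2 u v - det2 (vec w) (v - u)) := by
        rw [hk', ← hpl]; simp [det2]; ring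
      rw [h3]
      exact mul_nonneg hk.le (sub_nonneg.2 h2)
    rw [hdet, h0, mul_left_comm] at d0
    rw [hdet, h1, mul_left_comm] at d1
    have d0 := Int.dvd_of_mul_dvd_mul_left hk.ne' d0
    have d1 := Int.dvd_of_mul_dvd_mul_left hk.ne' d1
    obtain ⟨a, b, hab⟩ := h.coprime
    have : c = a * (c * (v - u) 0) + b * (c * (v - u) 1) := by linear_combination (-c) * hab
    rw [this]
    exact dvd_add (d0.mul_left _) (d1.mul_left _)
  rcases lt_or_gt_of_ne hk0 with hneg | hkpos
  · refine main q hq p hp (-k) (by omega) hql ?_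
    rw [neg_smul, ← hk]; abel
  · exact main p hp q hq k hkpos hpl hk

/-! ### The thirty polygons -/

/-- The vertices of the polygon with an edge of length `2` at height `2` on the line `y = 2` and
vertical edges that end at `(-1, -s)` and `(1, -t)`.  The left (right) edge is a point if `s = -2`
(`t = -2`). -/
def stripVertices (s t : ℤ) : Finset (ℤ × ℤ) := {(1, 2), (-1, 2), (-1, -s), (1, -t)}

/-- The vertex sets of the LDP polygons of Gorenstein index `2`.  Each of the polygons has an edge
on the line `y = 2`, of length `6` for the first, of length `4` for the next five, and of
length `2` for the others. -/
def vertexSets : List (Finset (ℤ × ℤ)) :=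
  [{(1, 2), (-5, 2), (1, -1)},
    {(1, 2), (-3, 2), (1, -2)},
    {(1, 2), (-3, 2), (1, -1)},
    {(1, 2), (-3, 2), (-2, 1), (1, -1)},
    {(1, 2), (-3, 2), (-1, 0), (1, -1)},
    {(1, 2), (-3, 2), (0, -1), (1, -1)},
    stripVertices (-2) 3, stripVertices (-1) 2, stripVertices 0 1,
    stripVertices (-2) 4, stripVertices (-1) 3, stripVertices 0 2, stripVertices 1 1,
    stripVertices (-2) 6, stripVertices (-1) 5, stripVertices 0 4, stripVertices 1 3,
    stripVertices 2 2,
    insert (0, -1) (stripVertices (-2) (-2)), insert (0, -1) (stripVertices (-2) (-1)),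
    insert (0, -1) (stripVertices (-2) 0), insert (0, -1) (stripVertices (-2) 1),
    insert (0, -1) (stripVertices (-2) 2), insert (0, -1) (stripVertices (-2) 3),
    insert (0, -1) (stripVertices (-1) (-1)), insert (0, -1) (stripVertices (-1) 0),
    insert (0, -1) (stripVertices (-1) 1), insert (0, -1) (stripVertices (-1) 2),
    insert (0, -1) (stripVertices 0 0), insert (0, -1) (stripVertices 0 1)]

lemma length_vertexSets : vertexSets.length = 30 := rfl

/-- A unimodular invariant of a set of lattice points, which separates the thirty vertex sets. -/
def pairInvariant (V : Finset (ℤ × ℤ)) : ℤ :=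
  ∑ p ∈ V, ∑ q ∈ V, (p.1 * q.2 - p.2 * q.1) ^ 2 * (Int.gcd (q.1 - p.1) (q.2 - p.2) : ℤ) ^ 2

lemma pairInvariant_nodup : (vertexSets.map pairInvariant).Nodup := by decide +kernel

/-- All properties of the thirty sets that are used, in a decidable form: the points are primitive,
every point is the only one on a supporting line, the heights of the edges divide `2`, and the
origin is an interior point at distance `2` from an edge on the line `y = 2`. -/
structure IsAdmissible (V : Finset (ℤ × ℤ)) : Prop where
  primitive : ∀ p ∈ V, Int.gcd p.1 p.2 = 1
  exposed : ∀ p ∈ V, ∃ q ∈ V, ∃ r ∈ V, ∀ w ∈ V, w ≠ p →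
    0 < (r.1 - q.1) * (w.2 - p.2) - (r.2 - q.2) * (w.1 - p.1)
  height : ∀ p ∈ V, ∀ q ∈ V, 0 < p.1 * q.2 - p.2 * q.1 →
    (∀ w ∈ V, 0 ≤ (q.1 - p.1) * (w.2 - p.2) - (q.2 - p.2) * (w.1 - p.1)) →
    p.1 * q.2 - p.2 * q.1 ∣ 2 * (q.1 - p.1) ∧ p.1 * q.2 - p.2 * q.1 ∣ 2 * (q.2 - p.2)
  top : (1, 2) ∈ V ∧ (∃ p ∈ V, p.1 ≤ -1 ∧ p.2 = 2) ∧ ∀ p ∈ V, p.2 ≤ 2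
  bottom : ∃ p ∈ V, ∃ q ∈ V, p.1 ≤ 0 ∧ 0 < q.1 ∧ 0 < p.1 * q.2 - p.2 * q.1

lemma isAdmissible_of_mem_vertexSets {V : Finset (ℤ × ℤ)} (hV : V ∈ vertexSets) :
    IsAdmissible V := by
  have h1 : ∀ V ∈ vertexSets, ∀ p ∈ V, Int.gcd p.1 p.2 = 1 := by decide +kernel
  have h2 : ∀ V ∈ vertexSets, ∀ p ∈ V, ∃ q ∈ V, ∃ r ∈ V, ∀ w ∈ V, w ≠ p →
    0 < (r.1 - q.1) * (w.2 - p.2) - (r.2 - q.2) * (w.1 - p.1) := by decide +kernel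
  have h3 : ∀ V ∈ vertexSets, ∀ p ∈ V, ∀ q ∈ V, 0 < p.1 * q.2 - p.2 * q.1 →
    (∀ w ∈ V, 0 ≤ (q.1 - p.1) * (w.2 - p.2) - (q.2 - p.2) * (w.1 - p.1)) →
    p.1 * q.2 - p.2 * q.1 ∣ 2 * (q.1 - p.1) ∧ p.1 * q.2 - p.2 * q.1 ∣ 2 * (q.2 - p.2) := by
    decide +kernel
  have h4 : ∀ V ∈ vertexSets, (1, 2) ∈ V ∧ (∃ p ∈ V, p.1 ≤ -1 ∧ p.2 = 2) ∧ ∀ p ∈ V, p.2 ≤ 2 := by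
    decide +kernel
  have h5 : ∀ V ∈ vertexSets, ∃ p ∈ V, ∃ q ∈ V, p.1 ≤ 0 ∧ 0 < q.1 ∧
    0 < p.1 * q.2 - p.2 * q.1 := by decide +kernel
  exact ⟨h1 V hV, h2 V hV, h3 V hV, h4 V hV, h5 V hV⟩

end LDPPolygon

/-! ### Vertices and unimodular equivalence -/

namespace LDPPolygon

lemma IsLatticePolygon.finite_extremePoints {P : Set Plane} (hP : IsLatticePolygon P) :
    (P.extremePoints ℝ).Finite := by
  obtain ⟨⟨S, -, rfl⟩, -⟩ := hP
  exact S.finite_toSet.subset extremePoints_convexHull_subset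

lemma IsLatticePolygon.extremePoints_subset_lattice {P : Set Plane} (hP : IsLatticePolygon P) :
    P.extremePoints ℝ ⊆ lattice := by
  obtain ⟨⟨S, hS, rfl⟩, -⟩ := hP
  exact extremePoints_convexHull_subset.trans hS

lemma IsLatticePolygon.convexHull_extremePoints {P : Set Plane} (hP : IsLatticePolygon P) :
    convexHull ℝ (P.extremePoints ℝ) = P := by
  have hfin := hP.finite_extremePoints
  obtain ⟨⟨S, -, rfl⟩, -⟩ := hP
  conv_rhs => rw [← closure_convexHull_extremePoints (S.finite_toSet.isCompact_convexHull ℝ)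
    (convex_convexHull ℝ _)]
  exact (hfin.isClosed_convexHull ℝ).closure_eq.symm

lemma gcd_dvd_gcd_mulVec (A : Matrix (Fin 2) (Fin 2) ℤ) (z : Fin 2 → ℤ) :
    Int.gcd (z 0) (z 1) ∣ Int.gcd ((A *ᵥ z) 0) ((A *ᵥ z) 1) := by
  refine Int.dvd_gcd ?_ ?_ <;> rw [Matrix.mulVec, dotProduct, Fin.sum_univ_two] <;>
    exact dvd_add ((Int.gcd_dvd_left ..).mul_left _) ((Int.gcd_dvd_right ..).mul_left _)

variable {A : Matrix (Fin 2) (Fin 2) ℤ}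

lemma gcd_mulVec (hA : IsUnit A.det) (z : Fin 2 → ℤ) :
    Int.gcd ((A *ᵥ z) 0) ((A *ᵥ z) 1) = Int.gcd (z 0) (z 1) := by
  refine Nat.dvd_antisymm ?_ (gcd_dvd_gcd_mulVec A z)
  have := gcd_dvd_gcd_mulVec A⁻¹ (A *ᵥ z)
  rwa [Matrix.mulVec_mulVec, Matrix.nonsing_inv_mul A hA, Matrix.one_mulVec] at this

lemma det2_mulVec (A : Matrix (Fin 2) (Fin 2) ℤ) (u v : Fin 2 → ℤ) :
    det2 (A *ᵥ u) (A *ᵥ v) = A.det * det2 u v := by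
  simp [det2, Matrix.mulVec, dotProduct, Fin.sum_univ_two, Matrix.det_fin_two]
  ring

lemma extremePoints_image_unimodular (hA : IsUnit A.det) (P : Set Plane) :
    (unimodular A hA '' P).extremePoints ℝ = unimodular A hA '' P.extremePoints ℝ :=
  (image_extremePoints (𝕜 := ℝ) (unimodular A hA) P).symm

lemma LinearUnimodularEquiv.isLDP {P P' : Set Plane} (h : LinearUnimodularEquiv P P')
    (hP : IsLDP P) : IsLDP P' := by
  obtain ⟨A, hA, rfl⟩ := linearUnimodularEquiv_iff.1 h
  have hO := hP.isOriginPolygon.image_unimodular hA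
  refine ⟨hO.1, hO.2, fun v hv => ?_⟩
  rw [extremePoints_image_unimodular] at hv
  obtain ⟨x, hx, rfl⟩ := hv
  obtain ⟨n, hn, rfl⟩ := hP.2.2 x hx
  refine ⟨A *ᵥ n, ?_, unimodular_ofInt hA n⟩
  rw [Int.isCoprime_iff_gcd_eq_one] at hn ⊢
  rw [gcd_mulVec hA, hn]

lemma LinearUnimodularEquiv.isLatticePolygon {P P' : Set Plane} (h : LinearUnimodularEquiv P P')
    (hP : IsLatticePolygon P) : IsLatticePolygon P' := by
  obtain ⟨A, hA, rfl⟩ := linearUnimodularEquiv_iff.1 h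
  exact hP.image_unimodular hA

lemma LinearUnimodularEquiv.smul {P P' : Set Plane} (h : LinearUnimodularEquiv P P') (c : ℝ) :
    LinearUnimodularEquiv (c • P) (c • P') := by
  obtain ⟨A, hA, rfl⟩ := linearUnimodularEquiv_iff.1 h
  exact linearUnimodularEquiv_iff.2 ⟨A, hA, image_smul_set (unimodular A hA) c P⟩

lemma LinearUnimodularEquiv.denom_eq {P P' : Set Plane} (h : LinearUnimodularEquiv P P') :
    denom P = denom P' := by
  unfold denom
  congr 1
  ext d
  exact and_congr_right fun _ =>
    ⟨(h.smul d).isLatticePolygon, (h.smul d).symm.isLatticePolygon⟩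

lemma LinearUnimodularEquiv.gorensteinIndex_eq {P P' : Set Plane}
    (h : LinearUnimodularEquiv P P') : gorensteinIndex P = gorensteinIndex P' :=
  h.dual.denom_eq

/-- An LDP polygon is the hull of a finite set of primitive lattice points. -/
lemma IsLDP.exists_eq_hull {Q : Set Plane} (hQ : IsLDP Q) :
    ∃ S : Finset (ℤ × ℤ), (∀ p ∈ S, Int.gcd p.1 p.2 = 1) ∧ Q = hull S := by
  have hfin : {p : ℤ × ℤ | ofInt (vec p) ∈ Q.extremePoints ℝ}.Finite :=
    hQ.1.finite_extremePoints.preimage (ofInt_injective.comp vec_injective).injOn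
  refine ⟨hfin.toFinset, fun p hp => ?_, ?_⟩
  · obtain ⟨n, hn, hp⟩ := hQ.2.2 _ (hfin.mem_toFinset.1 hp)
    rw [← ofInt_injective hp] at hn
    exact Int.isCoprime_iff_gcd_eq_one.1 hn
  · conv_lhs => rw [← hQ.1.convexHull_extremePoints]
    rw [hull, hfin.coe_toFinset]
    congr 1
    refine Set.Subset.antisymm (fun x hx => ?_) ?_
    · obtain ⟨z, rfl⟩ := hQ.1.extremePoints_subset_lattice hx
      exact ⟨(z 0, z 1), by rwa [Set.mem_ofPred_eq, vec_mk],
        congrArg ofInt (vec_mk z)⟩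
    · rintro _ ⟨p, hp, rfl⟩
      exact hp

/-! ### The hulls of admissible sets -/

namespace IsAdmissible

variable {V V' : Finset (ℤ × ℤ)}

lemma zero_mem_interior (hV : IsAdmissible V) : (0 : Plane) ∈ interior (hull V) := by
  obtain ⟨h1, ⟨⟨a, b⟩, h2, ha, rfl⟩, -⟩ := hV.top
  obtain ⟨p, hp, q, hq, hp0, hq0, hpq⟩ := hV.bottom
  have hp0' : (p.1 : ℝ) ≤ 0 := by exact_mod_cast hp0
  have hq0' : (0 : ℝ) < q.1 := by exact_mod_cast hq0
  have ha' : (a : ℝ) ≤ -1 := by exact_mod_cast ha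
  have hpq' : (0 : ℝ) < p.1 * q.2 - p.2 * q.1 := by exact_mod_cast hpq
  have hs : (0 : ℝ) < q.1 - p.1 := by linarith
  -- the point where the segment from `p` to `q` meets the negative vertical axis
  have hr : (![0, -((p.1 * q.2 - p.2 * q.1) / (q.1 - p.1))] : Plane) ∈ hull V := by
    convert convex_hull V (mem_hull hp) (mem_hull hq)
      (a := (q.1 / (q.1 - p.1) : ℝ)) (b := (-p.1 / (q.1 - p.1) : ℝ)) (by positivity)
      (div_nonneg (by linarith) hs.le) (by field_simp; ring) using 1
    apply plane_ext
    · simp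
      field_simp
      ring
    · simp
      field_simp
      ring
  have hy : 0 < (p.1 * q.2 - p.2 * q.1 : ℝ) / (q.1 - p.1) := by positivity
  refine zero_mem_interior_of_triangle (convex_hull V) (mem_hull h1) (mem_hull h2) hr ?_ ?_ ?_
  · simp [det2]
    nlinarith
  · simp [det2]
    exact hy
  · simp [det2]
    linarith

lemma extremePoints_hull (hV : IsAdmissible V) :
    (hull V).extremePoints ℝ = (fun p => ofInt (vec p)) '' (V : Set (ℤ × ℤ)) := by
  refine Set.Subset.antisymm extremePoints_convexHull_subset ?_
  rintro _ ⟨p, hp, rfl⟩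
  obtain ⟨q, -, r, -, hqr⟩ := hV.exposed p hp
  set d : Fin 2 → ℤ := vec r - vec q with hd
  have hlt : ∀ w ∈ V, w ≠ p → det2 (vec w) d < det2 (vec p) d := fun w hw hwp => by
    have := hqr w hw hwp
    simp only [det2, hd, Pi.sub_apply, vec_zero, vec_one]
    linarith
  have hle : ∀ x ∈ hull V, det2 x (ofInt d) ≤ (det2 (vec p) d : ℤ) := fun x hx =>
    det2_le_of_mem_hull (fun w hw => by
      rcases eq_or_ne w p with rfl | hwp
      · exact le_rfl
      · exact (hlt w hw hwp).le) hx
  refine mem_extremePoints_iff_left.2 ⟨mem_hull hp, fun x hx y hy hxy => ?_⟩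
  obtain ⟨a, b, ha, hb, hab, hxyp⟩ := hxy
  have hsum : a * det2 x (ofInt d) + b * det2 y (ofInt d) = (det2 (vec p) d : ℤ) := by
    rw [← det2_ofInt, ← show a • x + b • y = ofInt (vec p) from hxyp]
    simp [det2]
    ring
  have hxc : det2 x (ofInt d) = (det2 (vec p) d : ℤ) := by
    refine le_antisymm (hle x hx) ?_
    have h1 := mul_le_mul_of_nonneg_left (hle y hy) hb.le
    have hb' : b = 1 - a := by linarith
    subst hb'
    nlinarith
  have hmem := mem_convexHull_filter (ofInt d) (fun s hs => hle s (subset_convexHull ℝ _ hs)) hx hxc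
  have hsub : {s ∈ (fun p => ofInt (vec p)) '' (V : Set (ℤ × ℤ)) |
      det2 s (ofInt d) = ((det2 (vec p) d : ℤ) : ℝ)} ⊆ {ofInt (vec p)} := by
    rintro _ ⟨⟨w, hw, rfl⟩, hwd⟩
    rw [det2_ofInt, Int.cast_inj] at hwd
    rcases eq_or_ne w p with rfl | hwp
    · rfl
    · exact absurd hwd (hlt w hw hwp).ne
  have := convexHull_mono hsub hmem
  rwa [convexHull_singleton] at this

lemma isLDP_hull (hV : IsAdmissible V) : IsLDP (hull V) := by
  refine ⟨isLatticePolygon_of_interior_nonempty (V.finite_toSet.image _) ?_ rfl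
    ⟨0, hV.zero_mem_interior⟩, hV.zero_mem_interior, fun v hv => ?_⟩
  · rintro _ ⟨p, -, rfl⟩
    exact ofInt_mem_lattice _
  · rw [hV.extremePoints_hull] at hv
    obtain ⟨p, hp, rfl⟩ := hv
    exact ⟨vec p, Int.isCoprime_iff_gcd_eq_one.2 (hV.primitive p hp), rfl⟩

lemma gorensteinIndex_hull (hV : IsAdmissible V) : gorensteinIndex (hull V) = 2 := by
  have hO := hV.isLDP_hull.isOriginPolygon
  refine denom_eq_two_iff.2 ⟨?_, fun h => ?_⟩
  · have := (hO.isLatticePolygon_smul_dual_iff two_pos).2 fun u v huv =>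
      IsStep.dvd_of_hull (c := 2) hV.height huv
    exact_mod_cast this
  · obtain ⟨h1, ⟨⟨a, b⟩, h2, ha, rfl⟩, htop⟩ := hV.top
    have ha' : (a : ℝ) ≤ -1 := by exact_mod_cast ha
    have hs : (0 : ℝ) < 1 - a := by linarith
    have hmid : ofInt ![0, 2] ∈ hull V := by
      convert convex_hull V (mem_hull h1) (mem_hull h2) (a := (-a / (1 - a) : ℝ))
        (b := (1 / (1 - a) : ℝ)) (div_nonneg (by linarith) hs.le) (by positivity)
        (by field_simp; ring) using 1
      apply plane_ext
      · simp
        field_simp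
        ring
      · simp
        field_simp
        ring
    have hstep : IsStep (hull V) (vec (1, 2)) ![0, 2] := by
      refine ⟨mem_hull h1, hmid, by simp [det2], by simp [isCoprime_zero_right], fun x hx => ?_⟩
      refine det2_le_of_mem_hull (fun p hp => ?_) hx
      have := htop p hp
      simpa [det2] using this
    have := (hO.isLatticePolygon_smul_dual_iff one_pos).1 (by simpa using h) _ _ hstep
    simp [det2] at this

/-- The vertices of equivalent polygons are matched by a unimodular matrix, which preserves
determinants up to sign and greatest common divisors. -/
lemma pairInvariant_eq (hV : IsAdmissible V) (hV' : IsAdmissible V')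
    (h : LinearUnimodularEquiv (hull V) (hull V')) : pairInvariant V = pairInvariant V' := by
  obtain ⟨A, hA, hAV⟩ := linearUnimodularEquiv_iff.1 h
  have hdet : A.det ^ 2 = 1 := by
    rcases Int.isUnit_iff.1 hA with h | h <;> rw [h] <;> norm_num
  set f : ℤ × ℤ → ℤ × ℤ := fun p => ((A *ᵥ vec p) 0, (A *ᵥ vec p) 1) with hf
  have hfv : ∀ p, vec (f p) = A *ᵥ vec p := fun p => vec_mk _
  have hinj : Function.Injective f := fun p q hpq => by
    have := congrArg (fun p => A⁻¹ *ᵥ vec p) hpq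
    simp only [hfv, Matrix.mulVec_mulVec, Matrix.nonsing_inv_mul A hA, Matrix.one_mulVec] at this
    exact vec_injective this
  have himage : V' = V.image f := by
    have hext := extremePoints_image_unimodular hA (hull V)
    rw [hAV, hV.extremePoints_hull, hV'.extremePoints_hull, Set.image_image] at hext
    simp only [unimodular_ofInt, ← hfv] at hext
    rw [← Set.image_image (fun p => ofInt (vec p)) f] at hext
    have := (ofInt_injective.comp vec_injective).image_injective hext
    rw [← Finset.coe_image] at this
    exact Finset.coe_injective this
  rw [himage]
  unfold pairInvariant
  rw [Finset.sum_image hinj.injOn]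
  refine Finset.sum_congr rfl fun p _ => ?_
  rw [Finset.sum_image hinj.injOn]
  refine Finset.sum_congr rfl fun q _ => ?_
  have h1 : (f p).1 * (f q).2 - (f p).2 * (f q).1 = A.det * (p.1 * q.2 - p.2 * q.1) :=
    det2_mulVec A (vec p) (vec q)
  have h2 : Int.gcd ((f q).1 - (f p).1) ((f q).2 - (f p).2) = Int.gcd (q.1 - p.1) (q.2 - p.2) := by
    have := gcd_mulVec hA (vec q - vec p)
    rw [Matrix.mulVec_sub] at this
    exact this
  rw [h1, h2, mul_pow, hdet, one_mul]

end IsAdmissible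

end LDPPolygon

/-! ### LDP polygons with an edge at height two -/

namespace LDPPolygon

lemma _root_.Convex.ofInt_mem_of_smul_eq {K : Set Plane} (hK : Convex ℝ K) {a b z : Fin 2 → ℤ}
    (ha : ofInt a ∈ K) (hb : ofInt b ∈ K) {m n : ℤ} (hm : 0 ≤ m) (hn : 0 ≤ n) (hmn : 0 < m + n)
    (h : (m + n) • z = m • a + n • b) : ofInt z ∈ K := by
  have hm' : (0 : ℝ) ≤ m := by exact_mod_cast hm
  have hn' : (0 : ℝ) ≤ n := by exact_mod_cast hn
  have hs : (0 : ℝ) < m + n := by exact_mod_cast hmn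
  convert hK ha hb (a := (m / (m + n) : ℝ)) (b := (n / (m + n) : ℝ)) (by positivity)
    (by positivity) (by field_simp) using 1
  funext i
  have hi : (m + n) * z i = m * a i + n * b i := by simpa using congrFun h i
  have hi' : ((m : ℝ) + n) * z i = m * a i + n * b i := by exact_mod_cast hi
  simp only [ofInt_apply, Pi.add_apply, Pi.smul_apply, smul_eq_mul]
  field_simp
  linarith

/-- A convex set contains the lattice points between two of its points on a vertical line. -/
lemma _root_.Convex.ofInt_mem_of_vertical {K : Set Plane} (hK : Convex ℝ K) {e k l m : ℤ}
    (hk : ofInt (vec (e, k)) ∈ K) (hm : ofInt (vec (e, m)) ∈ K) (hkl : k ≤ l) (hlm : l ≤ m) :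
    ofInt (vec (e, l)) ∈ K := by
  rcases hkl.eq_or_lt with rfl | hkl
  · exact hk
  · refine hK.ofInt_mem_of_smul_eq hk hm (m := m - l) (n := l - k) (by omega) (by omega) (by omega)
      ?_
    funext i
    fin_cases i
    · simp; ring
    · simp; ring

/-- LDP polygons of Gorenstein index `2` in normal form: the segment from `(1, 2)` to
`(2 * c - 1, 2)` is an edge, and the lattice points of the polygon lie between the lines `x = 1` and
`x - c * y = -1`, which pass through the ends of this edge. -/
structure IsTopForm (c : ℤ) (Q : Set Plane) : Prop where
  isLDP : IsLDP Q
  index : gorensteinIndex Q = 2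
  right : ∀ x y : ℤ, ofInt (vec (x, y)) ∈ Q → x ≤ 1
  top : ∀ x y : ℤ, ofInt (vec (x, y)) ∈ Q → y ≤ 2
  left : ∀ x y : ℤ, ofInt (vec (x, y)) ∈ Q → -1 ≤ x - c * y
  right_mem : ofInt (vec (1, 2)) ∈ Q
  left_mem : ofInt (vec (2 * c - 1, 2)) ∈ Q

/-- `Q` is equivalent to one of the thirty polygons. -/
def IsListed (Q : Set Plane) : Prop := ∃ V ∈ vertexSets, LinearUnimodularEquiv Q (hull V)

lemma LinearUnimodularEquiv.isListed {Q Q' : Set Plane} (h : LinearUnimodularEquiv Q Q')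
    (hQ' : IsListed Q') : IsListed Q :=
  let ⟨V, hV, hQV⟩ := hQ'
  ⟨V, hV, h.trans hQV⟩

lemma isListed_hull {V : Finset (ℤ × ℤ)} (hV : V ∈ vertexSets) : IsListed (hull V) :=
  ⟨V, hV, 1, by simp, by rw [map_one_intCast]; simp⟩

namespace IsTopForm

variable {c : ℤ} {Q : Set Plane}

lemma isOriginPolygon (hQ : IsTopForm c Q) : IsOriginPolygon Q := hQ.isLDP.isOriginPolygon

lemma height_dvd (hQ : IsTopForm c Q) {u v : Fin 2 → ℤ} (h : IsStep Q u v) : det2 u v ∣ 2 := by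
  have := (denom_eq_two_iff.1 hQ.index).1
  exact (hQ.isOriginPolygon.isLatticePolygon_smul_dual_iff two_pos).1 (by exact_mod_cast this) u v h

/-- To identify a polygon, it suffices to know its vertices, which are primitive. -/
lemma eq_hull (hQ : IsTopForm c Q) {V : Finset (ℤ × ℤ)}
    (hVQ : ∀ p ∈ V, ofInt (vec p) ∈ Q)
    (h : ∀ x y : ℤ, ofInt (vec (x, y)) ∈ Q → Int.gcd x y = 1 → ofInt (vec (x, y)) ∈ hull V) :
    Q = hull V := by
  obtain ⟨S, hS, hQS⟩ := hQ.isLDP.exists_eq_hull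
  refine Set.Subset.antisymm ?_ (hull_subset hQ.isOriginPolygon.convex hVQ)
  conv_lhs => rw [hQS]
  refine hull_subset (convex_hull V) fun p hp => h p.1 p.2 ?_ (hS p hp)
  rw [hQS]
  exact mem_hull hp

lemma exists_neg (hQ : IsTopForm c Q) : ∃ x y : ℤ, ofInt (vec (x, y)) ∈ Q ∧ y < 0 := by
  obtain ⟨z, hz, hpos⟩ := hQ.isOriginPolygon.exists_lattice_det_pos (x := ofInt ![1, 0])
    (fun h => by have := congrFun h 0; simp at this)
  rw [det2_ofInt] at hpos
  refine ⟨z 0, z 1, by rwa [vec_mk], ?_⟩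
  have : 0 < det2 z ![1, 0] := by exact_mod_cast hpos
  simp [det2] at this
  exact this

lemma neg_two_le (hQ : IsTopForm c Q) (hc : c ≤ 0) : -2 ≤ c := by
  obtain ⟨x, y, h, hy⟩ := hQ.exists_neg
  have h1 := hQ.right x y h
  have h2 := hQ.left x y h
  nlinarith

lemma isListed_of_neg_two (hQ : IsTopForm (-2) Q) : IsListed Q := by
  have key : ofInt (vec (1, -1)) ∈ Q := by
    obtain ⟨x, y, h, hy⟩ := hQ.exists_neg
    have h1 := hQ.right x y h
    have h2 := hQ.left x y h
    obtain rfl : x = 1 := by omega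
    obtain rfl : y = -1 := by omega
    exact h
  have : Q = hull {(1, 2), (-5, 2), (1, -1)} := hQ.eq_hull
    (by simp only [Finset.forall_mem_insert, Finset.mem_singleton, forall_eq]
        exact ⟨hQ.right_mem, hQ.left_mem, key⟩)
    fun x y h _ => by
      have h1 := hQ.right x y h
      have h2 := hQ.left x y h
      have h3 := hQ.top x y h
      refine mem_hull_of_triangle (a := (1, 2)) (b := (-5, 2)) (c := (1, -1)) (by simp) (by simp)
        (by simp) ?_ ?_ ?_ ?_ <;> simp [det2] <;> linarith
  rw [this]
  exact isListed_hull (by decide)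

/-- For `c = -1` the position is unique up to the reflection that exchanges the two edges adjacent
to the top edge. -/
lemma reflect_neg_one (hQ : IsTopForm (-1) Q) : ∃ Q', IsTopForm (-1) Q' ∧
    LinearUnimodularEquiv Q Q' ∧
    ∀ x y : ℤ, ofInt (vec (x, y)) ∈ Q' ↔ ofInt (vec (-x - y, y)) ∈ Q := by
  set A : Matrix (Fin 2) (Fin 2) ℤ := !![-1, -1; 0, 1] with hAdef
  have hA : IsUnit A.det := by simp [hAdef, Matrix.det_fin_two]
  have hinv : ∀ x y : ℤ, A *ᵥ vec (-x - y, y) = vec (x, y) := fun x y => by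
    funext i
    fin_cases i <;> simp [hAdef, Matrix.mulVec, dotProduct, Fin.sum_univ_two]
  have hmem : ∀ x y : ℤ, ofInt (vec (x, y)) ∈ unimodular A hA '' Q ↔
      ofInt (vec (-x - y, y)) ∈ Q := fun x y => by
    rw [← hinv x y, ← unimodular_ofInt hA, (unimodular A hA).injective.mem_set_image]
  have hequiv : LinearUnimodularEquiv Q (unimodular A hA '' Q) :=
    linearUnimodularEquiv_iff.2 ⟨A, hA, rfl⟩
  refine ⟨unimodular A hA '' Q, ⟨hequiv.isLDP hQ.isLDP,
    by rw [← hequiv.gorensteinIndex_eq, hQ.index],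
    fun x y h => ?_, fun x y h => ?_, fun x y h => ?_, ?_, ?_⟩, hequiv, hmem⟩
  · have := hQ.left _ _ ((hmem x y).1 h)
    omega
  · exact hQ.top _ _ ((hmem x y).1 h)
  · have := hQ.right _ _ ((hmem x y).1 h)
    omega
  · rw [hmem]
    exact hQ.left_mem
  · rw [hmem]
    exact hQ.right_mem

lemma isListed_of_neg_one_of_mem (hQ : IsTopForm (-1) Q) (hk : ofInt (vec (1, -1)) ∈ Q) :
    IsListed Q := by
  have hR := hQ.right_mem
  have hL : ofInt (vec (-3, 2)) ∈ Q := hQ.left_mem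
  by_cases k1 : ofInt (vec (1, -2)) ∈ Q
  · have : Q = hull {(1, 2), (-3, 2), (1, -2)} := hQ.eq_hull
      (by simp only [Finset.forall_mem_insert, Finset.mem_singleton, forall_eq]
          exact ⟨hR, hL, k1⟩)
      fun x y h _ => by
        have h1 := hQ.right x y h
        have h2 := hQ.left x y h
        have h3 := hQ.top x y h
        refine mem_hull_of_triangle (a := (1, 2)) (b := (-3, 2)) (c := (1, -2)) (by simp) (by simp)
          (by simp) ?_ ?_ ?_ ?_ <;> simp [det2] <;> linarith
    rw [this]
    exact isListed_hull (by decide)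
  -- the polygon is the triangle with vertices `(1, 2)`, `(-3, 2)`, `(1, -1)`, enlarged by points on
  -- the line `x + y = -1`
  have htri : ∀ V : Finset (ℤ × ℤ), (1, 2) ∈ V → (-3, 2) ∈ V → (1, -1) ∈ V → ∀ x y : ℤ,
      ofInt (vec (x, y)) ∈ Q → 0 ≤ x + y → ofInt (vec (x, y)) ∈ hull V := by
    intro V hV1 hV2 hV3 x y h h0
    have h1 := hQ.right x y h
    have h3 := hQ.top x y h
    have hy : -1 ≤ y := by omega
    refine mem_hull_of_triangle hV1 hV2 hV3 ?_ ?_ ?_ ?_ <;> simp [det2] <;> linarith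
  have hline : ∀ x y : ℤ, ofInt (vec (x, y)) ∈ Q → 0 ≤ x + y ∨ (x = -1 - y ∧ -1 ≤ y ∧ y ≤ 2) := by
    intro x y h
    have h1 := hQ.right x y h
    have h2 := hQ.left x y h
    have h3 := hQ.top x y h
    by_cases hy : y = -2
    · obtain rfl : x = 1 := by omega
      exact absurd (hy ▸ h) k1
    · omega
  -- the points of the line `x + y = -1` that are not below a given one
  have hseg : ∀ (V : Finset (ℤ × ℤ)) (k : ℤ), (-3, 2) ∈ V → (-1 - k, k) ∈ V → ∀ y : ℤ, k ≤ y →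
      y ≤ 2 → k < 2 → ofInt (vec (-1 - y, y)) ∈ hull V := by
    intro V k hV1 hV2 y hky hy2 hk2
    refine (convex_hull V).ofInt_mem_of_smul_eq (mem_hull hV1) (mem_hull hV2) (m := y - k)
      (n := 2 - y) (by omega) (by omega) (by omega) ?_
    funext i
    fin_cases i <;> simp <;> ring
  have hcase : ∀ k : ℤ, -1 ≤ k → k ≤ 1 → ofInt (vec (-1 - k, k)) ∈ Q →
      (∀ l : ℤ, -1 ≤ l → l < k → ofInt (vec (-1 - l, l)) ∉ Q) →
      Q = hull {(1, 2), (-3, 2), (-1 - k, k), (1, -1)} := by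
    intro k hk1 hk2 hkQ hmin
    refine hQ.eq_hull ?_ fun x y h _ => ?_
    · simp only [Finset.forall_mem_insert, Finset.mem_singleton, forall_eq]
      exact ⟨hR, hL, hkQ, hk⟩
    · rcases hline x y h with h0 | ⟨rfl, h1, h2⟩
      · exact htri _ (by simp) (by simp) (by simp) x y h h0
      · refine hseg _ k (by simp) (by simp) y (not_lt.1 fun hlt => hmin y h1 hlt h) h2 (by omega)
  by_cases k2 : ofInt (vec (0, -1)) ∈ Q
  · rw [hcase (-1) le_rfl (by norm_num) k2 fun l h1 h2 => by omega]
    exact isListed_hull (by decide)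
  by_cases k3 : ofInt (vec (-1, 0)) ∈ Q
  · rw [hcase 0 (by norm_num) (by norm_num) k3 fun l h1 h2 => by
      obtain rfl : l = -1 := by omega
      exact k2]
    exact isListed_hull (by decide)
  by_cases k4 : ofInt (vec (-2, 1)) ∈ Q
  · rw [hcase 1 (by norm_num) (by norm_num) k4 fun l h1 h2 => by
      obtain rfl | rfl : l = -1 ∨ l = 0 := by omega
      · exact k2
      · exact k3]
    exact isListed_hull (by decide)
  have : Q = hull {(1, 2), (-3, 2), (1, -1)} := by
    refine hQ.eq_hull ?_ fun x y h _ => ?_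
    · simp only [Finset.forall_mem_insert, Finset.mem_singleton, forall_eq]
      exact ⟨hR, hL, hk⟩
    · rcases hline x y h with h0 | ⟨rfl, h1, h2⟩
      · exact htri _ (by simp) (by simp) (by simp) x y h h0
      · obtain rfl | rfl | rfl | rfl : y = -1 ∨ y = 0 ∨ y = 1 ∨ y = 2 := by omega
        · exact absurd h k2
        · exact absurd h k3
        · exact absurd h k4
        · exact mem_hull (V := {(1, 2), (-3, 2), (1, -1)}) (p := (-1 - 2, 2)) (by decide)
  rw [this]
  exact isListed_hull (by decide)

lemma isListed_of_neg_one (hQ : IsTopForm (-1) Q) : IsListed Q := by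
  by_cases hk : ofInt (vec (1, -1)) ∈ Q
  · exact hQ.isListed_of_neg_one_of_mem hk
  · obtain ⟨Q', hQ', hequiv, hmem⟩ := hQ.reflect_neg_one
    refine hequiv.isListed (hQ'.isListed_of_neg_one_of_mem ((hmem _ _).2 ?_))
    obtain ⟨x, y, h, hy⟩ := hQ.exists_neg
    have h1 := hQ.right x y h
    have h2 := hQ.left x y h
    rcases eq_or_ne x 1 with rfl | hx
    · exact absurd (hQ.isOriginPolygon.convex.ofInt_mem_of_vertical h hQ.right_mem (by omega)
        (by norm_num)) hk
    · obtain rfl : x = 0 := by omega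
      obtain rfl : y = -1 := by omega
      exact h

/-! ### Polygons in a strip -/

/-- The position for `c = 0` is unique up to the reflection in the vertical axis. -/
lemma reflect_zero (hQ : IsTopForm 0 Q) : ∃ Q', IsTopForm 0 Q' ∧
    LinearUnimodularEquiv Q Q' ∧
    ∀ x y : ℤ, ofInt (vec (x, y)) ∈ Q' ↔ ofInt (vec (-x, y)) ∈ Q := by
  set A : Matrix (Fin 2) (Fin 2) ℤ := !![-1, 0; 0, 1] with hAdef
  have hA : IsUnit A.det := by simp [hAdef, Matrix.det_fin_two]
  have hinv : ∀ x y : ℤ, A *ᵥ vec (-x, y) = vec (x, y) := fun x y => by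
    funext i
    fin_cases i <;> simp [hAdef, Matrix.mulVec, dotProduct, Fin.sum_univ_two]
  have hmem : ∀ x y : ℤ, ofInt (vec (x, y)) ∈ unimodular A hA '' Q ↔
      ofInt (vec (-x, y)) ∈ Q := fun x y => by
    rw [← hinv x y, ← unimodular_ofInt hA, (unimodular A hA).injective.mem_set_image]
  have hequiv : LinearUnimodularEquiv Q (unimodular A hA '' Q) :=
    linearUnimodularEquiv_iff.2 ⟨A, hA, rfl⟩
  refine ⟨unimodular A hA '' Q, ⟨hequiv.isLDP hQ.isLDP,
    by rw [← hequiv.gorensteinIndex_eq, hQ.index],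
    fun x y h => ?_, fun x y h => ?_, fun x y h => ?_, ?_, ?_⟩, hequiv, hmem⟩
  · have := hQ.left _ _ ((hmem x y).1 h)
    omega
  · exact hQ.top _ _ ((hmem x y).1 h)
  · have := hQ.right _ _ ((hmem x y).1 h)
    omega
  · rw [hmem]
    exact hQ.left_mem
  · rw [hmem]
    exact hQ.right_mem

/-- The lowest lattice point on a vertical line. -/
lemma exists_lowest (hQ : IsTopForm c Q) {e : ℤ} (he : ∃ y : ℤ, ofInt (vec (e, y)) ∈ Q) :
    ∃ s : ℤ, ofInt (vec (e, -s)) ∈ Q ∧ ∀ y : ℤ, ofInt (vec (e, y)) ∈ Q → -s ≤ y := by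
  have hfin : {y : ℤ | ofInt (vec (e, y)) ∈ Q}.Finite :=
    hQ.isOriginPolygon.finite_lattice.preimage (f := fun y => vec (e, y)) fun y _ y' _ h => by
      simpa using congrFun h 1
  obtain ⟨m, hm, hmin⟩ := hfin.exists_minimal he
  refine ⟨-m, by simpa using hm, fun y hy => ?_⟩
  rw [neg_neg]
  rcases le_total m y with h | h
  · exact h
  · exact hmin hy h

/-- The lattice points of the vertical axis that are in the hull of `stripVertices s t`: the axis
meets its lower edge at height `-(s + t) / 2`. -/
lemma axis_mem_hull_stripVertices {s t k : ℤ} (hk : k ≤ 2) (h : 0 ≤ s + t + 2 * k)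
    (hst : -4 < s + t) : ofInt (vec (0, k)) ∈ hull (stripVertices s t) := by
  have hmem : ∀ p ∈ stripVertices s t, ofInt (vec p) ∈ hull (stripVertices s t) :=
    fun p hp => mem_hull hp
  simp only [stripVertices, Finset.forall_mem_insert, Finset.mem_singleton, forall_eq] at hmem
  obtain ⟨m1, m2, m3, m4⟩ := hmem
  have hk' : (k : ℝ) ≤ 2 := by exact_mod_cast hk
  have h' : (0 : ℝ) ≤ s + t + 2 * k := by exact_mod_cast h
  have hst' : (0 : ℝ) < s + t + 4 := by
    have : (-4 : ℝ) < s + t := by exact_mod_cast hst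
    linarith
  have hconv := convex_hull (stripVertices s t)
  have hmid := hconv
    (hconv m1 m2 (a := 1 / 2) (b := 1 / 2) (by norm_num) (by norm_num) (by norm_num))
    (hconv m3 m4 (a := 1 / 2) (b := 1 / 2) (by norm_num) (by norm_num) (by norm_num))
    (a := (s + t + 2 * k) / (s + t + 4)) (b := (4 - 2 * k) / (s + t + 4)) (by positivity)
    (div_nonneg (by linarith) hst'.le) (by field_simp; ring)
  convert hmid using 1
  apply plane_ext
  · simp
  · simp
    field_simp
    ring

section strip

variable {s t : ℤ}

lemma stripVertices_subset (hQ : IsTopForm 0 Q) (hs : ofInt (vec (-1, -s)) ∈ Q)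
    (ht : ofInt (vec (1, -t)) ∈ Q) : ∀ p ∈ stripVertices s t, ofInt (vec p) ∈ Q := by
  simp only [stripVertices, Finset.forall_mem_insert, Finset.mem_singleton, forall_eq]
  exact ⟨hQ.right_mem, hQ.left_mem, hs, ht⟩

/-- A polygon in the strip is determined by the lowest points on the two boundary lines and the
primitive points of the axis. -/
lemma eq_hull_of_strip (hQ : IsTopForm 0 Q)
    (hs' : ∀ y : ℤ, ofInt (vec (-1, y)) ∈ Q → -s ≤ y)
    (ht' : ∀ y : ℤ, ofInt (vec (1, y)) ∈ Q → -t ≤ y) {V : Finset (ℤ × ℤ)}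
    (hV : stripVertices s t ⊆ V) (hVQ : ∀ p ∈ V, ofInt (vec p) ∈ Q)
    (h1 : ofInt (vec (0, 1)) ∈ hull V)
    (h2 : ofInt (vec (0, -1)) ∈ Q → ofInt (vec (0, -1)) ∈ hull V) : Q = hull V := by
  refine hQ.eq_hull hVQ fun x y h hxy => ?_
  have hx1 := hQ.right x y h
  have hx2 := hQ.left x y h
  have hy := hQ.top x y h
  obtain rfl | rfl | rfl : x = -1 ∨ x = 0 ∨ x = 1 := by omega
  · exact (convex_hull V).ofInt_mem_of_vertical
      (mem_hull (hV (by simp [stripVertices]) : (-1, -s) ∈ V))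
      (mem_hull (hV (by simp [stripVertices]) : (-1, 2) ∈ V)) (hs' y h) hy
  · rw [Int.gcd_zero_left] at hxy
    obtain rfl | rfl : y = 1 ∨ y = -1 := by omega
    · exact h1
    · exact h2 h
  · exact (convex_hull V).ofInt_mem_of_vertical
      (mem_hull (hV (by simp [stripVertices]) : (1, -t) ∈ V))
      (mem_hull (hV (by simp [stripVertices]) : (1, 2) ∈ V)) (ht' y h) hy

/-- The height of the lower edge, which divides `2`, is `(s + t) / 2` if this is an integer and
`s + t` if not. -/
lemma add_eq_two_or_four (hQ : IsTopForm 0 Q) (hs2 : -2 ≤ s) (ht2 : -2 ≤ t) (hst : 2 ≤ s + t)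
    (hQV : Q = hull (stripVertices s t)) : s + t = 2 ∨ s + t = 4 := by
  have hmem : ∀ p ∈ stripVertices s t, ofInt (vec p) ∈ Q := fun p hp => hQV ▸ mem_hull hp
  simp only [stripVertices, Finset.forall_mem_insert, Finset.mem_singleton, forall_eq] at hmem
  obtain ⟨-, -, m3, m4⟩ := hmem
  rcases Int.even_or_odd' (s + t) with ⟨n, hn | hn⟩
  · have hmid : ofInt (vec (0, -n)) ∈ Q := by
      rw [hQV]
      exact axis_mem_hull_stripVertices (by omega) (by omega) (by omega)
    have hstep : IsStep Q (vec (-1, -s)) (vec (0, -n)) := by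
      refine ⟨m3, hmid, by simp [det2]; omega, by simp [isCoprime_one_left], fun x hx => ?_⟩
      rw [hQV] at hx
      refine det2_le_of_mem_hull (fun p hp => ?_) hx
      revert p
      simp only [stripVertices, Finset.forall_mem_insert, Finset.mem_singleton, forall_eq]
      simp only [det2, vec_zero, vec_one, Pi.sub_apply]
      refine ⟨?_, ?_, ?_, ?_⟩ <;> linarith
    have := hQ.height_dvd hstep
    simp [det2] at this
    have hle := Int.le_of_dvd two_pos this
    omega
  · have hstep : IsStep Q (vec (-1, -s)) (vec (1, -t)) := by
      refine ⟨m3, m4, by simp [det2]; omega, ?_, fun x hx => ?_⟩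
      · exact ⟨s - n, -1, by simp; linarith⟩
      rw [hQV] at hx
      refine det2_le_of_mem_hull (fun p hp => ?_) hx
      revert p
      simp only [stripVertices, Finset.forall_mem_insert, Finset.mem_singleton, forall_eq]
      simp only [det2, vec_zero, vec_one, Pi.sub_apply]
      refine ⟨?_, ?_, ?_, ?_⟩ <;> linarith
    have := Int.le_of_dvd two_pos (hQ.height_dvd hstep)
    simp [det2] at this
    omega

/-- Without a lattice point on the negative half of the axis, the origin is interior only if the
lower edge passes below it. -/
lemma one_le_add (hQ : IsTopForm 0 Q)
    (hs' : ∀ y : ℤ, ofInt (vec (-1, y)) ∈ Q → -s ≤ y)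
    (ht' : ∀ y : ℤ, ofInt (vec (1, y)) ∈ Q → -t ≤ y) (h : ofInt (vec (0, -1)) ∉ Q) :
    1 ≤ s + t := by
  by_contra! hst
  obtain ⟨S, hS, hQS⟩ := hQ.isLDP.exists_eq_hull
  have hle : ∀ p ∈ S, det2 (vec p) ![2, s - t] ≤ 0 := by
    rintro ⟨x, y⟩ hp
    have hxy := hS _ hp
    have hmem : ofInt (vec (x, y)) ∈ Q := hQS ▸ mem_hull hp
    have hx1 := hQ.right x y hmem
    have hx2 := hQ.left x y hmem
    obtain rfl | rfl | rfl : x = -1 ∨ x = 0 ∨ x = 1 := by omega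
    · have := hs' y hmem
      simp [det2]
      linarith
    · simp only [Int.gcd_zero_left] at hxy
      obtain rfl | rfl : y = 1 ∨ y = -1 := by omega
      · simp [det2]
      · exact absurd hmem h
    · have := ht' y hmem
      simp [det2]
      linarith
  obtain ⟨z, hz, hpos⟩ := hQ.isOriginPolygon.exists_lattice_det_pos (x := ofInt ![2, s - t])
    (fun h => by have := congrFun h 0; simp at this)
  rw [hQS] at hz
  have := det2_le_of_mem_hull hle hz
  rw [Int.cast_zero] at this
  exact absurd hpos this.not_gt

lemma isListed_of_le (hQ : IsTopForm 0 Q) (hs : ofInt (vec (-1, -s)) ∈ Q)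
    (hs' : ∀ y : ℤ, ofInt (vec (-1, y)) ∈ Q → -s ≤ y) (ht : ofInt (vec (1, -t)) ∈ Q)
    (ht' : ∀ y : ℤ, ofInt (vec (1, y)) ∈ Q → -t ≤ y) (hst : s ≤ t) : IsListed Q := by
  have hs2 := hs' 2 hQ.left_mem
  have ht2 := ht' 2 hQ.right_mem
  have hVQ := hQ.stripVertices_subset hs ht
  rcases le_or_gt 2 (s + t) with hge | hlt
  · have hQV := hQ.eq_hull_of_strip hs' ht' subset_rfl hVQ
      (axis_mem_hull_stripVertices (by omega) (by omega) (by omega))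
      fun _ => axis_mem_hull_stripVertices (by omega) (by omega) (by omega)
    rw [hQV]
    apply isListed_hull
    have hs3 : s ≤ 2 := by
      rcases hQ.add_eq_two_or_four (by omega) (by omega) hge hQV with h | h <;> omega
    have hs4 : -2 ≤ s := by omega
    rcases hQ.add_eq_two_or_four (by omega) (by omega) hge hQV with h | h
    · obtain rfl : t = 2 - s := by omega
      obtain hs5 : s ≤ 1 := by omega
      clear * - hs4 hs5
      interval_cases s <;> decide
    · obtain rfl : t = 4 - s := by omega
      clear * - hs3 hs4
      interval_cases s <;> decide
  by_cases h : ofInt (vec (0, -1)) ∈ Q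
  · have hQV : Q = hull (insert (0, -1) (stripVertices s t)) := by
      refine hQ.eq_hull_of_strip hs' ht' (Finset.subset_insert _ _) ?_ ?_
        fun _ => mem_hull (Finset.mem_insert_self _ _)
      · rw [Finset.forall_mem_insert]
        exact ⟨h, hVQ⟩
      · refine mem_hull_of_triangle (a := (1, 2)) (b := (-1, 2)) (c := (0, -1))
          (by simp [stripVertices]) (by simp [stripVertices]) (by simp) ?_ ?_ ?_ ?_ <;>
          simp [det2]
    rw [hQV]
    apply isListed_hull
    have hs3 : s ≤ 0 := by omega
    have hs4 : -2 ≤ s := by omega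
    have ht3 : t ≤ 1 - s := by omega
    clear * - hs3 hs4 ht3 hst
    interval_cases s <;> interval_cases t <;> decide
  · have h1 := hQ.one_le_add hs' ht' h
    have hQV := hQ.eq_hull_of_strip hs' ht' subset_rfl hVQ
      (axis_mem_hull_stripVertices (by omega) (by omega) (by omega)) fun h' => absurd h' h
    rw [hQV]
    apply isListed_hull
    obtain rfl : t = 1 - s := by omega
    have hs3 : s ≤ 0 := by omega
    have hs4 : -2 ≤ s := by omega
    clear * - hs3 hs4
    interval_cases s <;> decide

end strip

lemma isListed_of_zero (hQ : IsTopForm 0 Q) : IsListed Q := by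
  obtain ⟨s, hs, hs'⟩ := hQ.exists_lowest ⟨2, hQ.left_mem⟩
  obtain ⟨t, ht, ht'⟩ := hQ.exists_lowest ⟨2, hQ.right_mem⟩
  rcases le_total s t with hst | hst
  · exact hQ.isListed_of_le hs hs' ht ht' hst
  · obtain ⟨Q', hQ', hequiv, hmem⟩ := hQ.reflect_zero
    exact hequiv.isListed (hQ'.isListed_of_le ((hmem _ _).2 ht) (fun y h => ht' y ((hmem _ _).1 h))
      ((hmem _ _).2 hs) (fun y h => hs' y ((hmem _ _).1 h)) hst)

lemma isListed (hQ : IsTopForm c Q) (hc : c ≤ 0) : IsListed Q := by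
  have := hQ.neg_two_le hc
  obtain rfl | rfl | rfl : c = -2 ∨ c = -1 ∨ c = 0 := by omega
  · exact hQ.isListed_of_neg_two
  · exact hQ.isListed_of_neg_one
  · exact hQ.isListed_of_zero

end IsTopForm

end LDPPolygon

/-! ### Normal form with respect to a vertex of the dual -/

namespace LDPPolygon

/-- Modulo `2`, a vanishing determinant of two nonzero vectors means that they agree. -/
lemma two_dvd_add_of_det2_eq_two {w d : Fin 2 → ℤ} (h : det2 w d = 2)
    (hd : IsCoprime (d 0) (d 1)) (hw : ¬(2 ∣ w 0 ∧ 2 ∣ w 1)) : 2 ∣ w 0 + d 0 ∧ 2 ∣ w 1 + d 1 := by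
  have key : ∀ a b c e : ZMod 2, a * e - b * c = 0 → ¬(a = 0 ∧ b = 0) → ¬(c = 0 ∧ e = 0) →
      a + c = 0 ∧ b + e = 0 := by decide
  have hd' : ¬(2 ∣ d 0 ∧ 2 ∣ d 1) := fun ⟨h0, h1⟩ => by
    have := hd.isUnit_of_dvd' h0 h1
    rw [Int.isUnit_iff] at this
    omega
  have hcast : ∀ n : ℤ, (2 : ℤ) ∣ n ↔ (n : ZMod 2) = 0 := fun n =>
    (ZMod.intCast_zmod_eq_zero_iff_dvd n 2).symm
  simp only [hcast, Int.cast_add] at hw hd' ⊢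
  refine key _ _ _ _ ?_ hw hd'
  have h2 : ((w 0 * d 1 - w 1 * d 0 : ℤ) : ZMod 2) = 0 := by
    rw [← hcast]
    exact dvd_of_eq h.symm
  exact_mod_cast h2

lemma exists_eq_two_smul {v : Fin 2 → ℤ} (h : 2 ∣ v 0 ∧ 2 ∣ v 1) : ∃ a, v = (2 : ℤ) • a := by
  obtain ⟨⟨a, ha⟩, b, hb⟩ := h
  refine ⟨![a, b], ?_⟩
  funext i
  fin_cases i
  · simpa using ha
  · simpa using hb

/-- If half of `M` is not a lattice polygon, then some vertex of `M` is not divisible by `2`. -/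
lemma IsOriginPolygon.exists_extremePoint_not_even {M : Set Plane} (hM : IsOriginPolygon M)
    (h : ¬IsLatticePolygon ((2⁻¹ : ℝ) • M)) :
    ∃ w ∈ bdry M, ofInt w ∈ M.extremePoints ℝ ∧ ¬(2 ∣ w 0 ∧ 2 ∣ w 1) := by
  by_contra! hcon
  refine h (isLatticePolygon_of_interior_nonempty
    (S := (2⁻¹ : ℝ) • M.extremePoints ℝ) (hM.1.finite_extremePoints.smul_set) ?_ ?_
    ⟨0, hM.zero_mem_interior_smul (by norm_num)⟩)
  · rintro _ ⟨x, hx, rfl⟩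
    obtain ⟨w, rfl⟩ := hM.1.extremePoints_subset_lattice hx
    have hw : w ∈ bdry M := ⟨extremePoints_subset hx, fun hint =>
      Set.disjoint_left.1 (disjoint_interior_extremePoints M) hint hx⟩
    obtain ⟨a, rfl⟩ := exists_eq_two_smul (hcon w hw hx)
    refine ⟨a, ?_⟩
    rw [ofInt_smul]
    change _ = (2⁻¹ : ℝ) • ((2 : ℤ) : ℝ) • ofInt a
    rw [smul_smul]
    norm_num
  · rw [convexHull_smul, hM.1.convexHull_extremePoints]

/-- Let `Q` be dual to half of `M`, and let `w` be a vertex of `M` that is not even.  The neighbours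
`u` and `v` of `w` on the boundary of `M` are even because `w` has height `2` on both sides, and
`u / 2`, `w / 2` and `v / 2` define the three lines that bound `Q` in its normal form. -/
lemma IsLDP.exists_isTopForm {Q : Set Plane} (hQ : IsLDP Q) (hg : gorensteinIndex Q = 2) :
    ∃ c Q', c ≤ 0 ∧ IsTopForm c Q' ∧ LinearUnimodularEquiv Q Q' := by
  have hden : denom (dual Q) = 2 := hg
  have hdd := hQ.isOriginPolygon.dual_dual
  obtain ⟨M, hM, hMQ⟩ := exists_eq_half_smul hden.dvd
    (zero_mem_interior_dual hQ.isOriginPolygon.isCompact.isBounded)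
  have hQM : Q = dual ((2⁻¹ : ℝ) • M) := by rw [← hMQ, hdd]
  have hH : HeightTwo M := hM.isLDP_dual_iff.1 (hQM ▸ hQ)
  obtain ⟨w, hwb, hwext, hwodd⟩ := hM.exists_extremePoint_not_even
    (hMQ ▸ (denom_eq_two_iff.1 hden).2)
  obtain ⟨u, huw⟩ := hM.exists_prev hwb
  obtain ⟨v, hwv⟩ := hM.exists_step hwb
  have eu := hH u w huw
  have ev := hH w v hwv
  -- the neighbours of `w` are even
  obtain ⟨a, rfl⟩ : ∃ a, v = (2 : ℤ) • a := by
    have := two_dvd_add_of_det2_eq_two (hwv.det_left.trans ev) hwv.coprime hwodd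
    exact exists_eq_two_smul (by simpa using this)
  obtain ⟨b, rfl⟩ : ∃ b, u = (2 : ℤ) • b := by
    have := two_dvd_add_of_det2_eq_two (huw.det_right.trans eu) huw.coprime hwodd
    simp only [Pi.sub_apply] at this
    exact exists_eq_two_smul (by omega)
  have hwa : det2 w a = 1 := by
    simp [det2] at ev ⊢
    linarith
  have hbw : det2 b w = 1 := by
    simp [det2] at eu ⊢
    linarith
  obtain ⟨c, hc⟩ : ∃ c : ℤ, a + b = c • w := by
    refine exists_eq_smul_of_det2_eq_zero ⟨-b 1, b 0, ?_⟩ ?_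
    · rw [← hbw]
      simp [det2]
      ring
    · have : det2 w (a + b) = det2 w a - det2 b w := by
        simp [det2]
        ring
      rw [this, hwa, hbw, sub_self]
  obtain rfl : a = c • w - b := by rw [← hc, add_sub_cancel_right]
  have hbw' : b 0 * w 1 - b 1 * w 0 = 1 := hbw
  have hc1 : c ≤ 1 := by
    have h := huw.le_int hwv.right_mem
    rw [eu] at h
    simp [det2] at h
    nlinarith
  have hc0 : c ≠ 1 := by
    rintro rfl
    -- otherwise `w` is the midpoint of its neighbours
    have hmid : ofInt w ∈ openSegment ℝ (ofInt ((2 : ℤ) • b))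
        (ofInt ((2 : ℤ) • ((1 : ℤ) • w - b))) := by
      refine ⟨1 / 2, 1 / 2, by norm_num, by norm_num, by norm_num, ?_⟩
      funext i
      simp
    have := (mem_extremePoints_iff_left.1 hwext).2 _ huw.left_mem _ hwv.right_mem hmid
    rw [← ofInt_injective this] at eu
    simp [det2] at eu
    linarith
  -- the pairing of a lattice point of `Q` with a lattice point of `M`
  have hpair : ∀ z y : Fin 2 → ℤ, ofInt z ∈ Q → ofInt y ∈ M → -2 ≤ z 0 * y 0 + z 1 * y 1 := by
    intro z y hz hy
    rw [hQM] at hz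
    have h := hz _ (Set.smul_mem_smul_set hy)
    simp only [dotProduct, Fin.sum_univ_two, Pi.smul_apply, smul_eq_mul, ofInt_apply] at h
    have h' : (-2 : ℝ) ≤ z 0 * y 0 + z 1 * y 1 := by linarith
    exact_mod_cast h'
  have hvert : ∀ x y : Fin 2 → ℤ, IsStep M x y → ofInt (stepNormal x y) ∈ Q := by
    intro x y h
    rw [hQM]
    have := hM.dualVertices_subset (t := 2⁻¹) (by norm_num) ⟨x, y, h, rfl⟩
    rw [hH x y h] at this
    simpa using this
  set A : Matrix (Fin 2) (Fin 2) ℤ := !![-b 0, -b 1; -w 0, -w 1] with hAdef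
  have hdet : A.det = 1 := by
    rw [hAdef, Matrix.det_fin_two_of]
    linarith
  have hA : IsUnit A.det := by rw [hdet]; exact isUnit_one
  have hAz : ∀ z : Fin 2 → ℤ, A *ᵥ z = vec (-(b 0 * z 0 + b 1 * z 1), -(w 0 * z 0 + w 1 * z 1)) :=
    fun z => by
      funext i
      fin_cases i <;> simp [hAdef, Matrix.mulVec, dotProduct, Fin.sum_univ_two] <;> ring
  have hmem : ∀ x y : ℤ, ofInt (vec (x, y)) ∈ unimodular A hA '' Q → ∃ z : Fin 2 → ℤ,
      ofInt z ∈ Q ∧ x = -(b 0 * z 0 + b 1 * z 1) ∧ y = -(w 0 * z 0 + w 1 * z 1) := by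
    intro x y h
    refine ⟨A⁻¹ *ᵥ vec (x, y), ?_, ?_⟩
    · rw [← (unimodular A hA).injective.mem_set_image, unimodular_ofInt, Matrix.mulVec_mulVec,
        Matrix.mul_nonsing_inv A hA, Matrix.one_mulVec]
      exact h
    · have := hAz (A⁻¹ *ᵥ vec (x, y))
      rw [Matrix.mulVec_mulVec, Matrix.mul_nonsing_inv A hA, Matrix.one_mulVec] at this
      exact Prod.ext_iff.1 (vec_injective this)
  have hequiv : LinearUnimodularEquiv Q (unimodular A hA '' Q) :=
    linearUnimodularEquiv_iff.2 ⟨A, hA, rfl⟩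
  refine ⟨c, unimodular A hA '' Q, by omega, ⟨hequiv.isLDP hQ,
    by rw [← hequiv.gorensteinIndex_eq, hg], fun x y h => ?_, fun x y h => ?_, fun x y h => ?_,
    ?_, ?_⟩, hequiv⟩
  · obtain ⟨z, hz, rfl, rfl⟩ := hmem x y h
    have := hpair z _ hz huw.left_mem
    simp at this
    linarith
  · obtain ⟨z, hz, rfl, rfl⟩ := hmem x y h
    have := hpair z _ hz huw.right_mem
    linarith
  · obtain ⟨z, hz, rfl, rfl⟩ := hmem x y h
    have := hpair z _ hz hwv.right_mem
    simp at this
    linarith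
  · refine ⟨_, hvert _ _ huw, ?_⟩
    rw [unimodular_ofInt, hAz]
    congr 2
    simp [stepNormal]
    constructor <;> linarith
  · refine ⟨_, hvert _ _ hwv, ?_⟩
    rw [unimodular_ofInt, hAz]
    congr 2
    simp [stepNormal]
    constructor
    · linear_combination (2 * c - 1) * hbw'
    · linear_combination 2 * hbw'

/-- The classification of the LDP polygons of Gorenstein index `2`. -/
lemma IsLDP.isListed {Q : Set Plane} (hQ : IsLDP Q) (hg : gorensteinIndex Q = 2) : IsListed Q := by
  obtain ⟨c, Q', hc, hQ', hequiv⟩ := hQ.exists_isTopForm hg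
  exact hequiv.isListed (hQ'.isListed hc)

/-! ### The matching of the two classifications -/

/-- The thirty LDP polygons of Gorenstein index `2`. -/
noncomputable def listedPolygon (j : Fin 30) : Set Plane :=
  hull (vertexSets.get (j.cast length_vertexSets.symm))

lemma isAdmissible_get (j : Fin 30) :
    IsAdmissible (vertexSets.get (j.cast length_vertexSets.symm)) :=
  isAdmissible_of_mem_vertexSets (List.get_mem _ _)

lemma isLDP_listedPolygon (j : Fin 30) : IsLDP (listedPolygon j) := (isAdmissible_get j).isLDP_hull

lemma gorensteinIndex_listedPolygon (j : Fin 30) : gorensteinIndex (listedPolygon j) = 2 :=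
  (isAdmissible_get j).gorensteinIndex_hull

lemma IsLDP.existsUnique_listedPolygon {Q : Set Plane} (hQ : IsLDP Q)
    (hg : gorensteinIndex Q = 2) : ∃! j, LinearUnimodularEquiv Q (listedPolygon j) := by
  obtain ⟨V, hV, hQV⟩ := hQ.isListed hg
  obtain ⟨i, rfl⟩ := List.mem_iff_get.1 hV
  refine ⟨i.cast length_vertexSets, hQV, fun j hj => ?_⟩
  have hinv := (isAdmissible_get j).pairInvariant_eq (isAdmissible_of_mem_vertexSets hV)
    (hj.symm.trans hQV)
  have hnodup := pairInvariant_nodup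
  rw [List.nodup_iff_injective_get] at hnodup
  have := @hnodup (j.cast (by simp [length_vertexSets])) (i.cast (by simp)) (by simpa using hinv)
  simpa [Fin.ext_iff] using this

lemma isHalfIntegralReflexive_dual_listedPolygon (j : Fin 30) :
    IsHalfIntegralReflexive (dual (listedPolygon j)) :=
  (isLDP_listedPolygon j).isHalfIntegralReflexive_dual (gorensteinIndex_listedPolygon j)

lemma dual_dual_listedPolygon (j : Fin 30) : dual (dual (listedPolygon j)) = listedPolygon j :=
  (isLDP_listedPolygon j).isOriginPolygon.dual_dual

/-- Equivalent polygons have equivalent duals, so that the classification of the LDP polygons gives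
that of their duals. -/
lemma existsUnique_dual_listedPolygon {P : Set Plane} (hP : IsRationalPolygon P)
    (hd : denom P = 2) (hps : IsPseudoIntegral P) (hi : interiorLatticePoints P = 1) :
    ∃! j, AffineUnimodularEquiv P (dual (listedPolygon j)) := by
  obtain ⟨w, hw⟩ := exists_vadd_isHalfIntegralReflexive hP hd hps hi
  have hiff : ∀ j, AffineUnimodularEquiv P (dual (listedPolygon j)) ↔
      LinearUnimodularEquiv (dual (ofInt w +ᵥ P)) (listedPolygon j) := fun j => by
    rw [affineUnimodularEquiv_iff hw.interior_eq
      (isHalfIntegralReflexive_dual_listedPolygon j).interior_eq]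
    refine ⟨fun h => dual_dual_listedPolygon j ▸ h.dual, fun h => ?_⟩
    have := h.dual
    rwa [hw.dual_dual] at this
  simp only [hiff]
  exact hw.isLDP_dual.existsUnique_listedPolygon hw.gorensteinIndex_dual

end LDPPolygon

theorem mainTheorem6 :
    -- the five conditions are equivalent
    (∀ P : Set Plane, IsRationalPolygon P → denom P ∣ 2 → (0 : Plane) ∈ interior P →
      List.TFAE [
        IsLDP (dual P),
        ∀ E, IsEdge P E → HasLatticeDist E 0 1,
        (∀ k : ℕ, latticePoints ((k : ℝ) • P) = interiorLatticePoints (((k : ℝ) + 1) • P)) ∧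
          ∀ E, IsEdge P E → ((affineSpan ℝ E : Set Plane) ∩ lattice).Nonempty,
        ∃ q : QuasiPolynomial 2, IsEhrhart P q ∧
          ∀ t : ℤ, (q.eval t : ℝ) = area P * (t : ℝ) ^ 2 + area P * (t : ℝ) + 1,
        interior P ∩ lattice = {0} ∧ IsPseudoIntegral P]) ∧
    -- the pseudo-integral polygons of denominator 2 whose only interior lattice point is the
    -- origin are exactly the duals of the LDP polygons of Gorenstein index 2, and vice versa
    (∀ P : Set Plane,
      (IsRationalPolygon P ∧ denom P = 2 ∧ IsPseudoIntegral P ∧ interior P ∩ lattice = {0}) ↔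
        ∃ Q : Set Plane, IsLDP Q ∧ gorensteinIndex Q = 2 ∧ P = dual Q) ∧
    (∀ Q : Set Plane,
      (IsLDP Q ∧ gorensteinIndex Q = 2) ↔
        ∃ P : Set Plane, (IsRationalPolygon P ∧ denom P = 2 ∧ IsPseudoIntegral P ∧
          interior P ∩ lattice = {0}) ∧ Q = dual P) ∧
    -- there are exactly 30 of either kind up to equivalence, and duality matches them
    (∃ R : Fin 30 → Set Plane,
      (∀ j, IsRationalPolygon (R j) ∧ denom (R j) = 2 ∧ IsPseudoIntegral (R j) ∧
        interior (R j) ∩ lattice = {0}) ∧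
      (∀ j, IsLDP (dual (R j)) ∧ gorensteinIndex (dual (R j)) = 2) ∧
      (∀ P : Set Plane, IsRationalPolygon P → denom P = 2 → IsPseudoIntegral P →
        interiorLatticePoints P = 1 → ∃! j, AffineUnimodularEquiv P (R j)) ∧
      (∀ Q : Set Plane, IsLDP Q → gorensteinIndex Q = 2 →
        ∃! j, LinearUnimodularEquiv Q (dual (R j)))) := by 
  refine ⟨fun P _ hd h0 => ?_, fun P => ?_, fun Q => ?_, fun j => dual (listedPolygon j),
    fun j => isHalfIntegralReflexive_iff.1 (isHalfIntegralReflexive_dual_listedPolygon j),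
    fun j => ?_, fun P => existsUnique_dual_listedPolygon, fun Q hQ hg => ?_⟩
  · obtain ⟨M, hM, rfl⟩ := exists_eq_half_smul hd h0
    exact hM.tfae_half
  · rw [← isHalfIntegralReflexive_iff]
    refine ⟨fun hP => ⟨dual P, hP.isLDP_dual, hP.gorensteinIndex_dual, hP.dual_dual.symm⟩, ?_⟩
    rintro ⟨Q, hQ, hg, rfl⟩
    exact hQ.isHalfIntegralReflexive_dual hg
  · simp only [← isHalfIntegralReflexive_iff]
    refine ⟨fun ⟨hQ, hg⟩ => ⟨dual Q, hQ.isHalfIntegralReflexive_dual hg,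
      hQ.isOriginPolygon.dual_dual.symm⟩, ?_⟩
    rintro ⟨P, hP, rfl⟩
    exact ⟨hP.isLDP_dual, hP.gorensteinIndex_dual⟩
  · rw [dual_dual_listedPolygon]
    exact ⟨isLDP_listedPolygon j, gorensteinIndex_listedPolygon j⟩
  · simp only [dual_dual_listedPolygon]
    exact hQ.existsUnique_listedPolygon hg
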